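/- **Setting.** Let $n\ge p\ge 1$, $\ell\ge 2$, $\tau\ge 0$, $L>0$. Let $\langle\xi,\eta\rangle=\mathrm{tr}(\xi^\top\eta)$ and $\|\cdot\|$ be the Frobenius inner product and norm, $\mathrm{St}(n,p)=\{X\in\mathbb R^{n\times p}: X^\top X=I\}$, and let $f:\mathbb R^{n\times p}\to\mathbb R$ be such that, on some bounded convex neighborhood of $\mathrm{St}(n,p)$, $f+\frac{\tau}{2}\|\cdot\|^2$ is convex and $f$ is $L$-Lipschitz. Let $\partial f$ be the Clarke subdifferential. Let $\mathfrak C=\{C_1,\dots,C_\ell\}$ be a partition of $[p]$. For $C\subseteq[p]$, $X_C$ is the submatrix of the columns of $X$ with index in $C$; write $C_{ij}=C_i\cup C_j$, $X_{ij}=X_{C_{ij}}$, $X_{-ij}=X_{[p]\setminus C_{ij}}$, $I_{ij}=I_{C_{ij}}$. For a set $\mathcal S$ of matrices, $\mathcal P_{\mathcal S}$ is the nearest-point projection. Put $\mathcal M_{X_{-ij}}=\{Y: Y^\top Y=I,\ X_{-ij}^\top Y=0\}$, with tangent space $T_{X_{ij}}\mathcal M_{X_{-ij}}=\{\xi:\xi^\top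 X_{ij}+X_{ij}^\top\xi=0,\ X_{-ij}^\top\xi=0\}$. **Algorithm (RSSM).** Start from a deterministic $X^0\in\mathrm{St}(n,p)$, with stepsizes $\gamma_k\in(0,\frac1L)$. At iteration $k=0,1,2,\dots$ a Euclidean subgradient $\widetilde\nabla f(X^k)\in\partial f(X^k)$ is chosen on the basis of the information available before the $k$-th draw; an unordered pair $\{i,j\}\subseteq[\ell]$, $i\ne j$, is drawn uniformly at random, independently of that information; with $D^k=\mathcal P_{T_{X^k_{ij}}\mathcal M_{X^k_{-ij}}}\big((\widetilde\nabla f(X^k))_{C_{ij}}\big)$ one sets $$X^{k+1}_{ij}=\mathcal P_{\mathcal M_{X^k_{-ij}}}\big(X^k_{ij}-\gamma_kD^k\big),\qquad X^{k+1}_{-ij}=X^k_{-ij}.$$ **Stationarity measure.** For $X\in\mathrm{St}(n,p)$ let $\mathcal A_X(\xi)=\binom{\ell}{2}^{-1}\sum_{\{i,j\}}(I-X_{-ij}X_{-ij}^\top)\xi_{ij}I_{ij}^\top$ (a positive definite operator), $\|\xi\|_{\mathcal A_X^{-1}}=\sqrt{\langle\mathcal A_X^{-1}(\xi),\xi\rangle}$,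 and let $f_\lambda^{\mathfrak C}(X)$ be the minimum and $P^{\mathfrak C}_{\lambda f}(X)$ the minimizer of $Y\mapsto f(Y)+\frac1{2\lambda}\|Y-X\|^2_{\mathcal A_X^{-1}}$ over $Y\in\mathrm{St}(n,p)$. Put $\Theta^{\mathfrak C}_{\lambda f}(X)=\frac1\lambda\|P^{\mathfrak C}_{\lambda f}(X)-X\|_{\mathcal A_X^{-1}}$. **Theorem.** Let $\lambda\in\big(0,\frac{\ell}{2(\tau+(2\ell-1)L)}\big)$ and $T\ge1$. Then the minimizer $P^{\mathfrak C}_{\lambda f}(X)$ exists and is unique for every $X\in\mathrm{St}(n,p)$, the random variables $\Theta^{\mathfrak C}_{\lambda f}(X^k)$ are square integrable, and the following hold. (a) If $\gamma_k=\frac{\Delta}{\sqrt{\ell(T+1)}}$ for $k=0,\dots,T$, where $\Delta\in(0,\frac1L]$, then $$\min_{0\le k\le T}\mathbb E[\Theta_{\lambda f}^{\mathfrak C}(X^k)^2]\le\frac{f_\lambda^{\mathfrak C}(X^0)-\min_{X\in\mathrm{St}(n,p)}f_\lambda^{\mathfrak C}(X)+\frac{9L^2\Delta^2}{2\lambda\ell}+\frac{2L^3\Delta^3}{\lambda\sqrt{\ell(T+1)}}+\frac{L^4\Delta^4}{2\lambda\ell(T+1)}}{\frac\lambda\ell\left(\frac{\ell}{2\lambda}-(\tau+(2\ell-3)L)\right)\frac{\Delta}{\sqrt\ell}\sqrt{T+1}}.$$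 (b) If $\gamma_k=\frac{\Delta_k}{\sqrt{\ell(k+1)}}$ with $\Delta_k\in[\Delta_{\min},\frac1L]$ for $k=0,\dots,T$, where $\Delta_{\min}>0$, then $$\min_{0\le k\le T}\mathbb E[\Theta_{\lambda f}^{\mathfrak C}(X^k)^2]\le\frac{f_\lambda^{\mathfrak C}(X^0)-\min_{X\in\mathrm{St}(n,p)}f_\lambda^{\mathfrak C}(X)+\frac{9(1+\log T)+6\sqrt\ell+2}{2\lambda\ell}}{\frac\lambda\ell\left(\frac{\ell}{2\lambda}-(\tau+(2\ell-3)L)\right)\frac{\Delta_{\min}}{\sqrt\ell}\sqrt{T+1}}.$$ (c) If $\lambda=\frac{\ell}{4(\tau+(2\ell-1)L)}$ and $T\ge\ell-1$, then, with the stepsizes of (a), $$\min_{0\le k\le T}\mathbb E[\Theta_{\lambda f}^{\mathfrak C}(X^k)]\le\sqrt{\frac{f_\lambda^{\mathfrak C}(X^0)-\min_{X\in\mathrm{St}(n,p)}f_\lambda^{\mathfrak C}(X)+\frac{9}{2\lambda\ell}+\frac{2}{\lambda\ell}+\frac{1}{2\lambda\ell^2}}{\frac\lambda\ell\left(\frac{\ell}{2\lambda}-\frac{\ell}{4\lambda}\right)\frac{\Delta}{\sqrt\ell}\sqrt{T+1}}}.$$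 (d) (Iteration complexity $\mathcal O(\ell\varepsilon^{-4})$.) For all $\tau\ge0$, $L>0$, $\Delta\in(0,\frac1L]$ and $B\in\mathbb R$ there is a constant $K>0$, depending only on these, such that in every instance of the above setting with $f(X^0)-\min_{X\in\mathrm{St}(n,p)}f(X)\le B$, for $\lambda=\frac{\ell}{4(\tau+(2\ell-1)L)}$, every $\varepsilon>0$, every integer $T\ge1$ with $T\ge K\ell\varepsilon^{-4}$, and the stepsizes of (a), one has $\min_{0\le k\le T}\mathbb E[\Theta_{\lambda f}^{\mathfrak C}(X^k)]\le\varepsilon$. -/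

import Mathlib

open scoped Matrix Topology ENNReal
open MeasureTheory ProbabilityTheory Filter

universe u

noncomputable section

namespace RSSM

/-- Frobenius inner product `tr(ξᵀ η)`. -/
def frobInner {m ι : Type*} [Fintype m] [Fintype ι] (ξ η : Matrix m ι ℝ) : ℝ :=
  (ξᵀ * η).trace

/-- Frobenius norm. -/
def frobNorm {m ι : Type*} [Fintype m] [Fintype ι] (ξ : Matrix m ι ℝ) : ℝ :=
  Real.sqrt (frobInner ξ ξ)

/-- The Stiefel manifold of matrices with orthonormal columns (columns indexed by `ι`). -/
def stiefel (n : ℕ) (ι : Type*) [DecidableEq ι] : Set (Matrix (Fin n) ι ℝ) :=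
  {X | Xᵀ * X = 1}

/-- The (set-valued) projection of `Z` onto `S` with respect to the Frobenius norm. -/
def projSet {m ι : Type*} [Fintype m] [Fintype ι] (S : Set (Matrix m ι ℝ)) (Z : Matrix m ι ℝ) :
    Set (Matrix m ι ℝ) :=
  {Y | Y ∈ S ∧ ∀ W ∈ S, frobNorm (Z - Y) ≤ frobNorm (Z - W)}

/-- The submatrix `X_C` formed by the columns with index in `C`. -/
def cols {m : Type*} {p : ℕ} (X : Matrix m (Fin p) ℝ) (C : Finset (Fin p)) :
    Matrix m {j // j ∈ C} ℝ :=
  X.submatrix id Subtype.val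

/-- `f` is `τ`-weakly convex and `L`-Lipschitz on some bounded convex neighborhood of the
Stiefel manifold. -/
def WeaklyConvexLipschitz {n p : ℕ} (f : Matrix (Fin n) (Fin p) ℝ → ℝ) (τ L : ℝ) : Prop :=
  ∃ U : Set (Matrix (Fin n) (Fin p) ℝ),
    U ∈ 𝓝ˢ (stiefel n (Fin p)) ∧
    (∃ R : ℝ, ∀ X ∈ U, frobNorm X ≤ R) ∧
    ConvexOn ℝ U (fun X => f X + τ / 2 * frobNorm X ^ 2) ∧
    ∀ X ∈ U, ∀ Y ∈ U, |f X - f Y| ≤ L * frobNorm (X - Y)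

/-- Clarke's generalized directional derivative
`f°(X; V) = limsup_{Y → X, t ↓ 0} (f(Y + tV) - f(Y)) / t`. -/
def clarkeDeriv {n p : ℕ} (f : Matrix (Fin n) (Fin p) ℝ → ℝ)
    (X V : Matrix (Fin n) (Fin p) ℝ) : EReal :=
  limsup (fun q : Matrix (Fin n) (Fin p) ℝ × ℝ =>
    (((f (q.1 + q.2 • V) - f q.1) / q.2 : ℝ) : EReal)) (𝓝 X ×ˢ 𝓝[>] (0 : ℝ))

/-- The Clarke subdifferential. -/
def clarkeSubdiff {n p : ℕ} (f : Matrix (Fin n) (Fin p) ℝ → ℝ)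
    (X : Matrix (Fin n) (Fin p) ℝ) : Set (Matrix (Fin n) (Fin p) ℝ) :=
  {G | ∀ V, ((frobInner G V : ℝ) : EReal) ≤ clarkeDeriv f X V}

/-- The submanifold block at `X` with respect to `C`. -/
def submanifoldBlock {n p : ℕ} (X : Matrix (Fin n) (Fin p) ℝ) (C : Finset (Fin p)) :
    Set (Matrix (Fin n) {j // j ∈ C} ℝ) :=
  {Y | Y ∈ stiefel n {j // j ∈ C} ∧ (cols X Cᶜ)ᵀ * Y = 0}

/-- The tangent space at `X_C` to the submanifold block at `X` with respect to `C`. -/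
def tangentBlock {n p : ℕ} (X : Matrix (Fin n) (Fin p) ℝ) (C : Finset (Fin p)) :
    Set (Matrix (Fin n) {j // j ∈ C} ℝ) :=
  {ξ | ξᵀ * cols X C + (cols X C)ᵀ * ξ = 0 ∧ (cols X Cᶜ)ᵀ * ξ = 0}

/-- `C 0, …, C (ℓ - 1)` is a partition of the column index set. -/
def IsBlockPartition {p ℓ : ℕ} (C : Fin ℓ → Finset (Fin p)) : Prop :=
  (∀ i j, i ≠ j → Disjoint (C i) (C j)) ∧ ∀ a, ∃ i, a ∈ C i

/-- The unordered pairs `{i, j}` with `i ≠ j`. -/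
def blockPairs (ℓ : ℕ) : Finset (Finset (Fin ℓ)) :=
  Finset.powersetCard 2 Finset.univ

/-- One step of the method from `X` to `X'` on the columns in `C`: project the `C`-columns of the
subgradient `G` to the tangent space of the block, move along the negative of the result with
stepsize `γ`, project back to the block; the other columns are kept. -/
def IsStep {n p : ℕ} (X G : Matrix (Fin n) (Fin p) ℝ) (C : Finset (Fin p)) (γ : ℝ)
    (X' : Matrix (Fin n) (Fin p) ℝ) : Prop :=
  ∃ D ∈ projSet (tangentBlock X C) (cols G C),
    cols X' C ∈ projSet (submanifoldBlock X C) (cols X C - γ • D) ∧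
    cols X' Cᶜ = cols X Cᶜ

/-- A run of the randomized submanifold subgradient method with stepsizes `γ k ∈ (0, 1/L)`,
started at the deterministic point `X₀`. The σ-algebra `ℱ k` is the information available before
the `k`-th pair is drawn; `X k` is the iterate, `G k` the Euclidean subgradient used at it, and
`S k` the pair, drawn uniformly and independently of `ℱ k`. -/
structure IsRun {n p ℓ : ℕ} {Ω : Type*} {mΩ : MeasurableSpace Ω} (μ : Measure Ω)
    (ℱ : Filtration ℕ mΩ) (f : Matrix (Fin n) (Fin p) ℝ → ℝ) (L : ℝ)
    (C : Fin ℓ → Finset (Fin p)) (γ : ℕ → ℝ) (X₀ : Matrix (Fin n) (Fin p) ℝ)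
    (X G : ℕ → Ω → Matrix (Fin n) (Fin p) ℝ) (S : ℕ → Ω → Finset (Fin ℓ)) : Prop where
  stepsize_pos : ∀ k, 0 < γ k
  stepsize_lt : ∀ k, γ k < 1 / L
  init_mem : X₀ ∈ stiefel n (Fin p)
  init_eq : ∀ ω, X 0 ω = X₀
  adapted_iterate : ∀ k, StronglyMeasurable[ℱ k] (X k)
  adapted_subgradient : ∀ k, StronglyMeasurable[ℱ k] (G k)
  subgradient_mem : ∀ k ω, G k ω ∈ clarkeSubdiff f (X k ω)
  pair_mem : ∀ k ω, S k ω ∈ blockPairs ℓ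
  pair_measurable : ∀ k, Measurable[mΩ, ⊤] (S k)
  pair_uniform : ∀ k, ∀ s ∈ blockPairs ℓ, μ.real {ω | S k ω = s} = 1 / (ℓ.choose 2 : ℝ)
  pair_indep : ∀ k, Indep (MeasurableSpace.comap (S k) ⊤) (ℱ k) μ
  step : ∀ k ω, IsStep (X k ω) (G k ω) ((S k ω).biUnion C) (γ k) (X (k + 1) ω)

/-- The averaging operator
`𝒜_X(ξ) = binom(ℓ,2)⁻¹ ∑_{i,j} (I - X_{-ij} X_{-ij}ᵀ) ξ_{ij} I_{ij}ᵀ`. -/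
def avgOp {n p ℓ : ℕ} (C : Fin ℓ → Finset (Fin p)) (X : Matrix (Fin n) (Fin p) ℝ) :
    Module.End ℝ (Matrix (Fin n) (Fin p) ℝ) where
  toFun ξ := (1 / (ℓ.choose 2 : ℝ)) • ∑ s ∈ blockPairs ℓ,
    (1 - cols X (s.biUnion C)ᶜ * (cols X (s.biUnion C)ᶜ)ᵀ) * cols ξ (s.biUnion C) *
      (cols (1 : Matrix (Fin p) (Fin p) ℝ) (s.biUnion C))ᵀ
  map_add' ξ η := by
    have h : ∀ D : Finset (Fin p), cols (ξ + η) D = cols ξ D + cols η D := fun _ => rfl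
    simp only [h, Matrix.mul_add, Matrix.add_mul, Finset.sum_add_distrib, smul_add]
  map_smul' c ξ := by
    have h : ∀ D : Finset (Fin p), cols (c • ξ) D = c • cols ξ D := fun _ => rfl
    simp only [h, Matrix.mul_smul, Matrix.smul_mul, ← Finset.smul_sum, RingHom.id_apply]
    rw [smul_comm]

/-- The Mahalanobis norm `‖ξ‖_{𝒜_X⁻¹} = √⟨𝒜_X⁻¹(ξ), ξ⟩`; the averaging operator is invertible
whenever `X` lies on the Stiefel manifold and `ℓ ≥ 2`. -/
def mahalNorm {n p ℓ : ℕ} (C : Fin ℓ → Finset (Fin p)) (X ξ : Matrix (Fin n) (Fin p) ℝ) : ℝ :=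
  Real.sqrt (frobInner (Ring.inverse (avgOp C X) ξ) ξ)

/-- The objective `f(Y) + ‖Y - X‖²_{𝒜_X⁻¹} / (2λ)` of the adaptive proximal problem. -/
def proxObj {n p ℓ : ℕ} (f : Matrix (Fin n) (Fin p) ℝ → ℝ) (C : Fin ℓ → Finset (Fin p)) (lam : ℝ)
    (X Y : Matrix (Fin n) (Fin p) ℝ) : ℝ :=
  f Y + 1 / (2 * lam) * mahalNorm C X (Y - X) ^ 2

/-- The adaptive Moreau envelope. -/
def moreau {n p ℓ : ℕ} (f : Matrix (Fin n) (Fin p) ℝ → ℝ) (C : Fin ℓ → Finset (Fin p)) (lam : ℝ)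
    (X : Matrix (Fin n) (Fin p) ℝ) : ℝ :=
  sInf (proxObj f C lam X '' stiefel n (Fin p))

/-- The minimum of the adaptive Moreau envelope over the Stiefel manifold. -/
def moreauMin {n p ℓ : ℕ} (f : Matrix (Fin n) (Fin p) ℝ → ℝ) (C : Fin ℓ → Finset (Fin p))
    (lam : ℝ) : ℝ :=
  sInf (moreau f C lam '' stiefel n (Fin p))

/-- The adaptive proximal map, as a set of minimizers. -/
def proxSet {n p ℓ : ℕ} (f : Matrix (Fin n) (Fin p) ℝ → ℝ) (C : Fin ℓ → Finset (Fin p)) (lam : ℝ)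
    (X : Matrix (Fin n) (Fin p) ℝ) : Set (Matrix (Fin n) (Fin p) ℝ) :=
  {Y | Y ∈ stiefel n (Fin p) ∧ ∀ Z ∈ stiefel n (Fin p), proxObj f C lam X Y ≤ proxObj f C lam X Z}

/-- The adaptive proximal map as a point (the unique minimizer when it is unique). -/
def prox {n p ℓ : ℕ} (f : Matrix (Fin n) (Fin p) ℝ → ℝ) (C : Fin ℓ → Finset (Fin p)) (lam : ℝ)
    (X : Matrix (Fin n) (Fin p) ℝ) : Matrix (Fin n) (Fin p) ℝ :=
  Classical.epsilon (fun Y => Y ∈ proxSet f C lam X)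

/-- The surrogate stationarity measure. -/
def surrogate {n p ℓ : ℕ} (f : Matrix (Fin n) (Fin p) ℝ → ℝ) (C : Fin ℓ → Finset (Fin p))
    (lam : ℝ) (X : Matrix (Fin n) (Fin p) ℝ) : ℝ :=
  1 / lam * mahalNorm C X (prox f C lam X - X)

/-- The minimum of `a 0, …, a T`. -/
def minUpTo (T : ℕ) (a : ℕ → ℝ) : ℝ :=
  (Finset.range (T + 1)).inf' Finset.nonempty_range_add_one a

end RSSM

end

/-!
The complexity bounds come from a descent inequality for the adaptive Moreau envelope along the
random block steps. Write `W = Z - X`, where `X` is an iterate, `G` the chosen subgradient and `Z`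
the proximal point of `X`.

**The metric.** For orthonormal `X` the averaging operator has the explicit inverse
`A_X⁻¹ ξ = (ℓ/2) (ξ + (ℓ-2) X · offBlock (Xᵀ ξ))`, where `offBlock` deletes the diagonal blocks
(`inverse_avgOp`): a pair of blocks moves a given column with probability `2/ℓ`, but moves both
columns of an off-diagonal entry of `Xᵀ ξ` only with the much smaller probability `1/(ℓ choose 2)`.

**One step.** Projecting the columns of a pair is a polar projection, so in full-size matrices the
new iterate satisfies `X' (1 + R) = X - γ D` with `R` positive semidefinite, symmetric and of second
order in `γ` (`IsStep.exists_factor`). Comparing the envelope at `X'` with the value of the proximal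
objective of `X'` at the old proximal point `Z` bounds its growth by terms which are explicit
functions of the pair (`blockQuad_step_le`).

**Averaging over the pairs.** The weight `ℓ - 2` in the metric exactly compensates the low
probability of off-diagonal blocks, so that the averaged first-order term is the inner product of
`W` with the Riemannian subgradient `G - X sym(Xᵀ G)`. The dependence of the metric on the base
point costs at most `(2ℓ-4) L ‖W‖²`. The a priori bound `‖W‖ ≤ 4λL/ℓ ≤ 2/(2ℓ-1)` absorbs the factor
`ℓ - 2` in the second-order terms, which is why the error terms do not grow with `ℓ`
(`pairAvg_stepBound_le`). Weak convexity, `⟨G, W⟩ ≤ f Z - f X + (τ/2) ‖W‖²`, and the minimality of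
`Z`, which makes `f Z - f X` negative, then turn the first-order term into a negative multiple of
the squared stationarity measure (`expected_descent`).

**The proximal map.** First-order optimality along the polar retraction (`prox_first_order`) gives
quadratic growth of the proximal objective around a minimizer for the given range of `λ`. In the
constant `2ℓ - 1 = 1 + 2(ℓ-1)` both summands come from the curvature of the manifold: the first from
its effect on `f`, the second from its effect on the quadratic term, where `ℓ - 1` is the ratio of
the metric to the Euclidean one. Hence the minimizer is unique (`proxSet_subsingleton`), and by
compactness it depends continuously on `X` (`continuousOn_prox`), so that the stationarity measure
is a bounded measurable function of the iterate.

The rates follow by telescoping (`minUpTo_surrogate_sq_le`) and Jensen's inequality.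
-/

noncomputable section

namespace RSSM

/-! ### The Frobenius inner product -/

section Frobenius

variable {m ι κ : Type*} [Fintype m] [Fintype ι] [Fintype κ]

theorem frobInner_eq_sum (ξ η : Matrix m ι ℝ) :
    frobInner ξ η = ∑ i, ∑ j, ξ i j * η i j := by
  rw [Finset.sum_comm]
  simp [frobInner, Matrix.trace, Matrix.mul_apply]

theorem frobInner_comm (ξ η : Matrix m ι ℝ) : frobInner ξ η = frobInner η ξ := by
  simp only [frobInner_eq_sum, mul_comm]

theorem frobInner_add_left (ξ η ζ : Matrix m ι ℝ) :
    frobInner (ξ + η) ζ = frobInner ξ ζ + frobInner η ζ := by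
  simp [frobInner, Matrix.add_mul]

theorem frobInner_add_right (ξ η ζ : Matrix m ι ℝ) :
    frobInner ξ (η + ζ) = frobInner ξ η + frobInner ξ ζ := by
  simp [frobInner, Matrix.mul_add]

theorem frobInner_sub_left (ξ η ζ : Matrix m ι ℝ) :
    frobInner (ξ - η) ζ = frobInner ξ ζ - frobInner η ζ := by
  simp [frobInner, Matrix.sub_mul]

theorem frobInner_sub_right (ξ η ζ : Matrix m ι ℝ) :
    frobInner ξ (η - ζ) = frobInner ξ η - frobInner ξ ζ := by
  simp [frobInner, Matrix.mul_sub]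

theorem frobInner_smul_left (c : ℝ) (ξ η : Matrix m ι ℝ) :
    frobInner (c • ξ) η = c * frobInner ξ η := by
  simp [frobInner]

theorem frobInner_smul_right (c : ℝ) (ξ η : Matrix m ι ℝ) :
    frobInner ξ (c • η) = c * frobInner ξ η := by
  simp [frobInner]

theorem frobInner_neg_left (ξ η : Matrix m ι ℝ) : frobInner (-ξ) η = -frobInner ξ η := by
  simp [frobInner]

theorem frobInner_neg_right (ξ η : Matrix m ι ℝ) : frobInner ξ (-η) = -frobInner ξ η := by
  simp [frobInner]

theorem frobInner_zero_left (ξ : Matrix m ι ℝ) : frobInner 0 ξ = 0 := by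
  simp [frobInner]

theorem frobInner_zero_right (ξ : Matrix m ι ℝ) : frobInner ξ 0 = 0 := by
  simp [frobInner]

/-- The adjoint of left multiplication by `A` is left multiplication by `Aᵀ`. -/
theorem frobInner_mul_left (A : Matrix m κ ℝ) (B : Matrix κ ι ℝ) (ξ : Matrix m ι ℝ) :
    frobInner (A * B) ξ = frobInner B (Aᵀ * ξ) := by
  simp [frobInner, Matrix.mul_assoc]

/-- The adjoint of right multiplication by `B` is right multiplication by `Bᵀ`. -/
theorem frobInner_mul_right (A : Matrix m κ ℝ) (B : Matrix κ ι ℝ) (ξ : Matrix m ι ℝ) :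
    frobInner (A * B) ξ = frobInner A (ξ * Bᵀ) := by
  rw [frobInner, frobInner, Matrix.transpose_mul, Matrix.mul_assoc, Matrix.trace_mul_comm,
    Matrix.mul_assoc]

theorem frobInner_transpose (ξ η : Matrix m ι ℝ) : frobInner ξᵀ ηᵀ = frobInner ξ η := by
  rw [frobInner_eq_sum, frobInner_eq_sum, Finset.sum_comm]
  rfl

theorem frobInner_self_nonneg (ξ : Matrix m ι ℝ) : 0 ≤ frobInner ξ ξ := by
  rw [frobInner_eq_sum]
  exact Finset.sum_nonneg fun i _ => Finset.sum_nonneg fun j _ => mul_self_nonneg _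

theorem frobNorm_sq (ξ : Matrix m ι ℝ) : frobNorm ξ ^ 2 = frobInner ξ ξ :=
  Real.sq_sqrt (frobInner_self_nonneg ξ)

theorem frobNorm_nonneg (ξ : Matrix m ι ℝ) : 0 ≤ frobNorm ξ := Real.sqrt_nonneg _

theorem eq_zero_of_frobInner_self_nonpos {ξ : Matrix m ι ℝ} (h : frobInner ξ ξ ≤ 0) : ξ = 0 := by
  have h0 : ∑ i, ∑ j, ξ i j * ξ i j = 0 := by
    rw [← frobInner_eq_sum]
    exact le_antisymm h (frobInner_self_nonneg ξ)
  ext i j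
  have h1 := (Finset.sum_eq_zero_iff_of_nonneg
    (fun i _ => Finset.sum_nonneg fun j _ => mul_self_nonneg (ξ i j))).mp h0 i (Finset.mem_univ i)
  have h2 := (Finset.sum_eq_zero_iff_of_nonneg
    (fun j _ => mul_self_nonneg (ξ i j))).mp h1 j (Finset.mem_univ j)
  exact mul_self_eq_zero.mp h2

theorem frobNorm_sub_comm (ξ η : Matrix m ι ℝ) : frobNorm (ξ - η) = frobNorm (η - ξ) := by
  rw [← neg_sub, frobNorm, frobInner_neg_left, frobInner_neg_right, neg_neg, ← frobNorm]

theorem frobInner_sq_le (ξ η : Matrix m ι ℝ) :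
    frobInner ξ η ^ 2 ≤ frobInner ξ ξ * frobInner η η := by
  have h := fun x : Matrix m ι ℝ => frobInner_self_nonneg x
  have key : ∀ t : ℝ, 0 ≤ frobInner ξ ξ * (t * t) + 2 * frobInner ξ η * t + frobInner η η := by
    intro t
    have := h (t • ξ + η)
    simp only [frobInner_add_left, frobInner_add_right, frobInner_smul_left,
      frobInner_smul_right] at this
    rw [frobInner_comm η ξ] at this
    linarith
  have := discrim_le_zero key
  rw [discrim] at this
  nlinarith

theorem abs_frobInner_le (ξ η : Matrix m ι ℝ) :
    |frobInner ξ η| ≤ frobNorm ξ * frobNorm η := by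
  rw [← abs_of_nonneg (mul_nonneg (frobNorm_nonneg ξ) (frobNorm_nonneg η)), ← sq_le_sq, mul_pow,
    frobNorm_sq, frobNorm_sq]
  exact frobInner_sq_le ξ η

theorem frobInner_le (ξ η : Matrix m ι ℝ) : frobInner ξ η ≤ frobNorm ξ * frobNorm η :=
  (le_abs_self _).trans (abs_frobInner_le ξ η)

theorem frobNorm_le_of_sq_le {ξ : Matrix m ι ℝ} {c : ℝ} (hc : 0 ≤ c)
    (h : frobInner ξ ξ ≤ c ^ 2) : frobNorm ξ ≤ c := by
  rw [frobNorm]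
  exact Real.sqrt_le_iff.mpr ⟨hc, h⟩

theorem frobNorm_add_le (ξ η : Matrix m ι ℝ) : frobNorm (ξ + η) ≤ frobNorm ξ + frobNorm η := by
  refine frobNorm_le_of_sq_le (add_nonneg (frobNorm_nonneg _) (frobNorm_nonneg _)) ?_
  have := frobInner_le ξ η
  simp only [frobInner_add_left, frobInner_add_right, frobInner_comm η ξ]
  rw [← frobNorm_sq, ← frobNorm_sq]
  nlinarith

theorem frobNorm_smul (c : ℝ) (ξ : Matrix m ι ℝ) : frobNorm (c • ξ) = |c| * frobNorm ξ := by
  rw [frobNorm, frobInner_smul_left, frobInner_smul_right, ← mul_assoc, ← pow_two,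
    Real.sqrt_mul (sq_nonneg c), Real.sqrt_sq_eq_abs, frobNorm]

theorem frobInner_self_mul_le (A : Matrix m κ ℝ) (B : Matrix κ ι ℝ) :
    frobInner (A * B) (A * B) ≤ frobInner A A * frobInner B B := by
  rw [frobInner_eq_sum, frobInner_eq_sum A, frobInner_eq_sum B, Finset.sum_mul]
  refine Finset.sum_le_sum fun i _ => ?_
  rw [Finset.sum_comm (f := fun k j => B k j * B k j), Finset.mul_sum]
  refine Finset.sum_le_sum fun j _ => ?_
  rw [Matrix.mul_apply, ← pow_two]
  simpa only [pow_two] using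
    Finset.sum_mul_sq_le_sq_mul_sq Finset.univ (fun k => A i k) (fun k => B k j)

theorem frobNorm_mul_le (A : Matrix m κ ℝ) (B : Matrix κ ι ℝ) :
    frobNorm (A * B) ≤ frobNorm A * frobNorm B := by
  refine frobNorm_le_of_sq_le (mul_nonneg (frobNorm_nonneg _) (frobNorm_nonneg _)) ?_
  rw [mul_pow, frobNorm_sq, frobNorm_sq]
  exact frobInner_self_mul_le A B

theorem frobNorm_transpose (A : Matrix m κ ℝ) : frobNorm Aᵀ = frobNorm A := by
  rw [frobNorm, frobInner_transpose, frobNorm]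

theorem frobInner_self_add_le (ξ η : Matrix m ι ℝ) :
    frobInner (ξ + η) (ξ + η) ≤ 2 * frobInner ξ ξ + 2 * frobInner η η := by
  have h := frobInner_self_nonneg (ξ - η)
  simp only [frobInner_add_left, frobInner_add_right, frobInner_sub_left,
    frobInner_sub_right] at h ⊢
  linarith

/-- Multiplication by a matrix with orthonormal columns is an isometry. -/
theorem frobInner_isometry [DecidableEq κ] {X : Matrix m κ ℝ} (hX : Xᵀ * X = 1)
    (A B : Matrix κ ι ℝ) : frobInner (X * A) (X * B) = frobInner A B := by
  rw [frobInner_mul_left, ← Matrix.mul_assoc, hX, Matrix.one_mul]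

/-- Multiplication by the transpose of a matrix with orthonormal columns is a contraction. -/
theorem frobInner_transpose_mul_le [DecidableEq κ] {X : Matrix m κ ℝ} (hX : Xᵀ * X = 1)
    (ξ : Matrix m ι ℝ) : frobInner (Xᵀ * ξ) (Xᵀ * ξ) ≤ frobInner ξ ξ := by
  have h := frobInner_self_nonneg (ξ - X * (Xᵀ * ξ))
  simp only [frobInner_sub_left, frobInner_sub_right, frobInner_isometry hX] at h
  rw [frobInner_comm ξ (X * _), frobInner_mul_left] at h
  linarith

theorem continuous_frobInner :
    Continuous fun q : Matrix m ι ℝ × Matrix m ι ℝ => frobInner q.1 q.2 := by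
  unfold frobInner
  fun_prop

@[fun_prop]
theorem Continuous.frobInner {α : Type*} [TopologicalSpace α] {f g : α → Matrix m ι ℝ}
    (hf : Continuous f) (hg : Continuous g) : Continuous fun a => frobInner (f a) (g a) :=
  continuous_frobInner.comp (hf.prodMk hg)

@[fun_prop]
theorem Continuous.frobNorm {α : Type*} [TopologicalSpace α] {f : α → Matrix m ι ℝ}
    (hf : Continuous f) : Continuous fun a => frobNorm (f a) := by
  unfold RSSM.frobNorm
  exact (Continuous.frobInner hf hf).sqrt

end Frobenius

/-! ### Positive semidefinite matrices and the polar projection -/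

section Polar

variable {m ι κ : Type*} [Fintype m] [Fintype ι] [Fintype κ]

/-- A positive semidefinite `R` makes `ξ ↦ ⟨ξ R, ξ⟩` nonnegative. -/
theorem frobInner_mul_posSemidef_nonneg {R : Matrix ι ι ℝ} (hR : R.PosSemidef)
    (ξ : Matrix m ι ℝ) : 0 ≤ frobInner (ξ * R) ξ := by
  have h : (ξ * R * ξᵀ).PosSemidef := by
    simpa using hR.mul_mul_conjTranspose_same ξ
  have h2 := h.trace_nonneg
  rwa [frobInner_comm, frobInner, Matrix.trace_mul_comm]

theorem posSemidef_transpose_eq {σ : Type*} {R : Matrix σ σ ℝ} (hR : R.PosSemidef) : Rᵀ = R := by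
  simpa [Matrix.IsHermitian] using hR.isHermitian

/-- The positive semidefinite solution `R = (1 + DᵀD)^{1/2} - 1` of `2 R + R² = DᵀD`. -/
theorem exists_posSemidef_sq [DecidableEq ι] (D : Matrix m ι ℝ) :
    ∃ R : Matrix ι ι ℝ, R.PosSemidef ∧ (2 : ℝ) • R + R * R = Dᵀ * D := by
  have hP : (Dᵀ * D).PosSemidef := by simpa using Matrix.posSemidef_conjTranspose_mul_self D
  have hH := hP.isHermitian
  set e := hH.eigenvalues with he
  set Q : Matrix ι ι ℝ := (hH.eigenvectorUnitary : Matrix ι ι ℝ) with hQ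
  have hQQ : Qᵀ * Q = 1 := by
    have := Matrix.UnitaryGroup.star_mul_self hH.eigenvectorUnitary
    simpa [Matrix.star_eq_conjTranspose] using this
  have hspec : Dᵀ * D = Q * Matrix.diagonal e * Qᵀ := by
    have := hH.spectral_theorem
    rw [Unitary.conjStarAlgAut_apply] at this
    simpa [Matrix.star_eq_conjTranspose, Function.comp_def] using this
  have hnn : ∀ i, 0 ≤ e i := fun i => hP.eigenvalues_nonneg i
  set r : ι → ℝ := fun i => √(1 + e i) - 1
  have hr : ∀ i, 0 ≤ r i := fun i => by
    have : 1 ≤ √(1 + e i) := by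
      rw [Real.one_le_sqrt]; linarith [hnn i]
    simp only [r]; linarith
  refine ⟨Q * Matrix.diagonal r * Qᵀ, ?_, ?_⟩
  · have := (Matrix.PosSemidef.diagonal (d := r) hr).mul_mul_conjTranspose_same Q
    simpa using this
  · have h1 : Q * Matrix.diagonal r * Qᵀ * (Q * Matrix.diagonal r * Qᵀ) =
        Q * (Matrix.diagonal r * Matrix.diagonal r) * Qᵀ := by
      calc _ = Q * Matrix.diagonal r * (Qᵀ * Q) * Matrix.diagonal r * Qᵀ := by
            simp only [Matrix.mul_assoc]
        _ = _ := by rw [hQQ]; simp only [Matrix.mul_assoc, Matrix.one_mul]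
    rw [h1, hspec, ← Matrix.smul_mul, ← Matrix.mul_smul, ← Matrix.add_mul, ← Matrix.mul_add,
      Matrix.diagonal_mul_diagonal, ← Matrix.diagonal_smul, Matrix.diagonal_add]
    congr 3
    ext i
    have : √(1 + e i) ^ 2 = 1 + e i := Real.sq_sqrt (by linarith [hnn i])
    simp only [r, Pi.smul_apply, smul_eq_mul]
    linear_combination this

/-- The trace of `R = (1 + DᵀD)^{1/2} - 1` is at most `‖D‖² / 2`. -/
theorem trace_le_of_sq {R : Matrix ι ι ℝ} (hR : R.PosSemidef) {D : Matrix m ι ℝ}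
    (h : (2 : ℝ) • R + R * R = Dᵀ * D) : R.trace ≤ frobInner D D / 2 := by
  have h1 := congrArg Matrix.trace h
  have h2 : 0 ≤ (R * R).trace := by
    have := frobInner_self_nonneg R
    rwa [frobInner, posSemidef_transpose_eq hR] at this
  rw [Matrix.trace_add, Matrix.trace_smul, smul_eq_mul] at h1
  rw [frobInner]
  linarith

/-- The Frobenius norm of a positive semidefinite matrix is at most its trace. -/
theorem frobNorm_le_trace [DecidableEq ι] {R : Matrix ι ι ℝ} (hR : R.PosSemidef) :
    frobNorm R ≤ R.trace := by
  refine frobNorm_le_of_sq_le hR.trace_nonneg ?_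
  have hH := hR.isHermitian
  have h1 : ∀ i j, R i j * R i j ≤ R i i * R j j := by
    intro i j
    have h2 := hR.submatrix ![i, j]
    have h3 := h2.det_nonneg
    have h4 : R j i = R i j := by
      have := congrFun (congrFun (posSemidef_transpose_eq hR) i) j
      simpa using this
    rw [Matrix.det_fin_two] at h3
    simp [h4] at h3
    linarith
  rw [frobInner_eq_sum, Matrix.trace, pow_two, Finset.sum_mul_sum]
  exact Finset.sum_le_sum fun i _ => Finset.sum_le_sum fun j _ => h1 i j

/-- If `A` and `Y` have orthonormal columns, then `⟨A, Y R⟩ ≤ tr R` for `R` positive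
semidefinite. -/
theorem frobInner_mul_le_trace [DecidableEq ι] {R : Matrix ι ι ℝ} (hR : R.PosSemidef)
    {A Y : Matrix m ι ℝ} (hA : Aᵀ * A = 1) (hY : Yᵀ * Y = 1) :
    frobInner A (Y * R) ≤ R.trace := by
  have h := frobInner_mul_posSemidef_nonneg hR (A - Y)
  have hT := posSemidef_transpose_eq hR
  have h1 : ∀ B : Matrix m ι ℝ, Bᵀ * B = 1 → frobInner (B * R) B = R.trace := by
    intro B hB
    rw [frobInner, Matrix.transpose_mul, hT, Matrix.mul_assoc, hB, Matrix.mul_one]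
  rw [Matrix.sub_mul, frobInner_sub_left, frobInner_sub_right, frobInner_sub_right, h1 A hA,
    h1 Y hY, frobInner_mul_right A, hT, frobInner_comm (Y * R)] at h
  linarith

/-- `1 + R` does not decrease Frobenius norms when `R` is positive semidefinite. -/
theorem frobInner_self_le_one_add_mul [DecidableEq ι] {R : Matrix ι ι ℝ} (hR : R.PosSemidef)
    (A : Matrix ι κ ℝ) : frobInner A A ≤ frobInner (A + R * A) (A + R * A) := by
  have h := frobInner_mul_posSemidef_nonneg hR Aᵀ
  have hT := posSemidef_transpose_eq hR
  have h1 : Aᵀ * R = (R * A)ᵀ := by rw [Matrix.transpose_mul, hT]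
  rw [h1, frobInner_transpose] at h
  have h2 := frobInner_self_nonneg (R * A)
  simp only [frobInner_add_left, frobInner_add_right, frobInner_comm A (R * A)]
  linarith

/-- The polar factor of `A + D`, for `D` tangent to the Stiefel manifold at `A`. -/
theorem exists_polar [DecidableEq ι] {A D : Matrix m ι ℝ} (hA : Aᵀ * A = 1)
    (hD : Dᵀ * A + Aᵀ * D = 0) :
    ∃ (Y : Matrix m ι ℝ) (R B : Matrix ι ι ℝ), R.PosSemidef ∧ (2 : ℝ) • R + R * R = Dᵀ * D ∧
      Yᵀ * Y = 1 ∧ Y + Y * R = A + D ∧ Y = (A + D) * B := by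
  obtain ⟨R, hR, hRR⟩ := exists_posSemidef_sq D
  have hT := posSemidef_transpose_eq hR
  have hpd : (1 + R).PosDef := Matrix.PosDef.one.add_posSemidef hR
  have hu : IsUnit (1 + R).det := (Matrix.isUnit_iff_isUnit_det _).mp hpd.isUnit
  have h1 : (A + D)ᵀ * (A + D) = (1 + R) * (1 + R) := by
    have e : (A + D)ᵀ * (A + D) = Aᵀ * A + (Dᵀ * A + Aᵀ * D) + Dᵀ * D := by
      simp only [Matrix.transpose_add, Matrix.add_mul, Matrix.mul_add]; abel
    rw [e, hA, hD, ← hRR]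
    simp only [Matrix.add_mul, Matrix.mul_add, Matrix.one_mul, Matrix.mul_one, two_smul]
    abel
  have hTi : ((1 + R)⁻¹)ᵀ = (1 + R)⁻¹ := by
    rw [Matrix.transpose_nonsing_inv, Matrix.transpose_add, hT, Matrix.transpose_one]
  refine ⟨(A + D) * (1 + R)⁻¹, R, (1 + R)⁻¹, hR, hRR, ?_, ?_, rfl⟩
  · rw [Matrix.transpose_mul, hTi, Matrix.mul_assoc, ← Matrix.mul_assoc _ (A + D), h1,
      ← Matrix.mul_assoc, ← Matrix.mul_assoc, Matrix.nonsing_inv_mul _ hu, Matrix.one_mul,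
      Matrix.mul_nonsing_inv _ hu]
  · calc _ = (A + D) * (1 + R)⁻¹ * (1 + R) := by rw [Matrix.mul_add _ 1 R, Matrix.mul_one]
      _ = A + D := by rw [Matrix.mul_assoc, Matrix.nonsing_inv_mul _ hu, Matrix.mul_one]

/-- A point `Y` with orthonormal columns that is no farther from `U (1 + R)` than `U` is, where
`U` has orthonormal columns and `R` is positive semidefinite, equals `U`. -/
theorem eq_of_frobNorm_sub_le [DecidableEq ι] {R : Matrix ι ι ℝ} (hR : R.PosSemidef)
    {U Y : Matrix m ι ℝ} (hU : Uᵀ * U = 1) (hY : Yᵀ * Y = 1)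
    (h : frobNorm (U + U * R - Y) ≤ frobNorm (U + U * R - U)) : Y = U := by
  have hT := posSemidef_transpose_eq hR
  have h0 : frobInner (U + U * R - Y) (U + U * R - Y) ≤
      frobInner (U + U * R - U) (U + U * R - U) := by
    rw [← frobNorm_sq, ← frobNorm_sq]
    exact pow_le_pow_left₀ (frobNorm_nonneg _) h 2
  have hn : ∀ B : Matrix m ι ℝ, Bᵀ * B = 1 → frobInner B B = (1 : Matrix ι ι ℝ).trace := by
    intro B hB; rw [frobInner, hB]
  have h1 : ∀ B : Matrix m ι ℝ, Bᵀ * B = 1 → frobInner (B * R) B = R.trace := by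
    intro B hB
    rw [frobInner, Matrix.transpose_mul, hT, Matrix.mul_assoc, hB, Matrix.mul_one]
  have h2 := frobInner_mul_posSemidef_nonneg hR (Y - U)
  rw [← sub_eq_zero]
  apply eq_zero_of_frobInner_self_nonpos
  rw [Matrix.sub_mul, frobInner_sub_left, frobInner_sub_right, frobInner_sub_right, h1 U hU,
    h1 Y hY, frobInner_mul_right Y, hT, frobInner_comm Y] at h2
  simp only [frobInner_add_left, frobInner_add_right, frobInner_sub_left, frobInner_sub_right,
    frobInner_comm Y, frobInner_comm U (U * R), hn U hU, hn Y hY, h1 U hU] at h0 ⊢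
  linarith

end Polar

/-! ### Column selection -/

section Columns

variable {m : Type*} {p : ℕ}

/-- The diagonal `0`-`1` matrix selecting the columns with index in `D`. -/
def colSel (D : Finset (Fin p)) : Matrix (Fin p) (Fin p) ℝ :=
  Matrix.diagonal fun a => if a ∈ D then 1 else 0

theorem cols_eq_mul (X : Matrix m (Fin p) ℝ) (D : Finset (Fin p)) :
    cols X D = X * cols (1 : Matrix (Fin p) (Fin p) ℝ) D := by
  ext i j
  simp [cols, Matrix.mul_apply, Matrix.one_apply]

theorem cols_one_mul_transpose (D : Finset (Fin p)) :
    cols (1 : Matrix (Fin p) (Fin p) ℝ) D * (cols (1 : Matrix (Fin p) (Fin p) ℝ) D)ᵀ =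
      colSel D := by
  ext i j
  rw [Matrix.mul_apply, colSel, Matrix.diagonal_apply]
  have : ∀ x : {x // x ∈ D}, cols (1 : Matrix (Fin p) (Fin p) ℝ) D i x *
      (cols (1 : Matrix (Fin p) (Fin p) ℝ) D)ᵀ x j =
      (fun y : Fin p => if i = y ∧ j = y then (1 : ℝ) else 0) x := by
    intro x
    simp only [cols, Matrix.submatrix_apply, id, Matrix.one_apply, Matrix.transpose_apply]
    by_cases h1 : i = x <;> by_cases h2 : j = x <;> simp [h1, h2]
  rw [Finset.sum_congr rfl fun x _ => this x,
    Finset.sum_coe_sort D fun y : Fin p => if i = y ∧ j = y then (1 : ℝ) else 0]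
  by_cases hij : i = j
  · subst hij; simp
  · rw [if_neg hij]
    refine Finset.sum_eq_zero fun y _ => if_neg ?_
    rintro ⟨rfl, rfl⟩
    exact hij rfl

theorem cols_one_transpose_mul (D : Finset (Fin p)) :
    (cols (1 : Matrix (Fin p) (Fin p) ℝ) D)ᵀ * cols (1 : Matrix (Fin p) (Fin p) ℝ) D = 1 := by
  ext i j
  rw [Matrix.mul_apply, Finset.sum_eq_single_of_mem (i : Fin p) (Finset.mem_univ _)]
  · by_cases h : i = j
    · subst h
      simp [cols, Matrix.one_apply]
    · have h' : (i : Fin p) ≠ j := fun e => h (Subtype.ext e)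
      simp [cols, Matrix.one_apply_ne h, h']
  · intro x _ hx
    simp [cols, hx]

theorem cols_one_compl_transpose_mul (D : Finset (Fin p)) :
    (cols (1 : Matrix (Fin p) (Fin p) ℝ) Dᶜ)ᵀ * cols (1 : Matrix (Fin p) (Fin p) ℝ) D = 0 := by
  ext i j
  have : (i : Fin p) ≠ j := fun h => (Finset.mem_compl.mp i.2) (h ▸ j.2)
  simpa [cols, Matrix.mul_apply, Matrix.one_apply] using this

theorem colSel_compl (D : Finset (Fin p)) : colSel Dᶜ = 1 - colSel D := by
  rw [colSel, colSel, ← Matrix.diagonal_one, Matrix.diagonal_sub]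
  congr 1
  ext a
  by_cases h : a ∈ D <;> simp [h]

theorem colSel_transpose (D : Finset (Fin p)) : (colSel D)ᵀ = colSel D :=
  Matrix.diagonal_transpose _

theorem colSel_mul_self (D : Finset (Fin p)) : colSel D * colSel D = colSel D := by
  rw [colSel, Matrix.diagonal_mul_diagonal]
  congr 1
  ext a
  by_cases h : a ∈ D <;> simp [h]

theorem mul_colSel_apply (A : Matrix m (Fin p) ℝ) (D : Finset (Fin p)) (i : m) (a : Fin p) :
    (A * colSel D) i a = A i a * if a ∈ D then 1 else 0 := by
  rw [colSel, Matrix.mul_diagonal]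

theorem colSel_mul_apply (A : Matrix (Fin p) m ℝ) (D : Finset (Fin p)) (i : m) (a : Fin p) :
    (colSel D * A) a i = (if a ∈ D then 1 else 0) * A a i := by
  rw [colSel, Matrix.diagonal_mul]

theorem frobInner_mul_colSel_le [Fintype m] (A : Matrix m (Fin p) ℝ) (D : Finset (Fin p)) :
    frobInner (A * colSel D) (A * colSel D) ≤ frobInner A A := by
  rw [frobInner_eq_sum, frobInner_eq_sum]
  refine Finset.sum_le_sum fun i _ => Finset.sum_le_sum fun a _ => ?_
  rw [mul_colSel_apply]
  split_ifs
  · simp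
  · simpa using mul_self_nonneg (A i a)

theorem frobInner_colSel_mul_le [Fintype m] (A : Matrix (Fin p) m ℝ) (D : Finset (Fin p)) :
    frobInner (colSel D * A) (colSel D * A) ≤ frobInner A A := by
  rw [frobInner_eq_sum, frobInner_eq_sum]
  refine Finset.sum_le_sum fun i _ => Finset.sum_le_sum fun a _ => ?_
  rw [colSel_mul_apply]
  split_ifs
  · simp
  · simpa using mul_self_nonneg (A i a)

end Columns

/-! ### One step of the method in full-size matrices -/

section Step

variable {n p : ℕ}

/-- The skew-symmetric part of `Xᵀ G`. -/
def skewPart (X G : Matrix (Fin n) (Fin p) ℝ) : Matrix (Fin p) (Fin p) ℝ :=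
  (1 / 2 : ℝ) • (Xᵀ * G - Gᵀ * X)

theorem skewPart_transpose (X G : Matrix (Fin n) (Fin p) ℝ) :
    (skewPart X G)ᵀ = -skewPart X G := by
  simp only [skewPart, Matrix.transpose_smul, Matrix.transpose_sub, Matrix.transpose_mul,
    Matrix.transpose_transpose, ← smul_neg, neg_sub]

/-- The search direction for the columns in `D`, extended by zero to all columns: the tangential
part of the `D`-columns of `G`. -/
def blockDir (X G : Matrix (Fin n) (Fin p) ℝ) (D : Finset (Fin p)) : Matrix (Fin n) (Fin p) ℝ :=
  (G - X * (Xᵀ * G)) * colSel D + X * (colSel D * skewPart X G * colSel D)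

/-- The projection onto `{ξ | ξᵀ A + Aᵀ ξ = 0, Bᵀ ξ = 0}` when `[A, B]` has orthonormal
columns. -/
theorem eq_of_mem_projSet_tangent {m ι κ : Type*} [Fintype m] [Fintype ι] [Fintype κ]
    [DecidableEq ι] [DecidableEq κ] {A : Matrix m ι ℝ} {B : Matrix m κ ℝ} (hA : Aᵀ * A = 1)
    (hB : Bᵀ * B = 1) (hBA : Bᵀ * A = 0) {G D : Matrix m ι ℝ}
    (hD : D ∈ projSet {ξ : Matrix m ι ℝ | ξᵀ * A + Aᵀ * ξ = 0 ∧ Bᵀ * ξ = 0} G) :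
    D = G - B * (Bᵀ * G) - A * ((1 / 2 : ℝ) • (Aᵀ * G + Gᵀ * A)) := by
  obtain ⟨⟨hD1, hD2⟩, hmin⟩ := hD
  set S : Matrix ι ι ℝ := (1 / 2 : ℝ) • (Aᵀ * G + Gᵀ * A) with hS
  have hST : Sᵀ = S := by
    rw [hS]
    simp only [Matrix.transpose_smul, Matrix.transpose_add, Matrix.transpose_mul,
      Matrix.transpose_transpose]
    rw [add_comm]
  have hAB : Aᵀ * B = 0 := by
    rw [← Matrix.transpose_transpose B, ← Matrix.transpose_mul, hBA, Matrix.transpose_zero]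
  set D₀ := G - B * (Bᵀ * G) - A * S with hD₀
  have hAD : Aᵀ * D₀ = Aᵀ * G - S := by
    rw [hD₀, Matrix.mul_sub, Matrix.mul_sub, ← Matrix.mul_assoc Aᵀ B, hAB, Matrix.zero_mul,
      ← Matrix.mul_assoc Aᵀ A, hA, Matrix.one_mul, sub_zero]
  have hBD : Bᵀ * D₀ = 0 := by
    rw [hD₀, Matrix.mul_sub, Matrix.mul_sub, ← Matrix.mul_assoc Bᵀ B, hB, Matrix.one_mul,
      ← Matrix.mul_assoc Bᵀ A, hBA, Matrix.zero_mul, sub_self, sub_zero]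
  have hDA : D₀ᵀ * A = Gᵀ * A - S := by
    have := congrArg Matrix.transpose hAD
    simpa [Matrix.transpose_mul, hST] using this
  have hmem : D₀ ∈ {ξ : Matrix m ι ℝ | ξᵀ * A + Aᵀ * ξ = 0 ∧ Bᵀ * ξ = 0} := by
    refine ⟨?_, hBD⟩
    rw [hDA, hAD]
    have : S + S = Aᵀ * G + Gᵀ * A := by
      rw [hS, ← add_smul]; norm_num
    rw [show Gᵀ * A - S + (Aᵀ * G - S) = Aᵀ * G + Gᵀ * A - (S + S) by abel, this, sub_self]
  -- `G - D₀` is orthogonal to the tangent space, so Pythagoras applies to `D₀ - D`.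
  have horth : frobInner (G - D₀) (D₀ - D) = 0 := by
    have e1 : G - D₀ = B * (Bᵀ * G) + A * S := by rw [hD₀]; abel
    have hskew : (Aᵀ * (D₀ - D))ᵀ = -(Aᵀ * (D₀ - D)) := by
      have h1 := hmem.1
      rw [Matrix.transpose_mul, Matrix.transpose_transpose, Matrix.transpose_sub, Matrix.sub_mul,
        Matrix.mul_sub, eq_neg_of_add_eq_zero_left h1, eq_neg_of_add_eq_zero_left hD1]
      abel
    have h2 : frobInner S (Aᵀ * (D₀ - D)) = 0 := by
      have h3 := frobInner_transpose S (Aᵀ * (D₀ - D))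
      rw [hskew, hST, frobInner_neg_right] at h3
      linarith
    rw [e1, frobInner_add_left, frobInner_mul_left, frobInner_mul_left A, h2, Matrix.mul_sub, hBD,
      hD2, sub_self, frobInner_zero_right, add_zero]
  have h1 := hmin D₀ hmem
  have h2 : frobInner (G - D) (G - D) ≤ frobInner (G - D₀) (G - D₀) := by
    rw [← frobNorm_sq, ← frobNorm_sq]
    exact pow_le_pow_left₀ (frobNorm_nonneg _) h1 2
  have h3 : G - D = (G - D₀) + (D₀ - D) := by abel
  have h4 : D₀ - D = 0 := by
    apply eq_zero_of_frobInner_self_nonpos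
    rw [h3] at h2
    generalize G - D₀ = P at *
    generalize D₀ - D = Q at *
    rw [frobInner_add_left, frobInner_add_right, frobInner_add_right, frobInner_comm Q P,
      horth] at h2
    linarith
  rw [sub_eq_zero] at h4
  exact h4.symm

/-- The step in full-size matrices: `X' (1 + R) = X - γ D̂` with `D̂` the extended search direction
and `R` positive semidefinite of second order in `γ`. -/
theorem IsStep.exists_factor {X G X' : Matrix (Fin n) (Fin p) ℝ} {D : Finset (Fin p)} {γ : ℝ}
    (hX : Xᵀ * X = 1) (h : IsStep X G D γ X') :
    ∃ R : Matrix (Fin p) (Fin p) ℝ, R.PosSemidef ∧ R * colSel D = R ∧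
      (2 : ℝ) • R + R * R = (γ • blockDir X G D)ᵀ * (γ • blockDir X G D) ∧
      X' + X' * R = X - γ • blockDir X G D ∧ X'ᵀ * X' = 1 := by
  obtain ⟨T, hT, ⟨⟨hYst, hYorth⟩, hYmin⟩, hcompl⟩ := h
  set J := cols (1 : Matrix (Fin p) (Fin p) ℝ) D with hJ
  set J' := cols (1 : Matrix (Fin p) (Fin p) ℝ) Dᶜ with hJ'
  have hJJ : J * Jᵀ = colSel D := cols_one_mul_transpose D
  have hJJ' : J' * J'ᵀ = 1 - colSel D := by rw [← colSel_compl]; exact cols_one_mul_transpose Dᶜ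
  have hJtJ : Jᵀ * J = 1 := cols_one_transpose_mul D
  have hJtJ' : J'ᵀ * J' = 1 := cols_one_transpose_mul Dᶜ
  have hJ'J : J'ᵀ * J = 0 := cols_one_compl_transpose_mul D
  have hA : (cols X D)ᵀ * cols X D = 1 := by
    rw [cols_eq_mul, ← hJ, Matrix.transpose_mul, Matrix.mul_assoc, ← Matrix.mul_assoc Xᵀ, hX,
      Matrix.one_mul, hJtJ]
  have hB : (cols X Dᶜ)ᵀ * cols X Dᶜ = 1 := by
    rw [cols_eq_mul, ← hJ', Matrix.transpose_mul, Matrix.mul_assoc, ← Matrix.mul_assoc Xᵀ, hX,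
      Matrix.one_mul, hJtJ']
  have hBA : (cols X Dᶜ)ᵀ * cols X D = 0 := by
    rw [cols_eq_mul X D, cols_eq_mul X Dᶜ, ← hJ, ← hJ', Matrix.transpose_mul, Matrix.mul_assoc,
      ← Matrix.mul_assoc Xᵀ, hX, Matrix.one_mul, hJ'J]
  have hTeq := eq_of_mem_projSet_tangent hA hB hBA hT
  have hTJ : T * Jᵀ = blockDir X G D := by
    rw [hTeq, cols_eq_mul X D, cols_eq_mul X Dᶜ, cols_eq_mul G D, ← hJ, ← hJ']
    have e1 : X * J' * ((X * J')ᵀ * (G * J)) * Jᵀ = X * ((1 - colSel D) * (Xᵀ * G) * colSel D) := by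
      rw [← hJJ', ← hJJ]
      simp only [Matrix.transpose_mul, Matrix.mul_assoc]
    have e2 : X * J * ((1 / 2 : ℝ) • ((X * J)ᵀ * (G * J) + (G * J)ᵀ * (X * J))) * Jᵀ =
        X * (colSel D * ((1 / 2 : ℝ) • (Xᵀ * G + Gᵀ * X)) * colSel D) := by
      rw [← hJJ]
      simp only [Matrix.transpose_mul, Matrix.mul_assoc, Matrix.mul_smul, Matrix.smul_mul,
        Matrix.mul_add, Matrix.add_mul]
    have e3 : skewPart X G = Xᵀ * G - (1 / 2 : ℝ) • (Xᵀ * G + Gᵀ * X) := by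
      rw [skewPart]; module
    rw [Matrix.sub_mul, Matrix.sub_mul, e1, e2, Matrix.mul_assoc G, hJJ, blockDir, e3]
    simp only [Matrix.mul_sub, Matrix.sub_mul, Matrix.one_mul, Matrix.mul_assoc]
    abel
  obtain ⟨⟨hT1, hT2⟩, -⟩ := hT
  obtain ⟨U, R, B, hR, hRR, hU, hUR, hUB⟩ := exists_polar (A := cols X D) (D := -(γ • T)) hA (by
    have : (-(γ • T))ᵀ * cols X D + (cols X D)ᵀ * -(γ • T) =
        -(γ • (Tᵀ * cols X D + (cols X D)ᵀ * T)) := by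
      simp only [Matrix.transpose_neg, Matrix.transpose_smul, Matrix.neg_mul, Matrix.mul_neg,
        Matrix.smul_mul, Matrix.mul_smul, smul_add, neg_add]
    rw [this, hT1, smul_zero, neg_zero])
  have hUorth : (cols X Dᶜ)ᵀ * U = 0 := by
    rw [hUB, ← Matrix.mul_assoc, Matrix.mul_add, hBA, Matrix.mul_neg, Matrix.mul_smul, hT2,
      smul_zero, neg_zero, add_zero, Matrix.zero_mul]
  have hYU : cols X' D = U := by
    refine eq_of_frobNorm_sub_le hR hU hYst ?_
    rw [hUR, ← sub_eq_add_neg]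
    exact hYmin U ⟨hU, hUorth⟩
  have hX' : X' = U * Jᵀ + X * (1 - colSel D) := by
    have : X' * (J * Jᵀ + J' * J'ᵀ) = X' := by
      rw [hJJ, hJJ', add_sub_cancel, Matrix.mul_one]
    rw [← this, Matrix.mul_add, ← Matrix.mul_assoc, ← Matrix.mul_assoc, ← cols_eq_mul,
      ← cols_eq_mul, hYU, hcompl, cols_eq_mul, ← hJ', Matrix.mul_assoc, hJJ']
  have hJE : Jᵀ * colSel D = Jᵀ := by
    rw [← hJJ, ← Matrix.mul_assoc, hJtJ, Matrix.one_mul]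
  have hEJ : colSel D * J = J := by
    rw [← hJJ, Matrix.mul_assoc, hJtJ, Matrix.mul_one]
  refine ⟨J * R * Jᵀ, ?_, ?_, ?_, ?_, ?_⟩
  · simpa using hR.mul_mul_conjTranspose_same J
  · rw [Matrix.mul_assoc, hJE]
  · have e1 : J * R * Jᵀ * (J * R * Jᵀ) = J * (R * R) * Jᵀ := by
      calc _ = J * R * (Jᵀ * J) * R * Jᵀ := by simp only [Matrix.mul_assoc]
        _ = _ := by rw [hJtJ]; simp only [Matrix.mul_assoc, Matrix.one_mul]
    rw [e1, ← hTJ, ← Matrix.smul_mul, ← Matrix.mul_smul, ← Matrix.add_mul, ← Matrix.mul_add, hRR]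
    simp only [Matrix.transpose_neg, Matrix.transpose_smul, Matrix.neg_mul, Matrix.mul_neg,
      Matrix.smul_mul, Matrix.mul_smul, Matrix.transpose_mul, Matrix.transpose_transpose,
      Matrix.mul_assoc, smul_neg, neg_neg]
  · have e1 : X' * (J * R * Jᵀ) = U * R * Jᵀ := by
      rw [hX', Matrix.add_mul]
      have : X * (1 - colSel D) * (J * R * Jᵀ) = 0 := by
        rw [Matrix.mul_assoc, ← Matrix.mul_assoc (1 - colSel D), ← Matrix.mul_assoc (1 - colSel D),
          Matrix.sub_mul, hEJ, Matrix.one_mul, sub_self, Matrix.zero_mul, Matrix.zero_mul,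
          Matrix.mul_zero]
      rw [this, add_zero]
      calc _ = U * (Jᵀ * J) * R * Jᵀ := by simp only [Matrix.mul_assoc]
        _ = _ := by rw [hJtJ, Matrix.mul_one]
    rw [e1, hX', ← hTJ, add_right_comm, ← Matrix.add_mul, hUR, cols_eq_mul, ← hJ, Matrix.add_mul,
      Matrix.mul_assoc, hJJ]
    simp only [Matrix.mul_sub, Matrix.mul_one, Matrix.neg_mul, Matrix.smul_mul]
    abel
  · have h1 : Uᵀ * X * (1 - colSel D) = 0 := by
      have := congrArg Matrix.transpose hUorth
      rw [Matrix.transpose_mul, Matrix.transpose_transpose, cols_eq_mul, ← hJ',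
        Matrix.transpose_zero, ← Matrix.mul_assoc] at this
      rw [← hJJ', ← Matrix.mul_assoc, this, Matrix.zero_mul]
    have h2 : (1 - colSel D) * (Xᵀ * U) = 0 := by
      have := congrArg Matrix.transpose h1
      simpa [Matrix.transpose_mul, colSel_transpose] using this
    have e : X'ᵀ = J * Uᵀ + (1 - colSel D) * Xᵀ := by
      rw [hX']; simp [Matrix.transpose_mul, colSel_transpose]
    have hF : (1 - colSel D) * (1 - colSel D) = 1 - colSel D := by
      simp [Matrix.mul_sub, Matrix.sub_mul, colSel_mul_self]
    calc X'ᵀ * X' = J * (Uᵀ * U) * Jᵀ + J * (Uᵀ * X * (1 - colSel D)) +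
          (1 - colSel D) * (Xᵀ * U) * Jᵀ + (1 - colSel D) * (Xᵀ * X) * (1 - colSel D) := by
          rw [e, hX']; simp only [Matrix.mul_add, Matrix.add_mul, Matrix.mul_assoc]; abel
      _ = 1 := by
          rw [hU, h1, h2, hX, Matrix.mul_one, Matrix.mul_one, hF, hJJ]; simp

end Step

/-! ### Counting pairs of blocks -/

section Pairs

variable {ℓ : ℕ}

theorem card_blockPairs_mem (i : Fin ℓ) :
    ((blockPairs ℓ).filter fun s => i ∈ s).card = ℓ - 1 := by
  have h : (blockPairs ℓ).filter (fun s => i ∈ s) =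
      (Finset.univ.erase i).image fun j => ({i, j} : Finset (Fin ℓ)) := by
    ext s
    simp only [blockPairs, Finset.mem_filter, Finset.mem_powersetCard, Finset.subset_univ,
      true_and, Finset.mem_image, Finset.mem_erase, Finset.mem_univ, and_true]
    constructor
    · rintro ⟨h2, hi⟩
      have h1 : (s.erase i).card = 1 := by rw [Finset.card_erase_of_mem hi, h2]
      obtain ⟨j, hj⟩ := Finset.card_eq_one.mp h1
      refine ⟨j, ?_, ?_⟩
      · have : j ∈ s.erase i := by rw [hj]; exact Finset.mem_singleton_self j
        exact Finset.ne_of_mem_erase this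
      · rw [← Finset.insert_erase hi, hj]
    · rintro ⟨j, hj, rfl⟩
      exact ⟨Finset.card_pair hj.symm, Finset.mem_insert_self _ _⟩
  rw [h, Finset.card_image_of_injOn, Finset.card_erase_of_mem (Finset.mem_univ i),
    Finset.card_univ, Fintype.card_fin]
  intro j hj k hk hjk
  have hj' : j ≠ i := Finset.ne_of_mem_erase hj
  have : j ∈ ({i, k} : Finset (Fin ℓ)) := by
    have hjk' : ({i, j} : Finset (Fin ℓ)) = {i, k} := hjk
    rw [← hjk']; simp
  simpa [hj'] using this

theorem sum_blockPairs_mem (hℓ : 2 ≤ ℓ) (i : Fin ℓ) :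
    ∑ s ∈ blockPairs ℓ, (if i ∈ s then (1 : ℝ) else 0) = ℓ - 1 := by
  rw [Finset.sum_boole, card_blockPairs_mem, Nat.cast_sub (by omega), Nat.cast_one]

theorem sum_blockPairs_mem_mem {i j : Fin ℓ} (hij : i ≠ j) :
    ∑ s ∈ blockPairs ℓ, (if i ∈ s then (1 : ℝ) else 0) * (if j ∈ s then 1 else 0) = 1 := by
  have hm : ({i, j} : Finset (Fin ℓ)) ∈ blockPairs ℓ := by
    simp [blockPairs, Finset.mem_powersetCard, Finset.card_pair hij]
  rw [Finset.sum_eq_single_of_mem _ hm]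
  · simp
  · intro s hs hne
    by_contra h
    have hi : i ∈ s := by by_contra hi; simp [hi] at h
    have hj : j ∈ s := by by_contra hj; simp [hj] at h
    apply hne
    refine (Finset.eq_of_subset_of_card_le ?_ ?_).symm
    · intro x hx
      rcases Finset.mem_insert.mp hx with rfl | hx
      · exact hi
      · rwa [Finset.mem_singleton.mp hx]
    · rw [Finset.card_pair hij, (Finset.mem_powersetCard.mp hs).2]

theorem choose_two_pos (hℓ : 2 ≤ ℓ) : (0 : ℝ) < ℓ.choose 2 := by
  exact_mod_cast Nat.choose_pos hℓ

/-- The average over the pairs of blocks. -/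
def pairAvg (ℓ : ℕ) (g : Finset (Fin ℓ) → ℝ) : ℝ :=
  1 / (ℓ.choose 2 : ℝ) * ∑ s ∈ blockPairs ℓ, g s

theorem pairAvg_add (g h : Finset (Fin ℓ) → ℝ) :
    pairAvg ℓ (fun s => g s + h s) = pairAvg ℓ g + pairAvg ℓ h := by
  rw [pairAvg, Finset.sum_add_distrib, mul_add, pairAvg, pairAvg]

theorem pairAvg_const_mul (c : ℝ) (g : Finset (Fin ℓ) → ℝ) :
    pairAvg ℓ (fun s => c * g s) = c * pairAvg ℓ g := by
  rw [pairAvg, ← Finset.mul_sum, pairAvg]; ring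

theorem pairAvg_const (hℓ : 2 ≤ ℓ) (c : ℝ) : pairAvg ℓ (fun _ => c) = c := by
  have := choose_two_pos hℓ
  rw [pairAvg, Finset.sum_const, blockPairs, Finset.card_powersetCard, Finset.card_univ,
    Fintype.card_fin, nsmul_eq_mul]
  field_simp

theorem pairAvg_sum {α : Type*} (t : Finset α) (g : α → Finset (Fin ℓ) → ℝ) :
    pairAvg ℓ (fun s => ∑ a ∈ t, g a s) = ∑ a ∈ t, pairAvg ℓ (g a) := by
  simp only [pairAvg]
  rw [Finset.sum_comm, Finset.mul_sum]

/-- A block belongs to a random pair with probability `2 / ℓ`. -/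
theorem pairAvg_mem (hℓ : 2 ≤ ℓ) (i : Fin ℓ) :
    pairAvg ℓ (fun s => if i ∈ s then 1 else 0) = 2 / ℓ := by
  have h2 : (2 : ℝ) ≤ ℓ := by exact_mod_cast hℓ
  rw [pairAvg, sum_blockPairs_mem hℓ, Nat.cast_choose_two]
  have : (ℓ : ℝ) - 1 ≠ 0 := by linarith
  field_simp

theorem pairAvg_mem_mem (hℓ : 2 ≤ ℓ) {i j : Fin ℓ} (hij : i ≠ j) :
    pairAvg ℓ (fun s => (if i ∈ s then 1 else 0) * (if j ∈ s then 1 else 0)) =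
      2 / ℓ / (ℓ - 1) := by
  have h2 : (2 : ℝ) ≤ ℓ := by exact_mod_cast hℓ
  rw [pairAvg, sum_blockPairs_mem_mem hij, Nat.cast_choose_two]
  have : (ℓ : ℝ) - 1 ≠ 0 := by linarith
  field_simp

end Pairs

/-! ### The off-diagonal blocks -/

section OffBlock

variable {p ℓ : ℕ} {κ : Type*}

/-- The off-diagonal blocks of a square matrix, with `b a` the block to which the index `a`
belongs. -/
def offBlock (b : κ → Fin ℓ) (M : Matrix κ κ ℝ) : Matrix κ κ ℝ :=
  Matrix.of fun k a => if b k = b a then 0 else M k a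

theorem offBlock_apply (b : κ → Fin ℓ) (M : Matrix κ κ ℝ) (k a : κ) :
    offBlock b M k a = if b k = b a then 0 else M k a := rfl

theorem offBlock_add (b : κ → Fin ℓ) (M N : Matrix κ κ ℝ) :
    offBlock b (M + N) = offBlock b M + offBlock b N := by
  ext k a
  simp only [offBlock_apply, Matrix.add_apply]
  split_ifs <;> simp

theorem offBlock_sub (b : κ → Fin ℓ) (M N : Matrix κ κ ℝ) :
    offBlock b (M - N) = offBlock b M - offBlock b N := by
  ext k a
  simp only [offBlock_apply, Matrix.sub_apply]
  split_ifs <;> simp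

theorem offBlock_smul (b : κ → Fin ℓ) (c : ℝ) (M : Matrix κ κ ℝ) :
    offBlock b (c • M) = c • offBlock b M := by
  ext k a
  simp [offBlock_apply]

theorem offBlock_one [DecidableEq κ] (b : κ → Fin ℓ) : offBlock b (1 : Matrix κ κ ℝ) = 0 := by
  ext k a
  rw [offBlock_apply]
  split_ifs with h
  · rfl
  · rw [Matrix.one_apply_ne (fun e => h (congrArg b e))]; rfl

theorem offBlock_offBlock (b : κ → Fin ℓ) (M : Matrix κ κ ℝ) :
    offBlock b (offBlock b M) = offBlock b M := by
  ext k a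
  simp only [offBlock_apply]
  split_ifs <;> rfl

theorem frobInner_offBlock_left [Fintype κ] (b : κ → Fin ℓ) (M N : Matrix κ κ ℝ) :
    frobInner (offBlock b M) N = frobInner (offBlock b M) (offBlock b N) := by
  rw [frobInner_eq_sum, frobInner_eq_sum]
  refine Finset.sum_congr rfl fun i _ => Finset.sum_congr rfl fun j _ => ?_
  simp only [offBlock_apply]
  split_ifs <;> simp

theorem frobInner_offBlock_le [Fintype κ] (b : κ → Fin ℓ) (M : Matrix κ κ ℝ) :
    frobInner (offBlock b M) (offBlock b M) ≤ frobInner M M := by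
  rw [frobInner_eq_sum, frobInner_eq_sum]
  refine Finset.sum_le_sum fun i _ => Finset.sum_le_sum fun j _ => ?_
  simp only [offBlock_apply]
  split_ifs
  · simpa using mul_self_nonneg (M i j)
  · exact le_rfl

theorem frobNorm_offBlock_le [Fintype κ] (b : κ → Fin ℓ) (M : Matrix κ κ ℝ) :
    frobNorm (offBlock b M) ≤ frobNorm M :=
  Real.sqrt_le_sqrt (frobInner_offBlock_le b M)

@[fun_prop]
theorem Continuous.offBlock {α : Type*} [TopologicalSpace α] (b : κ → Fin ℓ)
    {f : α → Matrix κ κ ℝ} (hf : Continuous f) : Continuous fun x => offBlock b (f x) := by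
  refine continuous_matrix fun k a => ?_
  simp only [offBlock_apply]
  split_ifs
  · exact continuous_const
  · exact hf.matrix_elem k a

theorem IsBlockPartition.exists_label {C : Fin ℓ → Finset (Fin p)} (hC : IsBlockPartition C) :
    ∃ b : Fin p → Fin ℓ, ∀ a i, a ∈ C i ↔ b a = i := by
  choose b hb using hC.2
  refine ⟨b, fun a i => ⟨fun h => ?_, fun h => h ▸ hb a⟩⟩
  by_contra hne
  exact Finset.disjoint_left.mp (hC.1 _ _ hne) (hb a) h

theorem mem_biUnion_iff_label {C : Fin ℓ → Finset (Fin p)} {b : Fin p → Fin ℓ}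
    (hb : ∀ a i, a ∈ C i ↔ b a = i) (s : Finset (Fin ℓ)) (a : Fin p) :
    a ∈ s.biUnion C ↔ b a ∈ s := by
  rw [Finset.mem_biUnion]
  constructor
  · rintro ⟨i, hi, ha⟩
    rwa [(hb a i).mp ha]
  · exact fun h => ⟨b a, h, (hb a _).mpr rfl⟩

end OffBlock

/-! ### The averaging operator and its inverse -/

section Averaging

variable {n p ℓ : ℕ} {C : Fin ℓ → Finset (Fin p)} {b : Fin p → Fin ℓ}

theorem avgOp_term (X ξ : Matrix (Fin n) (Fin p) ℝ) (D : Finset (Fin p)) :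
    (1 - cols X Dᶜ * (cols X Dᶜ)ᵀ) * cols ξ D * (cols (1 : Matrix (Fin p) (Fin p) ℝ) D)ᵀ =
      ξ * colSel D - X * ((1 - colSel D) * (Xᵀ * ξ) * colSel D) := by
  rw [cols_eq_mul ξ D, cols_eq_mul X Dᶜ, Matrix.mul_assoc, Matrix.mul_assoc ξ,
    cols_one_mul_transpose, ← colSel_compl, ← cols_one_mul_transpose Dᶜ]
  simp only [Matrix.transpose_mul, Matrix.sub_mul, Matrix.one_mul, Matrix.mul_assoc]

/-- Each column index is selected by `ℓ - 1` pairs of blocks. -/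
theorem sum_mul_colSel (hℓ : 2 ≤ ℓ) (hb : ∀ a i, a ∈ C i ↔ b a = i)
    {m : Type*} (ξ : Matrix m (Fin p) ℝ) :
    ∑ s ∈ blockPairs ℓ, ξ * colSel (s.biUnion C) = ((ℓ : ℝ) - 1) • ξ := by
  ext i a
  rw [Matrix.sum_apply]
  simp only [mul_colSel_apply, mem_biUnion_iff_label hb]
  rw [← Finset.mul_sum, sum_blockPairs_mem hℓ, Matrix.smul_apply, smul_eq_mul, mul_comm]

/-- Two column indices in different blocks are separated, with the second one selected, by
`ℓ - 2` pairs of blocks. -/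
theorem sum_compl_colSel_mul_colSel (hℓ : 2 ≤ ℓ) (hb : ∀ a i, a ∈ C i ↔ b a = i)
    (M : Matrix (Fin p) (Fin p) ℝ) :
    ∑ s ∈ blockPairs ℓ, (1 - colSel (s.biUnion C)) * M * colSel (s.biUnion C) =
      ((ℓ : ℝ) - 2) • offBlock b M := by
  ext k a
  rw [Matrix.sum_apply, Matrix.smul_apply, offBlock_apply, smul_eq_mul]
  have h1 : ∀ s ∈ blockPairs ℓ,
      ((1 - colSel (s.biUnion C)) * M * colSel (s.biUnion C)) k a =
        M k a * ((if b a ∈ s then 1 else 0) -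
          (if b k ∈ s then 1 else 0) * (if b a ∈ s then 1 else 0)) := by
    intro s _
    rw [mul_colSel_apply, Matrix.sub_mul, Matrix.sub_apply, colSel_mul_apply, Matrix.one_mul]
    simp only [mem_biUnion_iff_label hb]
    ring
  rw [Finset.sum_congr rfl h1, ← Finset.mul_sum, Finset.sum_sub_distrib, sum_blockPairs_mem hℓ]
  split_ifs with h
  · have h2 : ∀ s ∈ blockPairs ℓ, (if b k ∈ s then (1 : ℝ) else 0) * (if b a ∈ s then 1 else 0) =
        if b a ∈ s then 1 else 0 := by
      intro s _
      rw [h]; split_ifs <;> simp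
    rw [Finset.sum_congr rfl h2, sum_blockPairs_mem hℓ]
    ring
  · rw [sum_blockPairs_mem_mem h]
    ring

theorem avgOp_apply (hℓ : 2 ≤ ℓ) (hb : ∀ a i, a ∈ C i ↔ b a = i)
    (X ξ : Matrix (Fin n) (Fin p) ℝ) :
    avgOp C X ξ =
      (2 / (ℓ : ℝ)) • ξ - (2 * (ℓ - 2) / (ℓ * (ℓ - 1)) : ℝ) • (X * offBlock b (Xᵀ * ξ)) := by
  have h2 : (2 : ℝ) ≤ ℓ := by exact_mod_cast hℓ
  have h3 : (ℓ : ℝ) - 1 ≠ 0 := by linarith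
  have h0 : avgOp C X ξ = (1 / (ℓ.choose 2 : ℝ)) • ∑ s ∈ blockPairs ℓ,
      (1 - cols X (s.biUnion C)ᶜ * (cols X (s.biUnion C)ᶜ)ᵀ) * cols ξ (s.biUnion C) *
        (cols (1 : Matrix (Fin p) (Fin p) ℝ) (s.biUnion C))ᵀ := rfl
  rw [h0, Finset.sum_congr rfl fun s _ => avgOp_term X ξ (s.biUnion C), Finset.sum_sub_distrib,
    sum_mul_colSel hℓ hb, ← Matrix.mul_sum, sum_compl_colSel_mul_colSel hℓ hb, Matrix.mul_smul,
    smul_sub, smul_smul, smul_smul, Nat.cast_choose_two]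
  congr 2 <;> field_simp

/-- The inverse of the averaging operator,
`ξ ↦ (ℓ/2) (ξ + (ℓ - 2) X offBlock(Xᵀ ξ))`. -/
def avgInv (b : Fin p → Fin ℓ) (X : Matrix (Fin n) (Fin p) ℝ) :
    Module.End ℝ (Matrix (Fin n) (Fin p) ℝ) where
  toFun ξ := ((ℓ : ℝ) / 2) • (ξ + ((ℓ : ℝ) - 2) • (X * offBlock b (Xᵀ * ξ)))
  map_add' ξ η := by
    rw [Matrix.mul_add, offBlock_add, Matrix.mul_add]; module
  map_smul' c ξ := by
    rw [Matrix.mul_smul, offBlock_smul, Matrix.mul_smul, RingHom.id_apply]; module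

theorem avgInv_apply (b : Fin p → Fin ℓ) (X ξ : Matrix (Fin n) (Fin p) ℝ) :
    avgInv b X ξ = ((ℓ : ℝ) / 2) • (ξ + ((ℓ : ℝ) - 2) • (X * offBlock b (Xᵀ * ξ))) := rfl

theorem inverse_avgOp (hℓ : 2 ≤ ℓ) (hb : ∀ a i, a ∈ C i ↔ b a = i)
    {X : Matrix (Fin n) (Fin p) ℝ} (hX : Xᵀ * X = 1) :
    Ring.inverse (avgOp C X) = avgInv b X := by
  have h2 : (2 : ℝ) ≤ ℓ := by exact_mod_cast hℓ
  have h3 : (ℓ : ℝ) - 1 ≠ 0 := by linarith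
  -- `X offBlock(Xᵀ ·)` is idempotent, so both composites reduce to an identity of scalars.
  have hidem : ∀ M, offBlock b (Xᵀ * (X * offBlock b M)) = offBlock b M := fun M => by
    rw [← Matrix.mul_assoc, hX, Matrix.one_mul, offBlock_offBlock]
  have h4 : avgOp C X * avgInv b X = 1 := by
    ext1 ξ
    rw [Module.End.mul_apply, avgOp_apply hℓ hb, avgInv_apply, Module.End.one_apply]
    simp only [Matrix.mul_smul, Matrix.mul_add, offBlock_smul, offBlock_add, hidem, smul_add,
      smul_smul]
    match_scalars <;> field_simp
    ring
  have h5 : avgInv b X * avgOp C X = 1 := by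
    ext1 ξ
    rw [Module.End.mul_apply, avgOp_apply hℓ hb, avgInv_apply, Module.End.one_apply]
    simp only [Matrix.mul_smul, Matrix.mul_sub, offBlock_smul, offBlock_sub, hidem, smul_add,
      smul_smul]
    match_scalars <;> field_simp
    ring
  exact Ring.inverse_unit (⟨avgOp C X, avgInv b X, h4, h5⟩ : (Module.End ℝ _)ˣ)

/-- `(2/ℓ) ‖ξ‖²` in the Mahalanobis norm at a point of the Stiefel manifold. -/
def blockQuad (b : Fin p → Fin ℓ) (X ξ : Matrix (Fin n) (Fin p) ℝ) : ℝ :=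
  frobInner ξ ξ + ((ℓ : ℝ) - 2) * frobInner (offBlock b (Xᵀ * ξ)) (offBlock b (Xᵀ * ξ))

theorem frobInner_avgInv (b : Fin p → Fin ℓ) (X ξ η : Matrix (Fin n) (Fin p) ℝ) :
    frobInner (avgInv b X ξ) η = (ℓ : ℝ) / 2 * (frobInner ξ η +
      ((ℓ : ℝ) - 2) * frobInner (offBlock b (Xᵀ * ξ)) (offBlock b (Xᵀ * η))) := by
  rw [avgInv_apply, frobInner_smul_left, frobInner_add_left, frobInner_smul_left,
    frobInner_mul_left, frobInner_offBlock_left]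

theorem frobInner_self_le_blockQuad (hℓ : 2 ≤ ℓ) (b : Fin p → Fin ℓ)
    (X ξ : Matrix (Fin n) (Fin p) ℝ) : frobInner ξ ξ ≤ blockQuad b X ξ := by
  have h2 : (2 : ℝ) ≤ ℓ := by exact_mod_cast hℓ
  have := frobInner_self_nonneg (offBlock b (Xᵀ * ξ))
  rw [blockQuad]
  nlinarith

theorem mahalNorm_sq (hℓ : 2 ≤ ℓ) (hb : ∀ a i, a ∈ C i ↔ b a = i)
    {X : Matrix (Fin n) (Fin p) ℝ} (hX : Xᵀ * X = 1) (ξ : Matrix (Fin n) (Fin p) ℝ) :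
    mahalNorm C X ξ ^ 2 = (ℓ : ℝ) / 2 * blockQuad b X ξ := by
  have h := frobInner_avgInv b X ξ ξ
  rw [mahalNorm, inverse_avgOp hℓ hb hX, Real.sq_sqrt, h, blockQuad]
  rw [h]
  exact mul_nonneg (by positivity) ((frobInner_self_nonneg ξ).trans
    (frobInner_self_le_blockQuad hℓ b X ξ))

@[fun_prop]
theorem Continuous.blockQuad {α : Type*} [TopologicalSpace α] (b : Fin p → Fin ℓ)
    {F G : α → Matrix (Fin n) (Fin p) ℝ} (hF : Continuous F) (hG : Continuous G) :
    Continuous fun x => blockQuad b (F x) (G x) := by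
  unfold RSSM.blockQuad
  fun_prop

end Averaging

/-! ### Clarke subgradients of weakly convex functions -/

section Subgradient

variable {n p : ℕ} {f : Matrix (Fin n) (Fin p) ℝ → ℝ} {τ L : ℝ}
  {U : Set (Matrix (Fin n) (Fin p) ℝ)}

theorem mem_nhds_of_mem_stiefel (hU : U ∈ 𝓝ˢ (stiefel n (Fin p)))
    {X : Matrix (Fin n) (Fin p) ℝ} (hX : Xᵀ * X = 1) : U ∈ 𝓝 X :=
  mem_nhdsSet_iff_forall.mp hU X hX

theorem mem_of_mem_stiefel (hU : U ∈ 𝓝ˢ (stiefel n (Fin p)))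
    {X : Matrix (Fin n) (Fin p) ℝ} (hX : Xᵀ * X = 1) : X ∈ U :=
  mem_of_mem_nhds (mem_nhds_of_mem_stiefel hU hX)

/-- Weak convexity along a segment. -/
theorem weaklyConvex_segment (hconv : ConvexOn ℝ U fun X => f X + τ / 2 * frobNorm X ^ 2)
    {q Y : Matrix (Fin n) (Fin p) ℝ} (hq : q ∈ U) (hY : Y ∈ U) {t : ℝ} (ht0 : 0 ≤ t)
    (ht1 : t ≤ 1) :
    f (q + t • (Y - q)) ≤
      (1 - t) * f q + t * f Y + τ / 2 * (t * (1 - t)) * frobInner (Y - q) (Y - q) := by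
  have h := hconv.2 hq hY (sub_nonneg.mpr ht1) ht0 (by ring)
  have e : (1 - t) • q + t • Y = q + t • (Y - q) := by module
  rw [e] at h
  simp only [frobNorm_sq, smul_eq_mul, frobInner_add_left, frobInner_add_right,
    frobInner_sub_left, frobInner_sub_right, frobInner_smul_left, frobInner_smul_right,
    frobInner_comm Y q] at h ⊢
  linarith

theorem tendsto_add_smul (X V : Matrix (Fin n) (Fin p) ℝ) :
    Tendsto (fun q : Matrix (Fin n) (Fin p) ℝ × ℝ => q.1 + q.2 • V) (𝓝 X ×ˢ 𝓝[>] (0 : ℝ))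
      (𝓝 X) := by
  have h : Continuous fun q : Matrix (Fin n) (Fin p) ℝ × ℝ => q.1 + q.2 • V := by fun_prop
  have h1 := h.tendsto (X, 0)
  simp only [zero_smul, add_zero] at h1
  refine h1.mono_left ?_
  rw [nhds_prod_eq]
  exact Filter.prod_mono le_rfl nhdsWithin_le_nhds

/-- A Clarke subgradient of an `L`-Lipschitz function has norm at most `L`. -/
theorem frobNorm_clarkeSubdiff_le {X G : Matrix (Fin n) (Fin p) ℝ} (hU : U ∈ 𝓝 X)
    (hLip : ∀ X ∈ U, ∀ Y ∈ U, |f X - f Y| ≤ L * frobNorm (X - Y)) (hL : 0 ≤ L)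
    (hG : G ∈ clarkeSubdiff f X) : frobNorm G ≤ L := by
  have h1 : clarkeDeriv f X G ≤ ((L * frobNorm G : ℝ) : EReal) := by
    refine limsup_le_of_le (h := ?_)
    filter_upwards [tendsto_fst.eventually_mem hU, (tendsto_add_smul X G).eventually_mem hU,
      tendsto_snd.eventually_mem self_mem_nhdsWithin] with q hq1 hq2 hq3
    have hq3' : 0 < q.2 := hq3
    rw [EReal.coe_le_coe_iff, div_le_iff₀ hq3']
    have := (le_abs_self _).trans (hLip _ hq2 _ hq1)
    rw [add_sub_cancel_left, frobNorm_smul, abs_of_pos hq3'] at this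
    linarith
  have h2 := EReal.coe_le_coe_iff.mp ((hG G).trans h1)
  rw [← frobNorm_sq] at h2
  by_contra! hlt
  nlinarith [frobNorm_nonneg G]

/-- The subgradient inequality of a weakly convex function, for Clarke subgradients. -/
theorem le_of_mem_clarkeSubdiff {X Y G : Matrix (Fin n) (Fin p) ℝ} (hU : U ∈ 𝓝 X)
    (hconv : ConvexOn ℝ U fun X => f X + τ / 2 * frobNorm X ^ 2) (hτ : 0 ≤ τ)
    (hLip : ∀ X ∈ U, ∀ Y ∈ U, |f X - f Y| ≤ L * frobNorm (X - Y)) (hY : Y ∈ U)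
    (hG : G ∈ clarkeSubdiff f X) :
    frobInner G (Y - X) ≤ f Y - f X + τ / 2 * frobInner (Y - X) (Y - X) := by
  have hXU := mem_of_mem_nhds hU
  refine le_of_forall_pos_le_add fun ε hε => ?_
  rw [← EReal.coe_le_coe_iff]
  refine (hG (Y - X)).trans (limsup_le_of_le (h := ?_))
  -- The bound for the difference quotient at `q`, continuous in `q`.
  have hφ : Continuous fun q : Matrix (Fin n) (Fin p) ℝ =>
      f Y - f X + τ / 2 * frobInner (Y - q) (Y - q) + 2 * L * frobNorm (q - X) := by fun_prop
  have hφX : f Y - f X + τ / 2 * frobInner (Y - X) (Y - X) + 2 * L * frobNorm (X - X) <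
      f Y - f X + τ / 2 * frobInner (Y - X) (Y - X) + ε := by
    rw [sub_self X, frobNorm, frobInner_zero_left, Real.sqrt_zero]
    linarith
  have hev := hφ.continuousAt.eventually_lt_const hφX
  filter_upwards [tendsto_fst.eventually_mem hU, (tendsto_add_smul X (Y - X)).eventually_mem hU,
    tendsto_snd.eventually_mem (Ioo_mem_nhdsGT (zero_lt_one (α := ℝ))),
    tendsto_fst.eventually hev] with q hq1 hq2 hq3 hq4
  obtain ⟨ht0, ht1⟩ := hq3
  rw [EReal.coe_le_coe_iff, div_le_iff₀ ht0]
  have hmem : q.1 + q.2 • (Y - q.1) ∈ U := by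
    have := hconv.1 hq1 hY (sub_nonneg.mpr ht1.le) ht0.le (by ring)
    convert this using 1
    module
  have h1 := weaklyConvex_segment hconv hq1 hY ht0.le ht1.le
  have h2 := (le_abs_self _).trans (hLip _ hq2 _ hmem)
  -- Convexity applies along the segment towards `Y`; the direction `Y - X` differs by `q - X`.
  have e : q.1 + q.2 • (Y - X) - (q.1 + q.2 • (Y - q.1)) = q.2 • (q.1 - X) := by module
  rw [e, frobNorm_smul, abs_of_pos ht0] at h2
  have h3 := (abs_le.mp (hLip _ hq1 _ hXU)).1
  have h4 := mul_le_mul_of_nonneg_left hq4.le ht0.le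
  have h5 : q.2 * (f X - f q.1) ≤ q.2 * (L * frobNorm (q.1 - X)) :=
    mul_le_mul_of_nonneg_left (by linarith) ht0.le
  have h6 : 0 ≤ τ / 2 * (q.2 * q.2) * frobInner (Y - q.1) (Y - q.1) :=
    mul_nonneg (by positivity) (frobInner_self_nonneg _)
  nlinarith

theorem continuousOn_of_lipschitz (hU : U ∈ 𝓝ˢ (stiefel n (Fin p)))
    (hLip : ∀ X ∈ U, ∀ Y ∈ U, |f X - f Y| ≤ L * frobNorm (X - Y)) :
    ContinuousOn f (stiefel n (Fin p)) := by
  intro X hX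
  refine ContinuousAt.continuousWithinAt ?_
  have hUX := mem_nhds_of_mem_stiefel hU hX
  rw [ContinuousAt, tendsto_iff_dist_tendsto_zero]
  have hc : Continuous fun Y : Matrix (Fin n) (Fin p) ℝ => L * frobNorm (Y - X) := by fun_prop
  have h0 := hc.tendsto X
  simp only [sub_self, frobNorm, frobInner_zero_left, Real.sqrt_zero, mul_zero] at h0
  refine squeeze_zero' (Eventually.of_forall fun _ => dist_nonneg) ?_ h0
  filter_upwards [hUX] with Y hY
  exact hLip Y hY X (mem_of_mem_nhds hUX)

theorem isCompact_stiefel : IsCompact (stiefel n (Fin p)) := by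
  have hcl : IsClosed (stiefel n (Fin p)) := by
    have : Continuous fun X : Matrix (Fin n) (Fin p) ℝ => Xᵀ * X := by fun_prop
    exact isClosed_eq this continuous_const
  have hcpt : IsCompact (Set.univ.pi fun _ : Fin n => Set.univ.pi fun _ : Fin p =>
      Set.Icc (-1 : ℝ) 1) :=
    isCompact_univ_pi fun _ => isCompact_univ_pi fun _ => isCompact_Icc
  refine hcpt.of_isClosed_subset hcl ?_
  rintro (X : Matrix (Fin n) (Fin p) ℝ) hX i - j -
  have h1 : (Xᵀ * X) j j = 1 := by
    rw [show Xᵀ * X = 1 from hX, Matrix.one_apply_eq]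
  rw [Matrix.mul_apply] at h1
  have h2 : X i j * X i j ≤ 1 := by
    rw [← h1]
    exact Finset.single_le_sum (f := fun x => Xᵀ j x * X x j)
      (fun x _ => mul_self_nonneg (X x j)) (Finset.mem_univ i)
  exact abs_le.mp (abs_le_one_iff_mul_self_le_one.mpr h2)

/-- The normal part of a subgradient contributes to `⟨G, Z - X⟩` only to second order. -/
theorem frobInner_riemannian_le {X Z G : Matrix (Fin n) (Fin p) ℝ} (hX : Xᵀ * X = 1)
    (hZ : Zᵀ * Z = 1) (hG : frobNorm G ≤ L) :
    frobInner (Z - X) (G - X * (Xᵀ * G)) + frobInner (Xᵀ * (Z - X)) (skewPart X G) ≤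
      frobInner G (Z - X) + L / 2 * frobInner (Z - X) (Z - X) := by
  set W := Z - X with hW
  -- the symmetric part of `XᵀW` is `-WᵀW/2`
  have h1 : Xᵀ * W + (Xᵀ * W)ᵀ = -(Wᵀ * W) := by
    have : Zᵀ * Z = (X + W)ᵀ * (X + W) := by rw [hW, add_sub_cancel]
    rw [hZ, Matrix.transpose_add, Matrix.add_mul, Matrix.mul_add, Matrix.mul_add, hX] at this
    rw [Matrix.transpose_mul, Matrix.transpose_transpose, eq_neg_iff_add_eq_zero]
    have h2 := sub_eq_zero.mpr this.symm
    rw [← h2]; abel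
  have h2 : frobInner (Xᵀ * W) (Xᵀ * G) = frobInner W (X * (Xᵀ * G)) := by
    rw [frobInner_mul_left, Matrix.transpose_transpose]
  have h3 : frobInner (Xᵀ * W) (Gᵀ * X) = frobInner (Xᵀ * W)ᵀ (Xᵀ * G) := by
    rw [← frobInner_transpose, Matrix.transpose_mul Gᵀ, Matrix.transpose_transpose]
  have h4 : frobInner (Xᵀ * W) (Xᵀ * G) + frobInner (Xᵀ * W)ᵀ (Xᵀ * G) =
      -frobInner (Wᵀ * W) (Xᵀ * G) := by
    rw [← frobInner_add_left, h1, frobInner_neg_left]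
  have h5 : frobInner (Wᵀ * W) (Xᵀ * G) ≤ frobInner W W * L := by
    refine (frobInner_le _ _).trans ?_
    refine mul_le_mul ?_ ?_ (frobNorm_nonneg _) (frobInner_self_nonneg _)
    · rw [← frobNorm_sq, pow_two]
      exact (frobNorm_mul_le _ _).trans (by rw [frobNorm_transpose])
    · exact (Real.sqrt_le_sqrt (frobInner_transpose_mul_le hX G)).trans hG
  rw [skewPart, frobInner_smul_right, frobInner_sub_right, frobInner_sub_right, h3, ← h2,
    frobInner_comm G]
  linarith

end Subgradient

/-! ### The adaptive proximal map -/

section Prox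

variable {n p ℓ : ℕ} {f : Matrix (Fin n) (Fin p) ℝ → ℝ} {τ L lam : ℝ}
  {U : Set (Matrix (Fin n) (Fin p) ℝ)} {C : Fin ℓ → Finset (Fin p)} {b : Fin p → Fin ℓ}

theorem proxObj_eq (hℓ : 2 ≤ ℓ) (hb : ∀ a i, a ∈ C i ↔ b a = i)
    {X : Matrix (Fin n) (Fin p) ℝ} (hX : Xᵀ * X = 1) (Y : Matrix (Fin n) (Fin p) ℝ) :
    proxObj f C lam X Y = f Y + ℓ / (4 * lam) * blockQuad b X (Y - X) := by
  rw [proxObj, mahalNorm_sq hℓ hb hX, ← mul_assoc, one_div_mul_eq_div, div_div]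
  ring_nf

theorem proxObj_self (hℓ : 2 ≤ ℓ) (hb : ∀ a i, a ∈ C i ↔ b a = i)
    {X : Matrix (Fin n) (Fin p) ℝ} (hX : Xᵀ * X = 1) : proxObj f C lam X X = f X := by
  rw [proxObj_eq hℓ hb hX, sub_self, blockQuad, Matrix.mul_zero]
  have : offBlock b (0 : Matrix (Fin p) (Fin p) ℝ) = 0 := by
    simpa using offBlock_smul b 0 (0 : Matrix (Fin p) (Fin p) ℝ)
  rw [this, frobInner_zero_left, frobInner_zero_left]
  ring

theorem nonempty_proxSet (hU : U ∈ 𝓝ˢ (stiefel n (Fin p)))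
    (hLip : ∀ X ∈ U, ∀ Y ∈ U, |f X - f Y| ≤ L * frobNorm (X - Y)) (hℓ : 2 ≤ ℓ)
    (hb : ∀ a i, a ∈ C i ↔ b a = i) {X : Matrix (Fin n) (Fin p) ℝ} (hX : Xᵀ * X = 1) :
    (proxSet f C lam X).Nonempty := by
  have hc : ContinuousOn (proxObj f C lam X) (stiefel n (Fin p)) := by
    have h1 : Continuous fun Y => ℓ / (4 * lam) * blockQuad b X (Y - X) :=
      continuous_const.mul
        (Continuous.blockQuad b continuous_const (continuous_id.sub continuous_const))
    refine ((continuousOn_of_lipschitz hU hLip).add h1.continuousOn).congr fun Y _ => ?_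
    exact proxObj_eq hℓ hb hX Y
  obtain ⟨Z, hZ, hmin⟩ := isCompact_stiefel.exists_isMinOn ⟨X, hX⟩ hc
  exact ⟨Z, hZ, fun Y hY => isMinOn_iff.mp hmin Y hY⟩

/-- A minimizer of the proximal problem is within `4 λ L / ℓ` of the centre. -/
theorem frobNorm_sub_le_of_mem_proxSet (hU : U ∈ 𝓝ˢ (stiefel n (Fin p)))
    (hLip : ∀ X ∈ U, ∀ Y ∈ U, |f X - f Y| ≤ L * frobNorm (X - Y)) (hℓ : 2 ≤ ℓ) (hlam : 0 < lam)
    (hL : 0 ≤ L) (hb : ∀ a i, a ∈ C i ↔ b a = i) {X Z : Matrix (Fin n) (Fin p) ℝ}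
    (hX : Xᵀ * X = 1) (hZ : Z ∈ proxSet f C lam X) : frobNorm (Z - X) ≤ 4 * lam * L / ℓ := by
  have h2 : (2 : ℝ) ≤ ℓ := by exact_mod_cast hℓ
  have h1 := hZ.2 X hX
  rw [proxObj_self hℓ hb hX, proxObj_eq hℓ hb hX] at h1
  have h3 := (abs_le.mp (hLip X (mem_of_mem_stiefel hU hX) Z (mem_of_mem_stiefel hU hZ.1))).2
  rw [frobNorm_sub_comm] at h3
  have h4 := mul_le_mul_of_nonneg_left (frobInner_self_le_blockQuad hℓ b X (Z - X))
    (by positivity : 0 ≤ ℓ / (4 * lam))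
  rw [← frobNorm_sq] at h4
  have h5 : ℓ / (4 * lam) * frobNorm (Z - X) ^ 2 ≤ L * frobNorm (Z - X) := by linarith
  by_contra! hlt
  have h6 : L < ℓ / (4 * lam) * frobNorm (Z - X) := by
    rw [div_mul_eq_mul_div, lt_div_iff₀ (by positivity)]
    rw [div_lt_iff₀ (by positivity)] at hlt
    linarith
  have h7 : 0 < frobNorm (Z - X) := lt_of_le_of_lt (by positivity) hlt
  nlinarith

theorem frobNorm_avgInv_le (hℓ : 2 ≤ ℓ) (b : Fin p → Fin ℓ) {X : Matrix (Fin n) (Fin p) ℝ}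
    (hX : Xᵀ * X = 1) (ξ : Matrix (Fin n) (Fin p) ℝ) :
    frobNorm (avgInv b X ξ) ≤ ℓ * (ℓ - 1) / 2 * frobNorm ξ := by
  have h2 : (2 : ℝ) ≤ ℓ := by exact_mod_cast hℓ
  have h1 : frobNorm (X * offBlock b (Xᵀ * ξ)) ≤ frobNorm ξ := by
    rw [frobNorm, frobInner_isometry hX]
    exact Real.sqrt_le_sqrt
      ((frobInner_offBlock_le b _).trans (frobInner_transpose_mul_le hX ξ))
  rw [avgInv_apply, frobNorm_smul, abs_of_nonneg (by positivity)]
  have h3 := frobNorm_add_le ξ (((ℓ : ℝ) - 2) • (X * offBlock b (Xᵀ * ξ)))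
  rw [frobNorm_smul, abs_of_nonneg (by linarith)] at h3
  have h4 := mul_le_mul_of_nonneg_left h1 (by linarith : (0 : ℝ) ≤ ℓ - 2)
  have h5 := mul_le_mul_of_nonneg_left (h3.trans (add_le_add_right h4 _))
    (by positivity : (0 : ℝ) ≤ ℓ / 2)
  linarith

theorem blockQuad_add (b : Fin p → Fin ℓ) (X ξ η : Matrix (Fin n) (Fin p) ℝ) :
    (ℓ : ℝ) / 2 * blockQuad b X (ξ + η) =
      ℓ / 2 * blockQuad b X ξ + 2 * frobInner (avgInv b X ξ) η + ℓ / 2 * blockQuad b X η := by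
  rw [frobInner_avgInv]
  simp only [blockQuad, Matrix.mul_add, offBlock_add, frobInner_add_left, frobInner_add_right,
    frobInner_comm η ξ, frobInner_comm (offBlock b (Xᵀ * η)) (offBlock b (Xᵀ * ξ))]
  ring

theorem blockQuad_le (hℓ : 2 ≤ ℓ) (b : Fin p → Fin ℓ) {X : Matrix (Fin n) (Fin p) ℝ}
    (hX : Xᵀ * X = 1) (ξ : Matrix (Fin n) (Fin p) ℝ) :
    blockQuad b X ξ ≤ (ℓ - 1) * frobInner ξ ξ := by
  have h2 : (2 : ℝ) ≤ ℓ := by exact_mod_cast hℓ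
  have h1 := (frobInner_offBlock_le b _).trans (frobInner_transpose_mul_le hX ξ)
  have := mul_le_mul_of_nonneg_left h1 (by linarith : (0 : ℝ) ≤ ℓ - 2)
  rw [blockQuad]
  linarith

/-- First-order optimality of a minimizer `Z` of the proximal problem, tested with another point
`Z'` of the Stiefel manifold. It comes from comparing `Z` with the retraction of `Z + t ξ`, where
`ξ` is the tangential part of `Z' - Z`, as `t → 0`. -/
theorem prox_first_order (hτ : 0 ≤ τ) (hU : U ∈ 𝓝ˢ (stiefel n (Fin p)))
    (hconv : ConvexOn ℝ U fun X => f X + τ / 2 * frobNorm X ^ 2)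
    (hLip : ∀ X ∈ U, ∀ Y ∈ U, |f X - f Y| ≤ L * frobNorm (X - Y)) (hℓ : 2 ≤ ℓ) (hlam : 0 < lam)
    (hL : 0 ≤ L) (hb : ∀ a i, a ∈ C i ↔ b a = i) {X Z Z' : Matrix (Fin n) (Fin p) ℝ}
    (hX : Xᵀ * X = 1) (hZ : Z ∈ proxSet f C lam X) (hZ' : Z'ᵀ * Z' = 1) :
    0 ≤ f Z' - f Z + (τ + L) / 2 * frobInner (Z' - Z) (Z' - Z) +
      1 / lam * (frobInner (avgInv b X (Z - X)) (Z' - Z) +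
        1 / 2 * (frobNorm (avgInv b X (Z - X)) * frobInner (Z' - Z) (Z' - Z))) := by
  have h2 : (2 : ℝ) ≤ ℓ := by exact_mod_cast hℓ
  have hZZ : Zᵀ * Z = 1 := hZ.1
  set V := Z' - Z with hV
  set A := avgInv b X (Z - X) with hA
  -- `-N` is the normal part of `V`, so `ξ` is tangent to the Stiefel manifold at `Z`
  set N := (1 / 2 : ℝ) • (Z * (Vᵀ * V)) with hN
  set ξ := V + N with hξ
  have hNn : frobNorm N ≤ 1 / 2 * frobInner V V := by
    rw [hN, frobNorm_smul, abs_of_nonneg (by norm_num)]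
    refine mul_le_mul_of_nonneg_left ?_ (by norm_num)
    rw [frobNorm, frobInner_isometry hZZ, ← frobNorm, ← frobNorm_sq, pow_two]
    exact (frobNorm_mul_le _ _).trans (by rw [frobNorm_transpose])
  have htan : ξᵀ * Z + Zᵀ * ξ = 0 := by
    have h3 : Z'ᵀ * Z' = (Z + V)ᵀ * (Z + V) := by rw [hV, add_sub_cancel]
    rw [hZ', Matrix.transpose_add, Matrix.add_mul, Matrix.mul_add, Matrix.mul_add, hZZ] at h3
    have h4 : Vᵀ * Z + Zᵀ * V + Vᵀ * V = 0 := by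
      have h5 := sub_eq_zero.mpr h3.symm
      rw [← h5]; abel
    have h5 : Zᵀ * N = (1 / 2 : ℝ) • (Vᵀ * V) := by
      rw [hN, Matrix.mul_smul, ← Matrix.mul_assoc, hZZ, Matrix.one_mul]
    have h6 : Nᵀ * Z = (1 / 2 : ℝ) • (Vᵀ * V) := by
      have := congrArg Matrix.transpose h5
      simpa [Matrix.transpose_mul] using this
    rw [hξ, Matrix.transpose_add, Matrix.add_mul, Matrix.mul_add, h5, h6, ← h4]
    module
  set x := frobNorm ξ with hx
  have hx0 : 0 ≤ x := frobNorm_nonneg _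
  have hA0 : 0 ≤ frobNorm A := frobNorm_nonneg _
  set K := L * x ^ 2 / 2 + 1 / lam * (frobNorm A * x ^ 2 / 2) +
    ℓ / (4 * lam) * ((ℓ - 1) * (x + x ^ 2 / 2) ^ 2) with hK
  have hmain : ∀ᶠ t : ℝ in 𝓝[>] 0, 0 ≤ f Z' - f Z + (τ + L) / 2 * frobInner V V +
      1 / lam * (frobInner A V + 1 / 2 * (frobNorm A * frobInner V V)) + t * K := by
    have hcont : Continuous fun t : ℝ => Z + t • ξ := by fun_prop
    have hmemU : ∀ᶠ t : ℝ in 𝓝[>] 0, Z + t • ξ ∈ U := by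
      refine nhdsWithin_le_nhds (hcont.continuousAt.eventually_mem ?_)
      simpa using mem_nhds_of_mem_stiefel hU hZZ
    filter_upwards [hmemU, Ioo_mem_nhdsGT (zero_lt_one (α := ℝ))] with t htU ht
    obtain ⟨ht0, ht1⟩ := ht
    obtain ⟨Y, R, -, hR, hRR, hY, hYR, -⟩ := exists_polar (A := Z) (D := t • ξ) hZZ (by
      rw [Matrix.transpose_smul, Matrix.smul_mul, Matrix.mul_smul, ← smul_add, htan, smul_zero])
    have hRn : frobNorm (Y * R) ≤ t ^ 2 * (x ^ 2 / 2) := by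
      rw [frobNorm, frobInner_isometry hY, ← frobNorm]
      refine (frobNorm_le_trace hR).trans ((trace_le_of_sq hR hRR).trans (le_of_eq ?_))
      rw [frobInner_smul_left, frobInner_smul_right, hx, frobNorm_sq]
      ring
    have hmin := hZ.2 Y hY
    rw [proxObj_eq hℓ hb hX, proxObj_eq hℓ hb hX] at hmin
    -- the Lipschitz function
    have hf1 := (abs_le.mp (hLip _ (mem_of_mem_stiefel hU hY) _ htU)).2
    have e1 : Y - (Z + t • ξ) = -(Y * R) := by rw [← hYR]; abel
    rw [e1, ← zero_sub, frobNorm_sub_comm, sub_zero] at hf1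
    have hZU := mem_of_mem_stiefel hU hZZ
    have hZ'U := mem_of_mem_stiefel hU hZ'
    have hseg : Z + t • (Z' - Z) ∈ U := by
      have := hconv.1 hZU hZ'U (sub_nonneg.mpr ht1.le) ht0.le (by ring)
      convert this using 1
      module
    have hf2 := (abs_le.mp (hLip _ htU _ hseg)).2
    have e2 : Z + t • ξ - (Z + t • (Z' - Z)) = t • N := by rw [hξ, ← hV]; module
    rw [e2, frobNorm_smul, abs_of_pos ht0] at hf2
    have hf3 := weaklyConvex_segment hconv hZU hZ'U ht0.le ht1.le
    rw [← hV] at hf3 hf2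
    -- the quadratic
    have e3 : Y - X = (Z - X) + (t • ξ - Y * R) := by
      have : Y = Z + t • ξ - Y * R := by rw [← hYR]; abel
      nth_rewrite 1 [this]; abel
    have hq := blockQuad_add b X (Z - X) (t • ξ - Y * R)
    rw [← e3, ← hA] at hq
    have hEn : frobNorm (t • ξ - Y * R) ≤ t * (x + x ^ 2 / 2) := by
      have h5 := frobNorm_add_le (t • ξ) (-(Y * R))
      rw [← sub_eq_add_neg, ← zero_sub (Y * R), frobNorm_sub_comm 0, sub_zero, frobNorm_smul,
        abs_of_pos ht0, ← hx] at h5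
      have : t ^ 2 * (x ^ 2 / 2) ≤ t * (x ^ 2 / 2) :=
        mul_le_mul_of_nonneg_right (by nlinarith) (by positivity)
      linarith
    have hE2 : blockQuad b X (t • ξ - Y * R) ≤ (ℓ - 1) * (t * (x + x ^ 2 / 2)) ^ 2 := by
      refine (blockQuad_le hℓ b hX _).trans (mul_le_mul_of_nonneg_left ?_ (by linarith))
      rw [← frobNorm_sq]
      exact pow_le_pow_left₀ (frobNorm_nonneg _) hEn 2
    have hlin : frobInner A (t • ξ - Y * R) ≤ t * (frobInner A V +
        1 / 2 * (frobNorm A * frobInner V V)) + t ^ 2 * (frobNorm A * x ^ 2 / 2) := by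
      have h5 : frobInner A N ≤ frobNorm A * (1 / 2 * frobInner V V) :=
        (frobInner_le _ _).trans (mul_le_mul_of_nonneg_left hNn hA0)
      have h6 : -frobInner A (Y * R) ≤ frobNorm A * (t ^ 2 * (x ^ 2 / 2)) :=
        (neg_le_abs _).trans ((abs_frobInner_le _ _).trans (mul_le_mul_of_nonneg_left hRn hA0))
      rw [frobInner_sub_right, frobInner_smul_right, hξ, frobInner_add_right]
      nlinarith
    have hQ : ℓ / (4 * lam) * blockQuad b X (Y - X) - ℓ / (4 * lam) * blockQuad b X (Z - X) ≤
        1 / lam * (t * (frobInner A V + 1 / 2 * (frobNorm A * frobInner V V)) +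
          t ^ 2 * (frobNorm A * x ^ 2 / 2)) +
        ℓ / (4 * lam) * ((ℓ - 1) * (t * (x + x ^ 2 / 2)) ^ 2) := by
      have h5 := mul_le_mul_of_nonneg_left hlin (by positivity : 0 ≤ 1 / lam)
      have h6 := mul_le_mul_of_nonneg_left hE2 (by positivity : 0 ≤ ℓ / (4 * lam))
      have h7 : ℓ / (4 * lam) * blockQuad b X (Y - X) = ℓ / (4 * lam) * blockQuad b X (Z - X) +
          1 / lam * frobInner A (t • ξ - Y * R) +
          ℓ / (4 * lam) * blockQuad b X (t • ξ - Y * R) := by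
        have h8 := congrArg (fun y => 1 / (2 * lam) * y) hq
        field_simp at h8 ⊢
        linarith
      linarith
    have hf4 : L * (t * frobNorm N) ≤ L * (t * (1 / 2 * frobInner V V)) := by gcongr
    have hf5 : L * frobNorm (Y * R) ≤ L * (t ^ 2 * (x ^ 2 / 2)) := by gcongr
    have hf6 : 0 ≤ τ / 2 * (t * t) * frobInner V V :=
      mul_nonneg (by positivity) (frobInner_self_nonneg _)
    refine le_of_mul_le_mul_left ?_ ht0
    rw [hK]
    linarith
  have hlim : Tendsto (fun t : ℝ => f Z' - f Z + (τ + L) / 2 * frobInner V V +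
      1 / lam * (frobInner A V + 1 / 2 * (frobNorm A * frobInner V V)) + t * K) (𝓝[>] 0)
      (𝓝 (f Z' - f Z + (τ + L) / 2 * frobInner V V +
        1 / lam * (frobInner A V + 1 / 2 * (frobNorm A * frobInner V V)))) := by
    have hc : Continuous fun t : ℝ => f Z' - f Z + (τ + L) / 2 * frobInner V V +
      1 / lam * (frobInner A V + 1 / 2 * (frobNorm A * frobInner V V)) + t * K := by fun_prop
    simpa using (hc.tendsto 0).mono_left nhdsWithin_le_nhds
  exact ge_of_tendsto hlim hmain

/-- Two minimizers coincide: the first-order condition at `Z`, tested with `Z'`, holds up to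
`(τ + (2ℓ - 1) L) / 2 ‖Z' - Z‖²`, which the quadratic term of the objective outweighs. -/
theorem proxSet_subsingleton (hτ : 0 ≤ τ) (hU : U ∈ 𝓝ˢ (stiefel n (Fin p)))
    (hconv : ConvexOn ℝ U fun X => f X + τ / 2 * frobNorm X ^ 2)
    (hLip : ∀ X ∈ U, ∀ Y ∈ U, |f X - f Y| ≤ L * frobNorm (X - Y)) (hℓ : 2 ≤ ℓ) (hlam : 0 < lam)
    (hL : 0 ≤ L) (hlam2 : τ + (2 * ℓ - 1) * L < ℓ / (2 * lam)) (hb : ∀ a i, a ∈ C i ↔ b a = i)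
    {X Z Z' : Matrix (Fin n) (Fin p) ℝ} (hX : Xᵀ * X = 1) (hZ : Z ∈ proxSet f C lam X)
    (hZ' : Z' ∈ proxSet f C lam X) : Z' = Z := by
  have h2 : (2 : ℝ) ≤ ℓ := by exact_mod_cast hℓ
  have h1 := prox_first_order hτ hU hconv hLip hℓ hlam hL hb hX hZ hZ'.1
  have h3 := hZ'.2 Z hZ.1
  rw [proxObj_eq hℓ hb hX, proxObj_eq hℓ hb hX] at h3
  have h4 := blockQuad_add b X (Z - X) (Z' - Z)
  rw [show Z - X + (Z' - Z) = Z' - X by abel] at h4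
  have h5 : ℓ / (4 * lam) * blockQuad b X (Z' - X) = ℓ / (4 * lam) * blockQuad b X (Z - X) +
      1 / lam * frobInner (avgInv b X (Z - X)) (Z' - Z) +
      ℓ / (4 * lam) * blockQuad b X (Z' - Z) := by
    have h8 := congrArg (fun y => 1 / (2 * lam) * y) h4
    field_simp at h8 ⊢
    linarith
  have h6 : 1 / lam * (1 / 2 * (frobNorm (avgInv b X (Z - X)) * frobInner (Z' - Z) (Z' - Z))) ≤
      (ℓ - 1) * L * frobInner (Z' - Z) (Z' - Z) := by
    have h7 := (frobNorm_avgInv_le hℓ b hX (Z - X)).trans (mul_le_mul_of_nonneg_left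
      (frobNorm_sub_le_of_mem_proxSet hU hLip hℓ hlam hL hb hX hZ)
      (by have : (0 : ℝ) ≤ ℓ - 1 := by linarith
          positivity))
    have h8 : ℓ * (ℓ - 1) / 2 * (4 * lam * L / ℓ) = 2 * lam * ((ℓ - 1) * L) := by
      field_simp; ring
    rw [h8] at h7
    have h9 := mul_le_mul_of_nonneg_right h7 (frobInner_self_nonneg (Z' - Z))
    have h10 := mul_le_mul_of_nonneg_left h9 (by positivity : 0 ≤ 1 / lam * (1 / 2))
    calc _ = 1 / lam * (1 / 2) *
          (frobNorm (avgInv b X (Z - X)) * frobInner (Z' - Z) (Z' - Z)) := by ring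
      _ ≤ _ := h10
      _ = _ := by field_simp
  have h7 := mul_le_mul_of_nonneg_left (frobInner_self_le_blockQuad hℓ b X (Z' - Z))
    (by positivity : 0 ≤ ℓ / (4 * lam))
  have h8 : ℓ / (2 * lam) = 2 * (ℓ / (4 * lam)) := by field_simp; norm_num
  rw [← sub_eq_zero]
  apply eq_zero_of_frobInner_self_nonpos
  by_contra! hpos
  rw [h8] at hlam2
  have h9 := mul_lt_mul_of_pos_right hlam2 hpos
  linarith

end Prox

/-! ### The proximal map and the Moreau envelope -/

section ProxMap

variable {n p ℓ : ℕ} {f : Matrix (Fin n) (Fin p) ℝ → ℝ} {τ L lam : ℝ}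
  {U : Set (Matrix (Fin n) (Fin p) ℝ)} {C : Fin ℓ → Finset (Fin p)} {b : Fin p → Fin ℓ}

theorem prox_mem_proxSet (hU : U ∈ 𝓝ˢ (stiefel n (Fin p)))
    (hLip : ∀ X ∈ U, ∀ Y ∈ U, |f X - f Y| ≤ L * frobNorm (X - Y)) (hℓ : 2 ≤ ℓ)
    (hb : ∀ a i, a ∈ C i ↔ b a = i) {X : Matrix (Fin n) (Fin p) ℝ} (hX : Xᵀ * X = 1) :
    prox f C lam X ∈ proxSet f C lam X :=
  Classical.epsilon_spec (nonempty_proxSet hU hLip hℓ hb hX)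

/-- The proximal map is continuous, being the unique minimizer over a compact set of an objective
jointly continuous in the centre and the variable. -/
theorem continuousOn_prox (hτ : 0 ≤ τ) (hU : U ∈ 𝓝ˢ (stiefel n (Fin p)))
    (hconv : ConvexOn ℝ U fun X => f X + τ / 2 * frobNorm X ^ 2)
    (hLip : ∀ X ∈ U, ∀ Y ∈ U, |f X - f Y| ≤ L * frobNorm (X - Y)) (hℓ : 2 ≤ ℓ) (hlam : 0 < lam)
    (hL : 0 ≤ L) (hlam2 : τ + (2 * ℓ - 1) * L < ℓ / (2 * lam))
    (hb : ∀ a i, a ∈ C i ↔ b a = i) :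
    ContinuousOn (prox f C lam) (stiefel n (Fin p)) := by
  intro X hX
  have hfc := continuousOn_of_lipschitz hU hLip
  have hmem : ∀ X ∈ stiefel n (Fin p), prox f C lam X ∈ proxSet f C lam X :=
    fun X hX => prox_mem_proxSet hU hLip hℓ hb hX
  refine isCompact_stiefel.tendsto_nhds_of_unique_mapClusterPt
    (eventually_mem_nhdsWithin.mono fun Y hY => (hmem Y hY).1) fun Z hZ hcl => ?_
  -- A cluster point of the minimizers at nearby centres is a minimizer at `X`.
  refine proxSet_subsingleton hτ hU hconv hLip hℓ hlam hL hlam2 hb hX (hmem X hX) ⟨hZ, ?_⟩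
  intro Y hY
  obtain ⟨u, hu, hlim⟩ := mapClusterPt_iff_ultrafilter.mp hcl
  have huS : ∀ᶠ X' in (u : Filter _), X' ∈ stiefel n (Fin p) := hu eventually_mem_nhdsWithin
  have huX : Tendsto id (u : Filter (Matrix (Fin n) (Fin p) ℝ)) (𝓝 X) :=
    hu.trans nhdsWithin_le_nhds
  have hf : Tendsto (fun X' => f (prox f C lam X')) u (𝓝 (f Z)) :=
    (hfc Z hZ).tendsto.comp (tendsto_nhdsWithin_iff.mpr
      ⟨hlim, huS.mono fun X' hX' => (hmem X' hX').1⟩)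
  have hbq : Continuous fun q : Matrix (Fin n) (Fin p) ℝ × Matrix (Fin n) (Fin p) ℝ =>
      blockQuad b q.1 (q.2 - q.1) := by fun_prop
  have hq1 := (hbq.tendsto (X, Z)).comp (huX.prodMk_nhds hlim)
  have hq2 := (hbq.tendsto (X, Y)).comp (huX.prodMk_nhds tendsto_const_nhds)
  rw [proxObj_eq hℓ hb hX, proxObj_eq hℓ hb hX]
  refine le_of_tendsto_of_tendsto (hf.add (hq1.const_mul (ℓ / (4 * lam))))
    ((tendsto_const_nhds (x := f Y)).add (hq2.const_mul (ℓ / (4 * lam)))) ?_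
  filter_upwards [huS] with X' hX'
  have h := (hmem X' hX').2 Y hY
  rwa [proxObj_eq hℓ hb hX', proxObj_eq hℓ hb hX'] at h

theorem surrogate_sq (hℓ : 2 ≤ ℓ) (hb : ∀ a i, a ∈ C i ↔ b a = i)
    {X : Matrix (Fin n) (Fin p) ℝ} (hX : Xᵀ * X = 1) :
    surrogate f C lam X ^ 2 =
      1 / lam ^ 2 * (ℓ / 2 * blockQuad b X (prox f C lam X - X)) := by
  rw [surrogate, mul_pow, mahalNorm_sq hℓ hb hX, one_div_pow]

theorem surrogate_nonneg (hlam : 0 < lam) (X : Matrix (Fin n) (Fin p) ℝ) :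
    0 ≤ surrogate f C lam X :=
  mul_nonneg (by positivity) (Real.sqrt_nonneg _)

theorem isLeast_moreau (hU : U ∈ 𝓝ˢ (stiefel n (Fin p)))
    (hLip : ∀ X ∈ U, ∀ Y ∈ U, |f X - f Y| ≤ L * frobNorm (X - Y)) (hℓ : 2 ≤ ℓ)
    (hb : ∀ a i, a ∈ C i ↔ b a = i) {X : Matrix (Fin n) (Fin p) ℝ} (hX : Xᵀ * X = 1) :
    IsLeast (proxObj f C lam X '' stiefel n (Fin p)) (moreau f C lam X) ∧
      moreau f C lam X = proxObj f C lam X (prox f C lam X) := by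
  have h := prox_mem_proxSet (lam := lam) hU hLip hℓ hb hX
  have h1 : IsLeast (proxObj f C lam X '' stiefel n (Fin p))
      (proxObj f C lam X (prox f C lam X)) := by
    refine ⟨⟨_, h.1, rfl⟩, ?_⟩
    rintro _ ⟨Y, hY, rfl⟩
    exact h.2 Y hY
  have h2 : moreau f C lam X = proxObj f C lam X (prox f C lam X) := h1.csInf_eq
  exact ⟨h2 ▸ h1, h2⟩

theorem moreau_le (hU : U ∈ 𝓝ˢ (stiefel n (Fin p)))
    (hLip : ∀ X ∈ U, ∀ Y ∈ U, |f X - f Y| ≤ L * frobNorm (X - Y)) (hℓ : 2 ≤ ℓ)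
    (hb : ∀ a i, a ∈ C i ↔ b a = i) {X Y : Matrix (Fin n) (Fin p) ℝ} (hX : Xᵀ * X = 1)
    (hY : Yᵀ * Y = 1) :
    moreau f C lam X ≤ f Y + ℓ / (4 * lam) * blockQuad b X (Y - X) := by
  rw [← proxObj_eq hℓ hb hX]
  exact (isLeast_moreau hU hLip hℓ hb hX).1.2 ⟨Y, hY, rfl⟩

theorem moreau_le_self (hU : U ∈ 𝓝ˢ (stiefel n (Fin p)))
    (hLip : ∀ X ∈ U, ∀ Y ∈ U, |f X - f Y| ≤ L * frobNorm (X - Y)) (hℓ : 2 ≤ ℓ)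
    (hb : ∀ a i, a ∈ C i ↔ b a = i) {X : Matrix (Fin n) (Fin p) ℝ} (hX : Xᵀ * X = 1) :
    moreau f C lam X ≤ f X := by
  rw [← proxObj_self (f := f) (lam := lam) hℓ hb hX]
  exact (isLeast_moreau hU hLip hℓ hb hX).1.2 ⟨X, hX, rfl⟩

theorem le_moreau_of_le (hU : U ∈ 𝓝ˢ (stiefel n (Fin p)))
    (hLip : ∀ X ∈ U, ∀ Y ∈ U, |f X - f Y| ≤ L * frobNorm (X - Y)) (hℓ : 2 ≤ ℓ) (hlam : 0 < lam)
    (hb : ∀ a i, a ∈ C i ↔ b a = i) {c : ℝ} (hc : ∀ Y : Matrix (Fin n) (Fin p) ℝ,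
      Yᵀ * Y = 1 → c ≤ f Y) {X : Matrix (Fin n) (Fin p) ℝ} (hX : Xᵀ * X = 1) :
    c ≤ moreau f C lam X := by
  rw [(isLeast_moreau hU hLip hℓ hb hX).2, proxObj]
  have h := hc _ (prox_mem_proxSet (lam := lam) hU hLip hℓ hb hX).1
  have : 0 ≤ 1 / (2 * lam) * mahalNorm C X (prox f C lam X - X) ^ 2 := by positivity
  linarith

/-- The infimum is that of a set bounded below by the minimum of `f` on the compact Stiefel
manifold. -/
theorem moreauMin_le (hU : U ∈ 𝓝ˢ (stiefel n (Fin p)))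
    (hLip : ∀ X ∈ U, ∀ Y ∈ U, |f X - f Y| ≤ L * frobNorm (X - Y)) (hℓ : 2 ≤ ℓ) (hlam : 0 < lam)
    (hb : ∀ a i, a ∈ C i ↔ b a = i) {X : Matrix (Fin n) (Fin p) ℝ} (hX : Xᵀ * X = 1) :
    moreauMin f C lam ≤ moreau f C lam X := by
  obtain ⟨Z, -, hmin⟩ := isCompact_stiefel.exists_isMinOn ⟨X, hX⟩
    (continuousOn_of_lipschitz hU hLip)
  refine csInf_le ⟨f Z, ?_⟩ ⟨X, hX, rfl⟩
  rintro _ ⟨Y, hY, rfl⟩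
  exact le_moreau_of_le hU hLip hℓ hlam hb (fun W hW => isMinOn_iff.mp hmin W hW) hY

theorem le_moreauMin_of_le (hU : U ∈ 𝓝ˢ (stiefel n (Fin p)))
    (hLip : ∀ X ∈ U, ∀ Y ∈ U, |f X - f Y| ≤ L * frobNorm (X - Y)) (hℓ : 2 ≤ ℓ) (hlam : 0 < lam)
    (hb : ∀ a i, a ∈ C i ↔ b a = i) {c : ℝ} (hc : ∀ Y : Matrix (Fin n) (Fin p) ℝ,
      Yᵀ * Y = 1 → c ≤ f Y) {X : Matrix (Fin n) (Fin p) ℝ} (hX : Xᵀ * X = 1) :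
    c ≤ moreauMin f C lam := by
  refine le_csInf ⟨_, X, hX, rfl⟩ ?_
  rintro _ ⟨Y, hY, rfl⟩
  exact le_moreau_of_le hU hLip hℓ hlam hb hc hY

theorem continuousOn_moreau (hτ : 0 ≤ τ) (hU : U ∈ 𝓝ˢ (stiefel n (Fin p)))
    (hconv : ConvexOn ℝ U fun X => f X + τ / 2 * frobNorm X ^ 2)
    (hLip : ∀ X ∈ U, ∀ Y ∈ U, |f X - f Y| ≤ L * frobNorm (X - Y)) (hℓ : 2 ≤ ℓ) (hlam : 0 < lam)
    (hL : 0 ≤ L) (hlam2 : τ + (2 * ℓ - 1) * L < ℓ / (2 * lam))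
    (hb : ∀ a i, a ∈ C i ↔ b a = i) :
    ContinuousOn (moreau f C lam) (stiefel n (Fin p)) := by
  have hp := continuousOn_prox hτ hU hconv hLip hℓ hlam hL hlam2 hb
  have hf : ContinuousOn (fun X => f (prox f C lam X)) (stiefel n (Fin p)) :=
    (continuousOn_of_lipschitz hU hLip).comp hp fun X hX =>
      (prox_mem_proxSet hU hLip hℓ hb hX).1
  have hbq : Continuous fun q : Matrix (Fin n) (Fin p) ℝ × Matrix (Fin n) (Fin p) ℝ =>
      ℓ / (4 * lam) * blockQuad b q.1 (q.2 - q.1) := by fun_prop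
  refine (hf.add (hbq.comp_continuousOn (continuousOn_id.prodMk hp))).congr fun X hX => ?_
  rw [(isLeast_moreau hU hLip hℓ hb hX).2, proxObj_eq hℓ hb hX]
  rfl

end ProxMap

/-! ### The effect of one step on the proximal distance -/

section OneStep

variable {n p ℓ : ℕ} {C : Fin ℓ → Finset (Fin p)} {b : Fin p → Fin ℓ}

/-- Splitting the off-diagonal blocks by membership of the row and the column in the selected
blocks. -/
theorem frobInner_offBlock_split (hb : ∀ a i, a ∈ C i ↔ b a = i) (s : Finset (Fin ℓ))
    (M : Matrix (Fin p) (Fin p) ℝ) :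
    frobInner (offBlock b M) (offBlock b M) =
      frobInner (offBlock b ((1 - colSel (s.biUnion C)) * M))
        (offBlock b ((1 - colSel (s.biUnion C)) * M)) +
      frobInner (colSel (s.biUnion C) * M * (1 - colSel (s.biUnion C)))
        (colSel (s.biUnion C) * M * (1 - colSel (s.biUnion C))) +
      frobInner (offBlock b (colSel (s.biUnion C) * M * colSel (s.biUnion C)))
        (offBlock b (colSel (s.biUnion C) * M * colSel (s.biUnion C))) := by
  simp only [frobInner_eq_sum, ← Finset.sum_add_distrib]
  refine Finset.sum_congr rfl fun k _ => Finset.sum_congr rfl fun a _ => ?_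
  simp only [offBlock_apply, Matrix.mul_sub, Matrix.sub_mul, Matrix.sub_apply, mul_colSel_apply,
    colSel_mul_apply, Matrix.one_mul, Matrix.mul_one, mem_biUnion_iff_label hb]
  by_cases h : b k = b a
  · simp only [h]
    split_ifs <;> simp
  · simp only [h, if_false]
    split_ifs <;> simp

theorem frobInner_offBlock_compress_le (hb : ∀ a i, a ∈ C i ↔ b a = i) (s : Finset (Fin ℓ))
    (M : Matrix (Fin p) (Fin p) ℝ) :
    frobInner (offBlock b (colSel (s.biUnion C) * M * colSel (s.biUnion C)))
        (offBlock b (colSel (s.biUnion C) * M * colSel (s.biUnion C))) ≤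
      frobInner (offBlock b M) (offBlock b M) := by
  rw [frobInner_offBlock_split hb s M]
  have h1 := frobInner_self_nonneg (offBlock b ((1 - colSel (s.biUnion C)) * M))
  have h2 := frobInner_self_nonneg
    (colSel (s.biUnion C) * M * (1 - colSel (s.biUnion C)))
  linarith

variable (X G : Matrix (Fin n) (Fin p) ℝ) (D : Finset (Fin p))

theorem compress_skewPart_transpose :
    (colSel D * skewPart X G * colSel D)ᵀ = -(colSel D * skewPart X G * colSel D) := by
  rw [Matrix.transpose_mul, Matrix.transpose_mul, skewPart_transpose, colSel_transpose,
    Matrix.neg_mul, Matrix.mul_neg, Matrix.mul_assoc]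

variable {X} in
theorem transpose_mul_blockDir (hX : Xᵀ * X = 1) :
    Xᵀ * blockDir X G D = colSel D * skewPart X G * colSel D := by
  rw [blockDir, Matrix.mul_add, ← Matrix.mul_assoc, Matrix.mul_sub, ← Matrix.mul_assoc Xᵀ X, hX,
    Matrix.one_mul, sub_self, Matrix.zero_mul, zero_add, ← Matrix.mul_assoc Xᵀ X, hX,
    Matrix.one_mul]

theorem blockDir_mul_colSel : blockDir X G D * colSel D = blockDir X G D := by
  rw [blockDir, Matrix.add_mul, Matrix.mul_assoc, colSel_mul_self, Matrix.mul_assoc X,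
    Matrix.mul_assoc _ (colSel D), colSel_mul_self]

theorem frobInner_self_skewPart_le (M : Matrix (Fin p) (Fin p) ℝ) :
    frobInner ((1 / 2 : ℝ) • (M - Mᵀ)) ((1 / 2 : ℝ) • (M - Mᵀ)) ≤ frobInner M M := by
  have h := frobInner_self_add_le M (-Mᵀ)
  rw [frobInner_neg_left, frobInner_neg_right, frobInner_transpose, ← sub_eq_add_neg] at h
  rw [frobInner_smul_left, frobInner_smul_right]
  linarith

variable {X} in
/-- The search direction is not longer than the selected columns of the subgradient. -/
theorem frobInner_blockDir_le (hX : Xᵀ * X = 1) :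
    frobInner (blockDir X G D) (blockDir X G D) ≤ frobInner (G * colSel D) (G * colSel D) := by
  set E := colSel D with hE
  have h1 : Xᵀ * ((G - X * (Xᵀ * G)) * E) = 0 := by
    rw [← Matrix.mul_assoc, Matrix.mul_sub, ← Matrix.mul_assoc Xᵀ X, hX, Matrix.one_mul, sub_self,
      Matrix.zero_mul]
  have h2 : ∀ M : Matrix (Fin p) (Fin p) ℝ, frobInner ((G - X * (Xᵀ * G)) * E) (X * M) = 0 := by
    intro M
    rw [frobInner_comm, frobInner_mul_left, h1, frobInner_zero_right]
  have h3 : G * E = (G - X * (Xᵀ * G)) * E + X * (Xᵀ * G * E) := by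
    rw [Matrix.sub_mul]
    simp only [Matrix.mul_assoc]
    abel
  have h4 : E * skewPart X G * E = (1 / 2 : ℝ) • (E * (Xᵀ * G) * E - (E * (Xᵀ * G) * E)ᵀ) := by
    rw [skewPart, Matrix.mul_smul, Matrix.smul_mul, Matrix.mul_sub, Matrix.sub_mul]
    simp only [Matrix.transpose_mul, Matrix.transpose_transpose, hE, colSel_transpose,
      Matrix.mul_assoc]
  have h5 : frobInner (E * skewPart X G * E) (E * skewPart X G * E) ≤
      frobInner (Xᵀ * G * E) (Xᵀ * G * E) := by
    rw [h4]
    refine (frobInner_self_skewPart_le _).trans ?_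
    rw [Matrix.mul_assoc E]
    exact frobInner_colSel_mul_le _ _
  have h6 : ∀ M : Matrix (Fin p) (Fin p) ℝ, frobInner (X * M) ((G - X * (Xᵀ * G)) * E) = 0 :=
    fun M => by rw [frobInner_comm, h2]
  rw [h3, blockDir, ← hE]
  simp only [frobInner_add_left, frobInner_add_right, h2, h6, frobInner_isometry hX]
  linarith

/-- The bound of `blockQuad_step_le` for the proximal distance after a step on the columns in
`D`, with `W` the vector from the iterate to its proximal point. -/
def stepBound (b : Fin p → Fin ℓ) (L γ : ℝ) (X G W : Matrix (Fin n) (Fin p) ℝ)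
    (D : Finset (Fin p)) : ℝ :=
  blockQuad b X W +
    2 * γ * (frobInner W ((G - X * (Xᵀ * G)) * colSel D) +
      frobInner (Xᵀ * W) (colSel D * skewPart X G * colSel D) +
      (ℓ - 2) * frobInner (offBlock b (Xᵀ * W)) (colSel D * skewPart X G * colSel D)) +
    (ℓ - 2) * γ * L *
      frobInner (colSel D * offBlock b (Xᵀ * W)) (colSel D * offBlock b (Xᵀ * W)) +
    2 * (ℓ - 2) * γ ^ 2 * frobInner (offBlock b (colSel D * skewPart X G * colSel D))
      (offBlock b (colSel D * skewPart X G * colSel D)) +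
    (γ ^ 2 + (ℓ - 2) * (γ * frobInner W W / L + 2 * γ ^ 2 * frobInner W W + γ ^ 2 * frobNorm W +
      γ ^ 3 * L + γ ^ 4 * L ^ 2 / 4)) * frobInner (G * colSel D) (G * colSel D)


/-- Squared distances on the Stiefel manifold are affine in each point. -/
theorem frobInner_sub_self_stiefel {X Z : Matrix (Fin n) (Fin p) ℝ} (hX : Xᵀ * X = 1)
    (hZ : Zᵀ * Z = 1) :
    frobInner (Z - X) (Z - X) = 2 * (1 : Matrix (Fin p) (Fin p) ℝ).trace - 2 * frobInner Z X := by
  have h1 : frobInner X X = (1 : Matrix (Fin p) (Fin p) ℝ).trace := by rw [frobInner, hX]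
  have h2 : frobInner Z Z = (1 : Matrix (Fin p) (Fin p) ℝ).trace := by rw [frobInner, hZ]
  simp only [frobInner_sub_left, frobInner_sub_right, h1, h2, frobInner_comm X Z]
  ring

/-- The Euclidean part of the proximal distance after a step. -/
theorem frobInner_step_le {X G X' Z : Matrix (Fin n) (Fin p) ℝ} {R : Matrix (Fin p) (Fin p) ℝ}
    {D : Finset (Fin p)} {γ : ℝ}
    (hX : Xᵀ * X = 1) (hZ : Zᵀ * Z = 1) (hR : R.PosSemidef)
    (hRR : (2 : ℝ) • R + R * R = (γ • blockDir X G D)ᵀ * (γ • blockDir X G D))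
    (hstep : X' + X' * R = X - γ • blockDir X G D) (hX' : X'ᵀ * X' = 1) :
    frobInner (Z - X') (Z - X') ≤ frobInner (Z - X) (Z - X) +
      2 * γ * (frobInner (Z - X) ((G - X * (Xᵀ * G)) * colSel D) +
        frobInner (Xᵀ * (Z - X)) (colSel D * skewPart X G * colSel D)) +
      γ ^ 2 * frobInner (blockDir X G D) (blockDir X G D) := by
  have h1 : frobInner Z (X' * R) ≤ γ ^ 2 * frobInner (blockDir X G D) (blockDir X G D) / 2 := by
    refine (frobInner_mul_le_trace hR hZ hX').trans ((trace_le_of_sq hR hRR).trans (le_of_eq ?_))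
    rw [frobInner_smul_left, frobInner_smul_right]
    ring
  have h2 : frobInner X (blockDir X G D) = 0 := by
    have h3 : frobInner X (blockDir X G D) =
        frobInner (1 : Matrix (Fin p) (Fin p) ℝ) (colSel D * skewPart X G * colSel D) := by
      rw [← transpose_mul_blockDir G D hX, ← frobInner_mul_left, Matrix.mul_one]
    have h4 := frobInner_transpose (1 : Matrix (Fin p) (Fin p) ℝ)
      (colSel D * skewPart X G * colSel D)
    rw [compress_skewPart_transpose, Matrix.transpose_one, frobInner_neg_right] at h4
    linarith
  have h3 : frobInner (Z - X) (blockDir X G D) =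
      frobInner (Z - X) ((G - X * (Xᵀ * G)) * colSel D) +
        frobInner (Xᵀ * (Z - X)) (colSel D * skewPart X G * colSel D) := by
    rw [blockDir, frobInner_add_right, frobInner_mul_left Xᵀ, Matrix.transpose_transpose]
  have h4 : frobInner Z X' = frobInner Z X - γ * frobInner Z (blockDir X G D) -
      frobInner Z (X' * R) := by
    have : X' = X - γ • blockDir X G D - X' * R := by rw [← hstep]; abel
    conv_lhs => rw [this]
    rw [frobInner_sub_right, frobInner_sub_right, frobInner_smul_right]
  rw [frobInner_sub_left, h2, sub_zero] at h3
  rw [frobInner_sub_self_stiefel hX' hZ, frobInner_sub_self_stiefel hX hZ, h4, ← h3]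
  linarith

/-- The off-diagonal part after a step, before the first-order expansion. The polar factor `R` is
harmless on the columns outside the selected blocks, and of second order in `γ` inside. -/
theorem frobInner_offBlock_step_le (hb : ∀ a i, a ∈ C i ↔ b a = i) {s : Finset (Fin ℓ)}
    {M R : Matrix (Fin p) (Fin p) ℝ} (hR : R.PosSemidef)
    (hRE : R * colSel (s.biUnion C) = R) {c : ℝ} (hc : frobNorm (R * M) ≤ c) :
    frobInner (offBlock b M) (offBlock b M) ≤
      frobInner (offBlock b (M + R * M)) (offBlock b (M + R * M)) +
        2 * frobNorm (offBlock b (M + R * M)) * c + c ^ 2 := by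
  set E := colSel (s.biUnion C) with hE
  have hER : E * R = R := by
    have := congrArg Matrix.transpose hRE
    rwa [Matrix.transpose_mul, posSemidef_transpose_eq hR, hE, colSel_transpose] at this
  have hc0 : 0 ≤ c := (frobNorm_nonneg _).trans hc
  -- rows outside the selected blocks
  have h1 : (1 - E) * (M + R * M) = (1 - E) * M := by
    rw [Matrix.mul_add, ← Matrix.mul_assoc (1 - E) R, Matrix.sub_mul 1 E R, Matrix.one_mul, hER,
      sub_self, Matrix.zero_mul, add_zero]
  -- selected rows, other columns
  have h2 : frobInner (E * M * (1 - E)) (E * M * (1 - E)) ≤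
      frobInner (E * (M + R * M) * (1 - E)) (E * (M + R * M) * (1 - E)) := by
    have h3 := frobInner_self_le_one_add_mul hR (E * M * (1 - E))
    have h4 : E * M * (1 - E) + R * (E * M * (1 - E)) = E * (M + R * M) * (1 - E) := by
      rw [Matrix.mul_add E, Matrix.add_mul (E * M), ← Matrix.mul_assoc E R, hER, Matrix.mul_assoc E,
        ← Matrix.mul_assoc R E, hRE, Matrix.mul_assoc R]
    rwa [h4] at h3
  -- selected rows and columns
  have h3 : frobInner (offBlock b (E * M * E)) (offBlock b (E * M * E)) ≤
      frobInner (offBlock b (E * (M + R * M) * E)) (offBlock b (E * (M + R * M) * E)) +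
        2 * frobNorm (offBlock b (M + R * M)) * c + c ^ 2 := by
    have h4 : E * M * E = E * (M + R * M) * E - R * M * E := by
      rw [Matrix.mul_add E, Matrix.add_mul (E * M), ← Matrix.mul_assoc E R, hER]
      abel
    have h5 : frobNorm (offBlock b (R * M * E)) ≤ c :=
      (frobNorm_offBlock_le b _).trans
        ((Real.sqrt_le_sqrt (frobInner_mul_colSel_le _ _)).trans hc)
    have h6 : frobNorm (offBlock b (E * (M + R * M) * E)) ≤ frobNorm (offBlock b (M + R * M)) :=
      Real.sqrt_le_sqrt (frobInner_offBlock_compress_le hb s _)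
    have h7 := (neg_le_abs _).trans
      (abs_frobInner_le (offBlock b (E * (M + R * M) * E)) (offBlock b (R * M * E)))
    have h8 := mul_le_mul h6 h5 (frobNorm_nonneg _) (frobNorm_nonneg _)
    have h9 := pow_le_pow_left₀ (frobNorm_nonneg _) h5 2
    rw [frobNorm_sq] at h9
    rw [h4, offBlock_sub]
    simp only [frobInner_sub_left, frobInner_sub_right]
    rw [frobInner_comm (offBlock b (R * M * E)) (offBlock b (E * (M + R * M) * E))]
    linarith
  rw [frobInner_offBlock_split hb s M, frobInner_offBlock_split hb s (M + R * M), ← hE, h1]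
  linarith

/-- One step of the method bounds the proximal distance, in the metric at the new iterate, to any
point `Z` of the Stiefel manifold. -/
theorem blockQuad_step_le (hℓ : 2 ≤ ℓ) (hb : ∀ a i, a ∈ C i ↔ b a = i)
    {X G X' Z : Matrix (Fin n) (Fin p) ℝ} {s : Finset (Fin ℓ)} {L γ : ℝ} (hL : 0 < L)
    (hγ : 0 ≤ γ) (hX : Xᵀ * X = 1) (hZ : Zᵀ * Z = 1) (hG : frobNorm G ≤ L)
    (hstep : IsStep X G (s.biUnion C) γ X') :
    blockQuad b X' (Z - X') ≤ stepBound b L γ X G (Z - X) (s.biUnion C) := by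
  obtain ⟨R, hR, hRE, hRR, hfac, hX'⟩ := hstep.exists_factor hX
  have hR1 := frobInner_step_le (Z := Z) hX hZ hR hRR hfac hX'
  have h2 : (2 : ℝ) ≤ ℓ := by exact_mod_cast hℓ
  set D := s.biUnion C with hD
  set B := blockDir X G D with hB
  set W := Z - X with hW
  set S := colSel D * skewPart X G * colSel D with hS
  set g := frobInner (G * colSel D) (G * colSel D) with hg
  have hBg : frobInner B B ≤ g := frobInner_blockDir_le G D hX
  have hg0 : 0 ≤ g := frobInner_self_nonneg _
  have hgL : g ≤ L ^ 2 := by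
    refine (frobInner_mul_colSel_le _ _).trans ?_
    rw [← frobNorm_sq]
    exact pow_le_pow_left₀ (frobNorm_nonneg _) hG 2
  have hBL : frobNorm B ≤ L := frobNorm_le_of_sq_le hL.le (hBg.trans hgL)
  have hB0 := frobNorm_nonneg B
  have hW0 := frobNorm_nonneg W
  have hWX : ∀ Y : Matrix (Fin n) (Fin p) ℝ, Yᵀ * Y = 1 →
      offBlock b (Yᵀ * (Z - Y)) = offBlock b (Yᵀ * Z) := by
    intro Y hY
    rw [Matrix.mul_sub, hY, offBlock_sub, offBlock_one, sub_zero]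
  -- the transposed step, applied to `Z`
  have hN : X'ᵀ * Z + R * (X'ᵀ * Z) = Xᵀ * Z - γ • (Bᵀ * Z) := by
    have := congrArg (fun Y => Yᵀ * Z) hfac
    simpa [Matrix.transpose_mul, posSemidef_transpose_eq hR, Matrix.add_mul, Matrix.sub_mul,
      Matrix.mul_assoc] using this
  have hRM : frobNorm (R * (X'ᵀ * Z)) ≤ γ ^ 2 * g / 2 := by
    have h3 : frobNorm (R * (X'ᵀ * Z)) ≤ frobNorm R := by
      have e1 : (R * (X'ᵀ * Z))ᵀ = Zᵀ * (X' * R) := by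
        rw [Matrix.transpose_mul, Matrix.transpose_mul, Matrix.transpose_transpose,
          posSemidef_transpose_eq hR, Matrix.mul_assoc]
      rw [← frobNorm_transpose, e1]
      refine (Real.sqrt_le_sqrt (frobInner_transpose_mul_le hZ _)).trans ?_
      rw [frobInner_isometry hX']
      exact le_rfl
    refine h3.trans ((frobNorm_le_trace hR).trans ((trace_le_of_sq hR hRR).trans ?_))
    rw [frobInner_smul_left, frobInner_smul_right]
    nlinarith [sq_nonneg γ]
  have hoff := frobInner_offBlock_step_le hb hR hRE hRM
  rw [hN] at hoff
  -- the expansion of the off-diagonal part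
  have hBX : Bᵀ * Z = -S + Bᵀ * W := by
    have h3 : Bᵀ * X = -S := by
      have := congrArg Matrix.transpose (transpose_mul_blockDir G D hX)
      rwa [Matrix.transpose_mul, Matrix.transpose_transpose, compress_skewPart_transpose] at this
    rw [hW, Matrix.mul_sub, h3]
    abel
  have hBT : colSel D * Bᵀ = Bᵀ := by
    have := congrArg Matrix.transpose (blockDir_mul_colSel X G D)
    rwa [Matrix.transpose_mul, colSel_transpose] at this
  have hBW : frobNorm (Bᵀ * W) ≤ frobNorm B * frobNorm W := by
    simpa [frobNorm_transpose] using frobNorm_mul_le Bᵀ W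
  have hBZ : frobNorm (Bᵀ * Z) ≤ L := by
    have e1 : Bᵀ * Z = (Zᵀ * B)ᵀ := by rw [Matrix.transpose_mul, Matrix.transpose_transpose]
    rw [e1, frobNorm_transpose]
    exact (Real.sqrt_le_sqrt (frobInner_transpose_mul_le hZ B)).trans hBL
  set V := Xᵀ * W with hV
  have hoffV : offBlock b (Xᵀ * Z) = offBlock b V := (hWX X hX).symm
  have hVW : frobNorm (offBlock b V) ≤ frobNorm W :=
    (frobNorm_offBlock_le b _).trans (Real.sqrt_le_sqrt (frobInner_transpose_mul_le hX W))
  have hNn : frobNorm (offBlock b (Xᵀ * Z - γ • (Bᵀ * Z))) ≤ frobNorm W + γ * L := by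
    rw [offBlock_sub, hoffV, offBlock_smul, sub_eq_add_neg, ← neg_smul]
    refine (frobNorm_add_le _ _).trans (add_le_add hVW ?_)
    rw [frobNorm_smul, abs_neg, abs_of_nonneg hγ]
    exact mul_le_mul_of_nonneg_left ((frobNorm_offBlock_le b _).trans hBZ) hγ
  set v := frobInner (colSel D * offBlock b V) (colSel D * offBlock b V) with hv
  have hcross : -frobInner (offBlock b V) (Bᵀ * W) ≤
      (L * v + g * frobInner W W / L) / 2 := by
    have e1 : frobInner (offBlock b V) (Bᵀ * W) =
        frobInner (colSel D * offBlock b V) (Bᵀ * W) := by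
      rw [frobInner_mul_left, colSel_transpose, ← Matrix.mul_assoc, hBT]
    have h3 := (neg_le_abs _).trans (abs_frobInner_le (colSel D * offBlock b V) (Bᵀ * W))
    have h4 : frobNorm (colSel D * offBlock b V) * frobNorm (Bᵀ * W) ≤
        (L * v + frobNorm (Bᵀ * W) ^ 2 / L) / 2 := by
      rw [hv, ← frobNorm_sq]
      generalize frobNorm (colSel D * offBlock b V) = x
      generalize frobNorm (Bᵀ * W) = y
      have : (L * x ^ 2 + y ^ 2 / L) / 2 - x * y = (L * x - y) ^ 2 / (2 * L) := by
        field_simp; ring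
      have : 0 ≤ (L * x - y) ^ 2 / (2 * L) := by positivity
      linarith
    have h5 : frobNorm (Bᵀ * W) ^ 2 ≤ g * frobInner W W := by
      refine (pow_le_pow_left₀ (frobNorm_nonneg _) hBW 2).trans ?_
      rw [mul_pow, frobNorm_sq, frobNorm_sq]
      exact mul_le_mul_of_nonneg_right hBg (frobInner_self_nonneg _)
    have h6 : frobNorm (Bᵀ * W) ^ 2 / L ≤ g * frobInner W W / L :=
      div_le_div_of_nonneg_right h5 hL.le
    rw [e1]
    linarith
  have hsecond : frobInner (offBlock b (Bᵀ * Z)) (offBlock b (Bᵀ * Z)) ≤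
      2 * frobInner (offBlock b S) (offBlock b S) + 2 * (g * frobInner W W) := by
    rw [hBX, offBlock_add]
    refine (frobInner_self_add_le _ _).trans ?_
    have e1 : offBlock b (-S) = -offBlock b S := by
      rw [← neg_one_smul ℝ S, offBlock_smul, neg_one_smul]
    rw [e1, frobInner_neg_left, frobInner_neg_right, neg_neg]
    have h3 : frobInner (offBlock b (Bᵀ * W)) (offBlock b (Bᵀ * W)) ≤ g * frobInner W W := by
      refine (frobInner_offBlock_le b _).trans ((frobInner_self_mul_le _ _).trans ?_)
      rw [frobInner_transpose]
      exact mul_le_mul_of_nonneg_right hBg (frobInner_self_nonneg _)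
    linarith
  have hexp : frobInner (offBlock b (Xᵀ * Z - γ • (Bᵀ * Z)))
      (offBlock b (Xᵀ * Z - γ • (Bᵀ * Z))) ≤ frobInner (offBlock b V) (offBlock b V) +
        2 * γ * frobInner (offBlock b V) S + γ * (L * v + g * frobInner W W / L) +
        γ ^ 2 * (2 * frobInner (offBlock b S) (offBlock b S) + 2 * (g * frobInner W W)) := by
    have e1 : frobInner (offBlock b (Xᵀ * Z - γ • (Bᵀ * Z)))
        (offBlock b (Xᵀ * Z - γ • (Bᵀ * Z))) = frobInner (offBlock b V) (offBlock b V) -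
        2 * γ * frobInner (offBlock b V) (Bᵀ * Z) +
        γ ^ 2 * frobInner (offBlock b (Bᵀ * Z)) (offBlock b (Bᵀ * Z)) := by
      rw [offBlock_sub, hoffV, offBlock_smul, frobInner_offBlock_left b V (Bᵀ * Z)]
      simp only [frobInner_sub_left, frobInner_sub_right, frobInner_smul_left,
        frobInner_smul_right]
      rw [frobInner_comm (offBlock b (Bᵀ * Z)) (offBlock b V)]
      ring
    rw [e1]
    nth_rewrite 1 [hBX]
    rw [frobInner_add_right, frobInner_neg_right]
    have h3 := mul_le_mul_of_nonneg_left hcross (by positivity : 0 ≤ 2 * γ)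
    have h4 := mul_le_mul_of_nonneg_left hsecond (sq_nonneg γ)
    linarith
  have hlast : 2 * frobNorm (offBlock b (Xᵀ * Z - γ • (Bᵀ * Z))) * (γ ^ 2 * g / 2) +
      (γ ^ 2 * g / 2) ^ 2 ≤ (γ ^ 2 * frobNorm W + γ ^ 3 * L + γ ^ 4 * L ^ 2 / 4) * g := by
    have h3 := mul_le_mul_of_nonneg_right hNn (by positivity : 0 ≤ γ ^ 2 * g)
    have h4 := mul_le_mul_of_nonneg_left hgL (by positivity : 0 ≤ γ ^ 4 * g / 4)
    nlinarith
  have hfin := mul_le_mul_of_nonneg_left ((hoff.trans_eq (add_assoc _ _ _)).trans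
    (add_le_add hexp hlast)) (by linarith : (0 : ℝ) ≤ ℓ - 2)
  have hγB := mul_le_mul_of_nonneg_left hBg (sq_nonneg γ)
  rw [blockQuad, hWX X' hX', stepBound, blockQuad, ← hV, ← hS, ← hg, ← hv]
  have e3 : γ * frobInner W W / L * g = γ * (g * frobInner W W / L) := by ring
  nlinarith

end OneStep

/-! ### Averaging the step over the pairs of blocks -/

section PairAveraging

variable {n p ℓ : ℕ} {C : Fin ℓ → Finset (Fin p)} {b : Fin p → Fin ℓ}

theorem pairAvg_frobInner_mul_colSel (hℓ : 2 ≤ ℓ) (hb : ∀ a i, a ∈ C i ↔ b a = i) {m : Type*}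
    [Fintype m] (A B : Matrix m (Fin p) ℝ) :
    pairAvg ℓ (fun s => frobInner A (B * colSel (s.biUnion C))) = 2 / ℓ * frobInner A B := by
  simp only [frobInner_eq_sum, mul_colSel_apply, mem_biUnion_iff_label hb, ← mul_assoc,
    pairAvg_sum, pairAvg_const_mul, pairAvg_mem hℓ]
  simp only [← Finset.sum_mul]
  ring

theorem pairAvg_frobInner_self_mul_colSel (hℓ : 2 ≤ ℓ) (hb : ∀ a i, a ∈ C i ↔ b a = i)
    {m : Type*} [Fintype m] (A : Matrix m (Fin p) ℝ) :
    pairAvg ℓ (fun s => frobInner (A * colSel (s.biUnion C)) (A * colSel (s.biUnion C))) =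
      2 / ℓ * frobInner A A := by
  rw [← pairAvg_frobInner_mul_colSel hℓ hb]
  congr 1
  ext s
  rw [frobInner_mul_right, colSel_transpose, Matrix.mul_assoc, colSel_mul_self]

theorem pairAvg_frobInner_self_colSel_mul (hℓ : 2 ≤ ℓ) (hb : ∀ a i, a ∈ C i ↔ b a = i)
    {m : Type*} [Fintype m] (A : Matrix (Fin p) m ℝ) :
    pairAvg ℓ (fun s => frobInner (colSel (s.biUnion C) * A) (colSel (s.biUnion C) * A)) =
      2 / ℓ * frobInner A A := by
  rw [← frobInner_transpose, ← pairAvg_frobInner_self_mul_colSel hℓ hb]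
  congr 1
  ext s
  rw [← frobInner_transpose, Matrix.transpose_mul, colSel_transpose]

theorem compress_apply (hb : ∀ a i, a ∈ C i ↔ b a = i) (s : Finset (Fin ℓ))
    (K : Matrix (Fin p) (Fin p) ℝ) (k a : Fin p) :
    (colSel (s.biUnion C) * K * colSel (s.biUnion C)) k a =
      K k a * ((if b k ∈ s then 1 else 0) * (if b a ∈ s then 1 else 0)) := by
  rw [mul_colSel_apply, colSel_mul_apply]
  simp only [mem_biUnion_iff_label hb]
  ring

/-- Two columns in different blocks are selected together with probability `2 / (ℓ (ℓ - 1))`. -/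
theorem pairAvg_frobInner_offBlock_compress (hℓ : 2 ≤ ℓ) (hb : ∀ a i, a ∈ C i ↔ b a = i)
    (V K : Matrix (Fin p) (Fin p) ℝ) :
    pairAvg ℓ (fun s => frobInner (offBlock b V)
      (colSel (s.biUnion C) * K * colSel (s.biUnion C))) =
      2 / ℓ / (ℓ - 1) * frobInner (offBlock b V) K := by
  simp only [frobInner_eq_sum, compress_apply hb, ← mul_assoc _ (K _ _), pairAvg_sum,
    pairAvg_const_mul]
  rw [Finset.mul_sum]
  refine Finset.sum_congr rfl fun k _ => ?_
  rw [Finset.mul_sum]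
  refine Finset.sum_congr rfl fun a _ => ?_
  rw [offBlock_apply]
  split_ifs with h
  · simp
  · rw [pairAvg_mem_mem hℓ h]; ring

theorem pairAvg_frobInner_diagBlock_compress (hℓ : 2 ≤ ℓ) (hb : ∀ a i, a ∈ C i ↔ b a = i)
    (V K : Matrix (Fin p) (Fin p) ℝ) :
    pairAvg ℓ (fun s => frobInner (V - offBlock b V)
      (colSel (s.biUnion C) * K * colSel (s.biUnion C))) =
      2 / ℓ * frobInner (V - offBlock b V) K := by
  simp only [frobInner_eq_sum, compress_apply hb, ← mul_assoc _ (K _ _), pairAvg_sum,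
    pairAvg_const_mul]
  rw [Finset.mul_sum]
  refine Finset.sum_congr rfl fun k _ => ?_
  rw [Finset.mul_sum]
  refine Finset.sum_congr rfl fun a _ => ?_
  rw [Matrix.sub_apply, offBlock_apply]
  split_ifs with h
  · have h2 : ∀ s : Finset (Fin ℓ), (if b k ∈ s then (1 : ℝ) else 0) * (if b a ∈ s then 1 else 0) =
        if b a ∈ s then 1 else 0 := by
      intro s
      rw [h]; split_ifs <;> simp
    simp only [h2, pairAvg_mem hℓ]
    ring
  · simp

/-- The weight `ℓ - 2` of the off-diagonal blocks in the metric compensates for their lower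
probability of being selected. -/
theorem pairAvg_frobInner_compress (hℓ : 2 ≤ ℓ) (hb : ∀ a i, a ∈ C i ↔ b a = i)
    (V K : Matrix (Fin p) (Fin p) ℝ) :
    pairAvg ℓ (fun s => frobInner V (colSel (s.biUnion C) * K * colSel (s.biUnion C))) +
      (ℓ - 2) * pairAvg ℓ (fun s => frobInner (offBlock b V)
        (colSel (s.biUnion C) * K * colSel (s.biUnion C))) = 2 / ℓ * frobInner V K := by
  have h2 : (2 : ℝ) ≤ ℓ := by exact_mod_cast hℓ
  have h3 : (ℓ : ℝ) - 1 ≠ 0 := by linarith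
  have h4 : ∀ M, frobInner V M = frobInner (V - offBlock b V) M + frobInner (offBlock b V) M := by
    intro M
    rw [frobInner_sub_left]; ring
  simp only [h4]
  rw [pairAvg_add, pairAvg_frobInner_diagBlock_compress hℓ hb,
    pairAvg_frobInner_offBlock_compress hℓ hb]
  field_simp
  ring

theorem pairAvg_frobInner_self_offBlock_compress (hℓ : 2 ≤ ℓ) (hb : ∀ a i, a ∈ C i ↔ b a = i)
    (K : Matrix (Fin p) (Fin p) ℝ) :
    pairAvg ℓ (fun s => frobInner
        (offBlock b (colSel (s.biUnion C) * K * colSel (s.biUnion C)))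
        (offBlock b (colSel (s.biUnion C) * K * colSel (s.biUnion C)))) =
      2 / ℓ / (ℓ - 1) * frobInner (offBlock b K) (offBlock b K) := by
  rw [← frobInner_offBlock_left, ← pairAvg_frobInner_offBlock_compress hℓ hb]
  congr 1
  ext s
  simp only [frobInner_eq_sum, offBlock_apply, compress_apply hb]
  refine Finset.sum_congr rfl fun k _ => Finset.sum_congr rfl fun a _ => ?_
  split_ifs <;> simp

theorem frobInner_skewPart_le {X : Matrix (Fin n) (Fin p) ℝ} (hX : Xᵀ * X = 1)
    (G : Matrix (Fin n) (Fin p) ℝ) :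
    frobInner (skewPart X G) (skewPart X G) ≤ frobInner G G := by
  have h : skewPart X G = (1 / 2 : ℝ) • (Xᵀ * G - (Xᵀ * G)ᵀ) := by
    rw [skewPart, Matrix.transpose_mul, Matrix.transpose_transpose]
  rw [h]
  exact (frobInner_self_skewPart_le _).trans (frobInner_transpose_mul_le hX G)

/-- The average of the step bound over the pairs. The condition on `W` is the a priori bound for
the distance to the proximal point; it absorbs the factor `ℓ - 2` of the second-order terms. -/
theorem pairAvg_stepBound_le (hℓ : 2 ≤ ℓ) (hb : ∀ a i, a ∈ C i ↔ b a = i)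
    {X G W : Matrix (Fin n) (Fin p) ℝ} {L γ : ℝ} (hL : 0 < L) (hγ : 0 ≤ γ) (hX : Xᵀ * X = 1)
    (hG : frobNorm G ≤ L) (hW : (2 * ℓ - 1) * frobNorm W ≤ 2) :
    (ℓ : ℝ) / 2 * pairAvg ℓ (fun s => stepBound b L γ X G W (s.biUnion C)) ≤
      ℓ / 2 * blockQuad b X W + 2 * γ * (frobInner W (G - X * (Xᵀ * G)) +
        frobInner (Xᵀ * W) (skewPart X G) + (ℓ - 2) * L * frobInner W W) +
      (9 / 2 * L ^ 2 * γ ^ 2 + ℓ * L ^ 3 * γ ^ 3 + ℓ * L ^ 4 * γ ^ 4 / 4) := by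
  have h2 : (2 : ℝ) ≤ ℓ := by exact_mod_cast hℓ
  have h3 : (ℓ : ℝ) - 1 ≠ 0 := by linarith
  have h4 : 0 ≤ (ℓ : ℝ) - 2 := by linarith
  have hGL : frobInner G G ≤ L ^ 2 := by
    rw [← frobNorm_sq]
    exact pow_le_pow_left₀ (frobNorm_nonneg _) hG 2
  have hK : frobInner (offBlock b (skewPart X G)) (offBlock b (skewPart X G)) ≤ L ^ 2 :=
    (frobInner_offBlock_le b _).trans ((frobInner_skewPart_le hX G).trans hGL)
  have hV : frobInner (offBlock b (Xᵀ * W)) (offBlock b (Xᵀ * W)) ≤ frobInner W W :=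
    (frobInner_offBlock_le b _).trans (frobInner_transpose_mul_le hX W)
  have hmain := pairAvg_frobInner_compress hℓ hb (Xᵀ * W) (skewPart X G)
  simp only [stepBound, pairAvg_add, pairAvg_const_mul, pairAvg_const hℓ,
    pairAvg_frobInner_mul_colSel hℓ hb, pairAvg_frobInner_self_mul_colSel hℓ hb,
    pairAvg_frobInner_self_colSel_mul hℓ hb, pairAvg_frobInner_self_offBlock_compress hℓ hb]
  rw [add_assoc (2 / (ℓ : ℝ) * _), hmain]
  have hWW := frobNorm_sq W
  have hw0 := frobNorm_nonneg W
  rw [← hWW] at hV ⊢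
  generalize frobNorm W = w at *
  generalize frobInner (offBlock b (Xᵀ * W)) (offBlock b (Xᵀ * W)) = v at *
  generalize frobInner (offBlock b (skewPart X G)) (offBlock b (skewPart X G)) = κ at *
  have hG0 := frobInner_self_nonneg G
  generalize frobInner G G = g at *
  generalize frobInner W (G - X * (Xᵀ * G)) = m₁
  generalize frobInner (Xᵀ * W) (skewPart X G) = m₂
  generalize blockQuad b X W = q
  have hκ : (ℓ - 2) / (ℓ - 1) * κ ≤ L ^ 2 := by
    have h5 : ((ℓ : ℝ) - 2) / (ℓ - 1) ≤ 1 := by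
      rw [div_le_one (by linarith)]; linarith
    have h6 : 0 ≤ ((ℓ : ℝ) - 2) / (ℓ - 1) := div_nonneg h4 (by linarith)
    calc ((ℓ : ℝ) - 2) / (ℓ - 1) * κ ≤ (ℓ - 2) / (ℓ - 1) * L ^ 2 :=
          mul_le_mul_of_nonneg_left hK h6
      _ ≤ 1 * L ^ 2 := mul_le_mul_of_nonneg_right h5 (sq_nonneg L)
      _ = L ^ 2 := one_mul _
  have e : (ℓ : ℝ) / 2 * (q + 2 * γ * (2 / ℓ * m₁ + 2 / ℓ * m₂) +
      (ℓ - 2) * γ * L * (2 / ℓ * v) + 2 * (ℓ - 2) * γ ^ 2 * (2 / ℓ / (ℓ - 1) * κ) +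
      (γ ^ 2 + (ℓ - 2) * (γ * w ^ 2 / L + 2 * γ ^ 2 * w ^ 2 + γ ^ 2 * w + γ ^ 3 * L +
        γ ^ 4 * L ^ 2 / 4)) * (2 / ℓ * g)) =
      ℓ / 2 * q + 2 * γ * (m₁ + m₂) + (ℓ - 2) * γ * L * v +
      2 * γ ^ 2 * ((ℓ - 2) / (ℓ - 1) * κ) +
      (γ ^ 2 + (ℓ - 2) * (γ * w ^ 2 / L + 2 * γ ^ 2 * w ^ 2 + γ ^ 2 * w + γ ^ 3 * L +
        γ ^ 4 * L ^ 2 / 4)) * g := by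
    field_simp
  rw [e]
  have t1 : (ℓ - 2) * γ * L * v ≤ (ℓ - 2) * γ * L * w ^ 2 :=
    mul_le_mul_of_nonneg_left hV (by positivity)
  have t2 : 2 * γ ^ 2 * ((ℓ - 2) / (ℓ - 1) * κ) ≤ 2 * γ ^ 2 * L ^ 2 :=
    mul_le_mul_of_nonneg_left hκ (by positivity)
  have t3 : (γ ^ 2 + (ℓ - 2) * (γ * w ^ 2 / L + 2 * γ ^ 2 * w ^ 2 + γ ^ 2 * w + γ ^ 3 * L +
        γ ^ 4 * L ^ 2 / 4)) * g ≤ (γ ^ 2 + (ℓ - 2) * (γ * w ^ 2 / L + 2 * γ ^ 2 * w ^ 2 +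
        γ ^ 2 * w + γ ^ 3 * L + γ ^ 4 * L ^ 2 / 4)) * L ^ 2 :=
    mul_le_mul_of_nonneg_left hGL (by positivity)
  have t4 : (γ ^ 2 + (ℓ - 2) * (γ * w ^ 2 / L + 2 * γ ^ 2 * w ^ 2 + γ ^ 2 * w + γ ^ 3 * L +
        γ ^ 4 * L ^ 2 / 4)) * L ^ 2 = (ℓ - 2) * γ * L * w ^ 2 +
        (1 + (2 * ((ℓ - 2) * w ^ 2) + (ℓ - 2) * w)) * (γ ^ 2 * L ^ 2) +
        (ℓ - 2) * (L ^ 3 * γ ^ 3) + (ℓ - 2) * (L ^ 4 * γ ^ 4 / 4) := by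
    field_simp
    ring
  -- a bound free of `ℓ`, which together with `1` and the `2` of `t2` gives the constant `9 / 2`
  have t5 : 2 * (((ℓ : ℝ) - 2) * w ^ 2) + (ℓ - 2) * w ≤ 3 / 2 := by
    have h5 : ((ℓ : ℝ) - 2) * w ≤ 1 - 3 / 2 * w := by linarith
    have h6 := mul_le_mul_of_nonneg_right h5 (by positivity : 0 ≤ 1 + 2 * w)
    nlinarith [sq_nonneg (w - 1 / 12)]
  have t6 := mul_le_mul_of_nonneg_right t5 (by positivity : 0 ≤ γ ^ 2 * L ^ 2)
  have t7 : 0 ≤ L ^ 3 * γ ^ 3 := by positivity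
  have t8 : 0 ≤ L ^ 4 * γ ^ 4 / 4 := by positivity
  linarith

end PairAveraging

/-! ### Measurability and integrability along a run -/

section Measurability

/-- Matrices carry the product topology, but no metric as a global instance. -/
instance instPseudoMetrizableSpaceMatrix (n p : ℕ) :
    TopologicalSpace.PseudoMetrizableSpace (Matrix (Fin n) (Fin p) ℝ) :=
  inferInstanceAs (TopologicalSpace.PseudoMetrizableSpace (Fin n → Fin p → ℝ))

/-- A strongly measurable map into a set composed with a function continuous on that set. -/
theorem stronglyMeasurable_comp_of_continuousOn {Ω E F : Type*} {m : MeasurableSpace Ω}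
    [TopologicalSpace E] [TopologicalSpace.PseudoMetrizableSpace E] [TopologicalSpace F]
    {K : Set E} {g : E → F} (hg : ContinuousOn g K) {Y : Ω → E} (hY : StronglyMeasurable Y)
    (hYK : ∀ ω, Y ω ∈ K) : StronglyMeasurable fun ω => g (Y ω) := by
  have h : StronglyMeasurable fun ω => (⟨Y ω, hYK ω⟩ : K) :=
    (Embedding.comp_stronglyMeasurable_iff Topology.IsEmbedding.subtypeVal).mp hY
  exact (continuousOn_iff_continuous_domRestrict.mp hg).comp_stronglyMeasurable h

theorem memLp_comp_of_continuousOn {Ω E : Type*} {m : MeasurableSpace Ω} {μ : Measure Ω}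
    [IsFiniteMeasure μ] [TopologicalSpace E] [TopologicalSpace.PseudoMetrizableSpace E]
    {K : Set E} (hK : IsCompact K) {g : E → ℝ} (hg : ContinuousOn g K) {Y : Ω → E}
    (hY : StronglyMeasurable Y) (hYK : ∀ ω, Y ω ∈ K) (q : ℝ≥0∞) :
    MemLp (fun ω => g (Y ω)) q μ := by
  obtain ⟨c, hc⟩ := hK.exists_bound_of_continuousOn hg
  exact MemLp.of_bound (stronglyMeasurable_comp_of_continuousOn hg hY hYK).aestronglyMeasurable c
    (Eventually.of_forall fun ω => hc _ (hYK ω))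

theorem isCompact_frobNorm_le (n p : ℕ) (r : ℝ) :
    IsCompact {G : Matrix (Fin n) (Fin p) ℝ | frobNorm G ≤ r} := by
  have hcl : IsClosed {G : Matrix (Fin n) (Fin p) ℝ | frobNorm G ≤ r} :=
    isClosed_le (by fun_prop) continuous_const
  have hcpt : IsCompact (Set.univ.pi fun _ : Fin n => Set.univ.pi fun _ : Fin p =>
      Set.Icc (-r) r) :=
    isCompact_univ_pi fun _ => isCompact_univ_pi fun _ => isCompact_Icc
  refine hcpt.of_isClosed_subset hcl ?_
  rintro (G : Matrix (Fin n) (Fin p) ℝ) (hG : frobNorm G ≤ r) i - j -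
  refine abs_le.mp (le_trans ?_ hG)
  rw [← Real.sqrt_sq_eq_abs, frobNorm, frobInner_eq_sum]
  refine Real.sqrt_le_sqrt ?_
  rw [pow_two]
  refine le_trans ?_ (Finset.single_le_sum (f := fun i => ∑ j, G i j * G i j)
    (fun x _ => Finset.sum_nonneg fun y _ => mul_self_nonneg (G x y)) (Finset.mem_univ i))
  exact Finset.single_le_sum (f := fun j => G i j * G i j)
    (fun y _ => mul_self_nonneg (G i y)) (Finset.mem_univ j)

/-- Evaluating an integrable family `Φ` at a uniformly distributed random pair, independent of a
σ-algebra for which `Φ` is measurable, averages `Φ` over the pairs. -/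
theorem integral_random_pair {ℓ : ℕ} {Ω : Type*} {m mΩ : MeasurableSpace Ω} {μ : Measure Ω}
    [IsProbabilityMeasure μ] {S : Ω → Finset (Fin ℓ)} (hS : Measurable[mΩ, ⊤] S)
    (hmem : ∀ ω, S ω ∈ blockPairs ℓ)
    (hunif : ∀ s ∈ blockPairs ℓ, μ.real {ω | S ω = s} = 1 / (ℓ.choose 2 : ℝ))
    (hindep : Indep (MeasurableSpace.comap S ⊤) m μ)
    {Φ : Finset (Fin ℓ) → Ω → ℝ} (hΦ : ∀ s, StronglyMeasurable[m] (Φ s))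
    (hint : ∀ s, Integrable (Φ s) μ) :
    Integrable (fun ω => Φ (S ω) ω) μ ∧
      ∫ ω, Φ (S ω) ω ∂μ = ∫ ω, pairAvg ℓ (fun s => Φ s ω) ∂μ := by
  have hA : ∀ s, MeasurableSet {ω | S ω = s} := fun s => hS (t := {s}) trivial
  have hsum : (fun ω => Φ (S ω) ω) =
      fun ω => ∑ s ∈ blockPairs ℓ, {ω | S ω = s}.indicator (Φ s) ω := by
    ext ω
    rw [Finset.sum_eq_single_of_mem (S ω) (hmem ω)]
    · exact (Set.indicator_of_mem (s := {ω' | S ω' = S ω}) rfl (Φ (S ω))).symm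
    · intro s _ hs
      exact Set.indicator_of_notMem (s := {ω' | S ω' = s}) (fun h => hs (Eq.symm h)) (Φ s)
  have hind : ∀ s, Integrable ({ω | S ω = s}.indicator (Φ s)) μ :=
    fun s => (hint s).indicator (hA s)
  have hval : ∀ s ∈ blockPairs ℓ,
      ∫ ω, {ω | S ω = s}.indicator (Φ s) ω ∂μ = 1 / (ℓ.choose 2 : ℝ) * ∫ ω, Φ s ω ∂μ := by
    intro s hs
    have h1 : Measurable[MeasurableSpace.comap S ⊤]
        ({ω | S ω = s}.indicator (1 : Ω → ℝ)) := by
      refine Measurable.indicator (m := MeasurableSpace.comap S ⊤) measurable_const ?_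
      exact ⟨{s}, trivial, rfl⟩
    have h2 : IndepFun ({ω | S ω = s}.indicator (1 : Ω → ℝ)) (Φ s) μ := by
      rw [IndepFun_iff_Indep]
      exact indep_of_indep_of_le_left (indep_of_indep_of_le_right hindep
        (measurable_iff_comap_le.mp (hΦ s).measurable)) (measurable_iff_comap_le.mp h1)
    have h3 : ({ω | S ω = s}.indicator (Φ s)) =
        fun ω => {ω | S ω = s}.indicator (1 : Ω → ℝ) ω * Φ s ω := by
      ext ω
      by_cases h : ω ∈ {ω | S ω = s} <;> simp [h]
    rw [h3, h2.integral_fun_mul_eq_mul_integral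
      ((measurable_one.indicator (hA s)).aestronglyMeasurable) (hint s).aestronglyMeasurable,
      integral_indicator_one (hA s), hunif s hs]
  refine ⟨?_, ?_⟩
  · rw [hsum]
    exact integrable_finsetSum _ fun s _ => hind s
  · simp only [hsum, pairAvg]
    rw [integral_finsetSum _ fun s _ => hind s, Finset.sum_congr rfl hval, integral_const_mul,
      integral_finsetSum _ fun s _ => hint s, Finset.mul_sum]

end Measurability

/-! ### Expected descent of the adaptive Moreau envelope -/

section Descent

variable {n p ℓ : ℕ} {f : Matrix (Fin n) (Fin p) ℝ → ℝ} {τ L lam : ℝ}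
  {U : Set (Matrix (Fin n) (Fin p) ℝ)} {C : Fin ℓ → Finset (Fin p)} {b : Fin p → Fin ℓ}
  {Ω : Type*} {mΩ : MeasurableSpace Ω} {μ : Measure Ω} {ℱ : Filtration ℕ mΩ} {γ : ℕ → ℝ}
  {X₀ : Matrix (Fin n) (Fin p) ℝ} {X G : ℕ → Ω → Matrix (Fin n) (Fin p) ℝ}
  {S : ℕ → Ω → Finset (Fin ℓ)}

theorem IsRun.mem_stiefel (h : IsRun μ ℱ f L C γ X₀ X G S) (k : ℕ) (ω : Ω) :
    X k ω ∈ stiefel n (Fin p) := by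
  induction k with
  | zero => rw [h.init_eq]; exact h.init_mem
  | succ k ih =>
    obtain ⟨R, -, -, -, -, h5⟩ := (h.step k ω).exists_factor ih
    exact h5

theorem continuousOn_surrogate (hτ : 0 ≤ τ) (hU : U ∈ 𝓝ˢ (stiefel n (Fin p)))
    (hconv : ConvexOn ℝ U fun X => f X + τ / 2 * frobNorm X ^ 2)
    (hLip : ∀ X ∈ U, ∀ Y ∈ U, |f X - f Y| ≤ L * frobNorm (X - Y)) (hℓ : 2 ≤ ℓ) (hlam : 0 < lam)
    (hL : 0 ≤ L) (hlam2 : τ + (2 * ℓ - 1) * L < ℓ / (2 * lam))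
    (hb : ∀ a i, a ∈ C i ↔ b a = i) :
    ContinuousOn (surrogate f C lam) (stiefel n (Fin p)) := by
  have hp := continuousOn_prox hτ hU hconv hLip hℓ hlam hL hlam2 hb
  have hbq : Continuous fun q : Matrix (Fin n) (Fin p) ℝ × Matrix (Fin n) (Fin p) ℝ =>
      √(1 / lam ^ 2 * (ℓ / 2 * blockQuad b q.1 (q.2 - q.1))) := by fun_prop
  refine (hbq.comp_continuousOn (continuousOn_id.prodMk hp)).congr fun X hX => ?_
  rw [← Real.sqrt_sq (surrogate_nonneg hlam X), surrogate_sq hℓ hb hX]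
  rfl

theorem continuous_stepBound (b : Fin p → Fin ℓ) (L γ : ℝ) (D : Finset (Fin p)) :
    Continuous fun q : Matrix (Fin n) (Fin p) ℝ × Matrix (Fin n) (Fin p) ℝ ×
      Matrix (Fin n) (Fin p) ℝ => stepBound b L γ q.1 q.2.1 q.2.2 D := by
  unfold stepBound skewPart
  fun_prop

/-- The right-hand side of the descent inequality, pointwise: the average over the pairs of the
bound for the envelope at the next iterate. -/
theorem pairAvg_envelope_le (hτ : 0 ≤ τ) (hU : U ∈ 𝓝ˢ (stiefel n (Fin p)))
    (hconv : ConvexOn ℝ U fun X => f X + τ / 2 * frobNorm X ^ 2)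
    (hLip : ∀ X ∈ U, ∀ Y ∈ U, |f X - f Y| ≤ L * frobNorm (X - Y)) (hℓ : 2 ≤ ℓ) (hlam : 0 < lam)
    (hL : 0 < L) (hlam2 : τ + (2 * ℓ - 1) * L < ℓ / (2 * lam))
    (hb : ∀ a i, a ∈ C i ↔ b a = i) {X G : Matrix (Fin n) (Fin p) ℝ} (hX : Xᵀ * X = 1)
    (hG : G ∈ clarkeSubdiff f X) {t : ℝ} (ht : 0 ≤ t) :
    pairAvg ℓ (fun s => f (prox f C lam X) + ℓ / (4 * lam) *
      stepBound b L t X G (prox f C lam X - X) (s.biUnion C)) ≤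
      moreau f C lam X -
        t * (lam / ℓ * (ℓ / (2 * lam) - (τ + (2 * ℓ - 3) * L))) * surrogate f C lam X ^ 2 +
        (9 / 2 * L ^ 2 * t ^ 2 + ℓ * L ^ 3 * t ^ 3 + ℓ * L ^ 4 * t ^ 4 / 4) / (2 * lam) := by
  have h2 : (2 : ℝ) ≤ ℓ := by exact_mod_cast hℓ
  have hZ := prox_mem_proxSet (lam := lam) hU hLip hℓ hb hX
  have hGL := frobNorm_clarkeSubdiff_le (mem_nhds_of_mem_stiefel hU hX) hLip hL.le hG
  have hsub := le_of_mem_clarkeSubdiff (mem_nhds_of_mem_stiefel hU hX) hconv hτ hLip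
    (mem_of_mem_stiefel hU hZ.1) hG
  have hWb := frobNorm_sub_le_of_mem_proxSet hU hLip hℓ hlam hL.le hb hX hZ
  have hriem := frobInner_riemannian_le hX hZ.1 hGL
  have hmin := hZ.2 X hX
  rw [surrogate_sq hℓ hb hX, (isLeast_moreau hU hLip hℓ hb hX).2, pairAvg_add,
    pairAvg_const hℓ, pairAvg_const_mul]
  rw [proxObj_self hℓ hb hX] at hmin
  rw [proxObj_eq hℓ hb hX] at hmin ⊢
  set Z := prox f C lam X with hZdef
  have hW : (2 * ℓ - 1) * frobNorm (Z - X) ≤ 2 := by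
    have h3 : (2 * ℓ - 1) * L < ℓ / (2 * lam) := by linarith
    rw [lt_div_iff₀ (by positivity)] at h3
    have h4 : (0 : ℝ) ≤ 2 * ℓ - 1 := by linarith
    refine (mul_le_mul_of_nonneg_left hWb h4).trans ?_
    rw [← mul_div_assoc, div_le_iff₀ (by positivity)]
    linarith
  have havg := pairAvg_stepBound_le hℓ hb hL ht hX hGL hW
  have hWq := frobInner_self_le_blockQuad hℓ b X (Z - X)
  generalize pairAvg ℓ (fun s => stepBound b L t X G (Z - X) (s.biUnion C)) = A at *
  generalize frobInner (Z - X) (G - X * (Xᵀ * G)) = m₁ at *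
  generalize frobInner (Xᵀ * (Z - X)) (skewPart X G) = m₂ at *
  generalize blockQuad b X (Z - X) = q at *
  generalize frobInner (Z - X) (Z - X) = w at *
  generalize frobInner G (Z - X) = g at *
  set ε := 9 / 2 * L ^ 2 * t ^ 2 + ℓ * L ^ 3 * t ^ 3 + ℓ * L ^ 4 * t ^ 4 / 4 with hε
  have h3 : m₁ + m₂ + (ℓ - 2) * L * w ≤
      -(ℓ / (4 * lam) * q) + (τ + (2 * ℓ - 3) * L) / 2 * q := by
    have h4 : (τ + (2 * ℓ - 3) * L) / 2 * w ≤ (τ + (2 * ℓ - 3) * L) / 2 * q := by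
      refine mul_le_mul_of_nonneg_left hWq ?_
      have : 0 ≤ (2 * ℓ - 3) * L := mul_nonneg (by linarith) hL.le
      linarith
    linarith
  have h4 := mul_le_mul_of_nonneg_left h3 (by positivity : 0 ≤ 2 * t)
  have h5 : ℓ / 2 * A ≤ ℓ / 2 * q +
      2 * t * (-(ℓ / (4 * lam) * q) + (τ + (2 * ℓ - 3) * L) / 2 * q) + ε := by linarith
  have h6 := mul_le_mul_of_nonneg_left h5 (by positivity : 0 ≤ 1 / (2 * lam))
  have e1 : ℓ / (4 * lam) * A = 1 / (2 * lam) * (ℓ / 2 * A) := by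
    ring
  have e2 : 1 / (2 * lam) * (ℓ / 2 * q +
      2 * t * (-(ℓ / (4 * lam) * q) + (τ + (2 * ℓ - 3) * L) / 2 * q) + ε) =
      ℓ / (4 * lam) * q - t * (lam / ℓ * (ℓ / (2 * lam) - (τ + (2 * ℓ - 3) * L))) *
        (1 / lam ^ 2 * (ℓ / 2 * q)) + ε / (2 * lam) := by
    field_simp
    ring
  rw [e1]
  linarith

/-- The expected envelope decreases by a multiple of the expected squared stationarity measure, up
to terms of second order in the stepsize. -/
theorem expected_descent [IsProbabilityMeasure μ] (hτ : 0 ≤ τ)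
    (hU : U ∈ 𝓝ˢ (stiefel n (Fin p)))
    (hconv : ConvexOn ℝ U fun X => f X + τ / 2 * frobNorm X ^ 2)
    (hLip : ∀ X ∈ U, ∀ Y ∈ U, |f X - f Y| ≤ L * frobNorm (X - Y)) (hℓ : 2 ≤ ℓ) (hlam : 0 < lam)
    (hL : 0 < L) (hlam2 : τ + (2 * ℓ - 1) * L < ℓ / (2 * lam))
    (hb : ∀ a i, a ∈ C i ↔ b a = i) (hrun : IsRun μ ℱ f L C γ X₀ X G S) (k : ℕ) :
    ∫ ω, moreau f C lam (X (k + 1) ω) ∂μ ≤ ∫ ω, moreau f C lam (X k ω) ∂μ -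
      γ k * (lam / ℓ * (ℓ / (2 * lam) - (τ + (2 * ℓ - 3) * L))) *
        ∫ ω, surrogate f C lam (X k ω) ^ 2 ∂μ +
      (9 / 2 * L ^ 2 * γ k ^ 2 + ℓ * L ^ 3 * γ k ^ 3 + ℓ * L ^ 4 * γ k ^ 4 / 4) / (2 * lam) := by
  have hp := continuousOn_prox (C := C) hτ hU hconv hLip hℓ hlam hL.le hlam2 hb
  have hGL : ∀ ω, frobNorm (G k ω) ≤ L := fun ω => frobNorm_clarkeSubdiff_le
    (mem_nhds_of_mem_stiefel hU (hrun.mem_stiefel k ω)) hLip hL.le (hrun.subgradient_mem k ω)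
  have hmor : ∀ j, Integrable (fun ω => moreau f C lam (X j ω)) μ := fun j =>
    memLp_one_iff_integrable.mp (memLp_comp_of_continuousOn isCompact_stiefel
      (continuousOn_moreau hτ hU hconv hLip hℓ hlam hL.le hlam2 hb)
      ((hrun.adapted_iterate j).mono (ℱ.le j)) (hrun.mem_stiefel j) 1)
  have hsur : Integrable (fun ω => surrogate f C lam (X k ω) ^ 2) μ :=
    memLp_one_iff_integrable.mp (memLp_comp_of_continuousOn isCompact_stiefel
      ((continuousOn_surrogate hτ hU hconv hLip hℓ hlam hL.le hlam2 hb).pow 2)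
      ((hrun.adapted_iterate k).mono (ℱ.le k)) (hrun.mem_stiefel k) 1)
  set φ : Finset (Fin ℓ) → Matrix (Fin n) (Fin p) ℝ × Matrix (Fin n) (Fin p) ℝ → ℝ :=
    fun s q => f (prox f C lam q.1) + ℓ / (4 * lam) *
      stepBound b L (γ k) q.1 q.2 (prox f C lam q.1 - q.1) (s.biUnion C) with hφ
  set Φ : Finset (Fin ℓ) → Ω → ℝ := fun s ω => φ s (X k ω, G k ω) with hΦ
  have hφc : ∀ s, ContinuousOn (φ s) (stiefel n (Fin p) ×ˢ {G | frobNorm G ≤ L}) := by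
    intro s
    have hmaps : Set.MapsTo (Prod.fst : Matrix (Fin n) (Fin p) ℝ × Matrix (Fin n) (Fin p) ℝ → _)
        (stiefel n (Fin p) ×ˢ {G | frobNorm G ≤ L}) (stiefel n (Fin p)) := fun q hq => hq.1
    have h1 := hp.comp continuousOn_fst hmaps
    have h2 : ContinuousOn (fun q : Matrix (Fin n) (Fin p) ℝ × Matrix (Fin n) (Fin p) ℝ =>
        f (prox f C lam q.1)) (stiefel n (Fin p) ×ˢ {G | frobNorm G ≤ L}) :=
      (continuousOn_of_lipschitz hU hLip).comp h1
        fun q hq => (prox_mem_proxSet hU hLip hℓ hb hq.1).1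
    have h3 := (continuous_stepBound b L (γ k) (s.biUnion C)).comp_continuousOn
      ((continuousOn_fst (s := stiefel n (Fin p) ×ˢ {G : Matrix (Fin n) (Fin p) ℝ |
        frobNorm G ≤ L})).prodMk (continuousOn_snd.prodMk (h1.sub continuousOn_fst)))
    exact h2.add (continuousOn_const.mul h3)
  have hmemK : ∀ ω, (X k ω, G k ω) ∈ stiefel n (Fin p) ×ˢ {G | frobNorm G ≤ L} :=
    fun ω => ⟨hrun.mem_stiefel k ω, hGL ω⟩
  have hpair := (hrun.adapted_iterate k).prodMk (hrun.adapted_subgradient k)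
  have hΦm : ∀ s, StronglyMeasurable[ℱ k] (Φ s) := fun s =>
    stronglyMeasurable_comp_of_continuousOn (hφc s) hpair hmemK
  have hΦi : ∀ s, Integrable (Φ s) μ := fun s =>
    memLp_one_iff_integrable.mp (memLp_comp_of_continuousOn
      (isCompact_stiefel.prod (isCompact_frobNorm_le n p L)) (hφc s)
      (hpair.mono (ℱ.le k)) hmemK 1)
  obtain ⟨hi, he⟩ := integral_random_pair (hrun.pair_measurable k) (hrun.pair_mem k)
    (hrun.pair_uniform k) (hrun.pair_indep k) hΦm hΦi
  have hstep : ∀ ω, moreau f C lam (X (k + 1) ω) ≤ Φ (S k ω) ω := by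
    intro ω
    have hZ := (prox_mem_proxSet (lam := lam) hU hLip hℓ hb (hrun.mem_stiefel k ω)).1
    refine (moreau_le hU hLip hℓ hb (hrun.mem_stiefel (k + 1) ω) hZ).trans ?_
    have h1 := blockQuad_step_le hℓ hb hL (hrun.stepsize_pos k).le (hrun.mem_stiefel k ω) hZ
      (hGL ω) (hrun.step k ω)
    exact add_le_add_right (mul_le_mul_of_nonneg_left h1 (by positivity)) _
  have hcont : Integrable (fun ω => pairAvg ℓ (fun s => Φ s ω)) μ :=
    (integrable_finsetSum _ fun s _ => hΦi s).const_mul _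
  calc ∫ ω, moreau f C lam (X (k + 1) ω) ∂μ ≤ ∫ ω, Φ (S k ω) ω ∂μ :=
        integral_mono (hmor (k + 1)) hi hstep
    _ = ∫ ω, pairAvg ℓ (fun s => Φ s ω) ∂μ := he
    _ ≤ ∫ ω, (moreau f C lam (X k ω) -
        γ k * (lam / ℓ * (ℓ / (2 * lam) - (τ + (2 * ℓ - 3) * L))) *
          surrogate f C lam (X k ω) ^ 2 +
        (9 / 2 * L ^ 2 * γ k ^ 2 + ℓ * L ^ 3 * γ k ^ 3 + ℓ * L ^ 4 * γ k ^ 4 / 4) /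
          (2 * lam)) ∂μ :=
      integral_mono hcont (((hmor k).sub (hsur.const_mul _)).add (integrable_const _)) fun ω =>
        pairAvg_envelope_le hτ hU hconv hLip hℓ hlam hL hlam2 hb (hrun.mem_stiefel k ω)
          (hrun.subgradient_mem k ω) (hrun.stepsize_pos k).le
    _ = _ := by
      have hd : Integrable (fun ω => moreau f C lam (X k ω) -
          γ k * (lam / ℓ * (ℓ / (2 * lam) - (τ + (2 * ℓ - 3) * L))) *
            surrogate f C lam (X k ω) ^ 2) μ := (hmor k).sub (hsur.const_mul _)
      rw [integral_add hd (integrable_const _), integral_sub (hmor k) (hsur.const_mul _),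
        integral_const_mul, integral_const]
      simp

end Descent

/-! ### Summation over the iterations -/

section Summation

theorem minUpTo_le {T k : ℕ} (a : ℕ → ℝ) (hk : k ≤ T) : minUpTo T a ≤ a k :=
  Finset.inf'_le a (Finset.mem_range_succ_iff.mpr hk)

theorem exists_minUpTo_eq (T : ℕ) (a : ℕ → ℝ) : ∃ k, k ≤ T ∧ minUpTo T a = a k := by
  obtain ⟨k, hk, he⟩ := Finset.exists_mem_eq_inf' (Finset.nonempty_range_add_one (n := T)) a
  exact ⟨k, Finset.mem_range_succ_iff.mp hk, he⟩

/-- Telescoping a descent inequality bounds the smallest of the `a k`. -/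
theorem minUpTo_le_of_descent {T : ℕ} {a F γ d : ℕ → ℝ} {c Γ N Fmin : ℝ}
    (hdesc : ∀ k, F (k + 1) ≤ F k - γ k * c * a k + d k) (ha : ∀ k, 0 ≤ a k)
    (hγ : ∀ k, 0 ≤ γ k) (hc : 0 < c) (hΓ : 0 < Γ) (hΓle : Γ ≤ ∑ k ∈ Finset.range (T + 1), γ k)
    (hmin : Fmin ≤ F (T + 1)) (hN : F 0 - Fmin + ∑ k ∈ Finset.range (T + 1), d k ≤ N) :
    minUpTo T a ≤ N / (c * Γ) := by
  have htel : ∀ m, c * ∑ k ∈ Finset.range m, γ k * a k ≤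
      F 0 - F m + ∑ k ∈ Finset.range m, d k := by
    intro m
    induction m with
    | zero => simp
    | succ m ih =>
      rw [Finset.sum_range_succ, Finset.sum_range_succ]
      linarith [hdesc m]
  have hm0 : 0 ≤ minUpTo T a := by
    obtain ⟨k, -, hk⟩ := exists_minUpTo_eq T a
    rw [hk]; exact ha k
  have h1 : (∑ k ∈ Finset.range (T + 1), γ k) * minUpTo T a ≤
      ∑ k ∈ Finset.range (T + 1), γ k * a k := by
    rw [Finset.sum_mul]
    exact Finset.sum_le_sum fun k hk => mul_le_mul_of_nonneg_left
      (minUpTo_le a (Finset.mem_range_succ_iff.mp hk)) (hγ k)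
  rw [le_div_iff₀ (by positivity)]
  have h2 := mul_le_mul_of_nonneg_left ((mul_le_mul_of_nonneg_right hΓle hm0).trans h1) hc.le
  linarith [htel (T + 1)]

theorem sum_inv_le (N : ℕ) :
    ∑ k ∈ Finset.range N, 1 / ((k : ℝ) + 1) ≤ 1 + Real.log N := by
  have h := harmonic_le_one_add_log N
  rw [harmonic] at h
  push_cast at h
  simpa only [one_div] using h

theorem sum_inv_sq_le (N : ℕ) :
    ∑ k ∈ Finset.range (N + 1), 1 / ((k : ℝ) + 1) ^ 2 ≤ 2 - 1 / ((N : ℝ) + 1) := by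
  induction N with
  | zero => norm_num
  | succ N ih =>
    rw [Finset.sum_range_succ]
    push_cast
    have h : 1 / ((N : ℝ) + 1 + 1) ^ 2 ≤ 1 / (N + 1) - 1 / (N + 1 + 1) := by
      rw [div_sub_div _ _ (by positivity) (by positivity), div_le_div_iff₀ (by positivity)
        (by positivity)]
      nlinarith
    linarith

theorem sum_inv_mul_sqrt_le (N : ℕ) :
    ∑ k ∈ Finset.range (N + 1), 1 / √((k : ℝ) + 1) ^ 3 ≤ 3 - 2 / √(N + 1) := by
  induction N with
  | zero => norm_num
  | succ N ih =>
    rw [Finset.sum_range_succ]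
    push_cast
    have hu : 0 < √((N : ℝ) + 1) := Real.sqrt_pos.mpr (by positivity)
    have hv : 0 < √((N : ℝ) + 1 + 1) := Real.sqrt_pos.mpr (by positivity)
    have hu2 : √((N : ℝ) + 1) ^ 2 = N + 1 := Real.sq_sqrt (by positivity)
    have hv2 : √((N : ℝ) + 1 + 1) ^ 2 = N + 1 + 1 := Real.sq_sqrt (by positivity)
    have huv : √((N : ℝ) + 1) ≤ √((N : ℝ) + 1 + 1) := Real.sqrt_le_sqrt (by linarith)
    generalize √((N : ℝ) + 1) = x at *
    generalize √((N : ℝ) + 1 + 1) = y at *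
    have h : 1 / y ^ 3 ≤ 2 / x - 2 / y := by
      have h1 : (y - x) * (y + x) = 1 := by linear_combination hv2 - hu2
      have h2 : x ≤ 2 * y ^ 2 * (y - x) := by
        refine le_of_mul_le_mul_right ?_ (by linarith : 0 < y + x)
        rw [mul_assoc, h1]
        nlinarith
      rw [div_sub_div _ _ hu.ne' hv.ne', div_le_div_iff₀ (by positivity) (by positivity)]
      nlinarith
    linarith

/-- Jensen's inequality for the square. -/
theorem integral_le_sqrt {Ω : Type*} {mΩ : MeasurableSpace Ω} {μ : Measure Ω}
    [IsProbabilityMeasure μ] {Y : Ω → ℝ} (hY : MemLp Y 2 μ) :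
    ∫ ω, Y ω ∂μ ≤ √(∫ ω, Y ω ^ 2 ∂μ) := by
  refine Real.le_sqrt_of_sq_le ?_
  have h := variance_nonneg Y μ
  rw [variance_eq_sub hY] at h
  simpa using h

end Summation

/-! ### Stationarity bounds -/

section Bounds

variable {n p ℓ : ℕ} {f : Matrix (Fin n) (Fin p) ℝ → ℝ} {τ L lam : ℝ}
  {C : Fin ℓ → Finset (Fin p)}
  {Ω : Type*} {mΩ : MeasurableSpace Ω} {μ : Measure Ω} {ℱ : Filtration ℕ mΩ} {γ : ℕ → ℝ}
  {X₀ : Matrix (Fin n) (Fin p) ℝ} {X G : ℕ → Ω → Matrix (Fin n) (Fin p) ℝ}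
  {S : ℕ → Ω → Finset (Fin ℓ)}

theorem lt_div_two_mul_of_lt (hτ : 0 ≤ τ) (hL : 0 < L) (hℓ : 2 ≤ ℓ) (hlam : 0 < lam)
    (h : lam < ℓ / (2 * (τ + (2 * ℓ - 1) * L))) : τ + (2 * ℓ - 1) * L < ℓ / (2 * lam) := by
  have h2 : (2 : ℝ) ≤ ℓ := by exact_mod_cast hℓ
  have hA : 0 < (2 * (ℓ : ℝ) - 1) * L := mul_pos (by linarith) hL
  rw [lt_div_iff₀ (by linarith)] at h
  rw [lt_div_iff₀ (by linarith)]
  linarith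

theorem existsUnique_mem_proxSet (hτ : 0 ≤ τ) (hL : 0 < L) (hℓ : 2 ≤ ℓ)
    (hf : WeaklyConvexLipschitz f τ L) (hC : IsBlockPartition C) (hlam : 0 < lam)
    (hlam2 : lam < ℓ / (2 * (τ + (2 * ℓ - 1) * L))) {Y : Matrix (Fin n) (Fin p) ℝ}
    (hY : Y ∈ stiefel n (Fin p)) : ∃! Z, Z ∈ proxSet f C lam Y := by
  obtain ⟨b, hb⟩ := hC.exists_label
  obtain ⟨U, hU, -, hconv, hLip⟩ := hf
  obtain ⟨Z, hZ⟩ := nonempty_proxSet (lam := lam) hU hLip hℓ hb hY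
  exact ⟨Z, hZ, fun Z' hZ' => proxSet_subsingleton hτ hU hconv hLip hℓ hlam hL.le
    (lt_div_two_mul_of_lt hτ hL hℓ hlam hlam2) hb hY hZ hZ'⟩

theorem memLp_surrogate [IsProbabilityMeasure μ] (hτ : 0 ≤ τ) (hL : 0 < L) (hℓ : 2 ≤ ℓ)
    (hf : WeaklyConvexLipschitz f τ L) (hC : IsBlockPartition C) (hlam : 0 < lam)
    (hlam2 : lam < ℓ / (2 * (τ + (2 * ℓ - 1) * L))) (hrun : IsRun μ ℱ f L C γ X₀ X G S)
    (k : ℕ) : MemLp (fun ω => surrogate f C lam (X k ω)) 2 μ := by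
  obtain ⟨b, hb⟩ := hC.exists_label
  obtain ⟨U, hU, -, hconv, hLip⟩ := hf
  exact memLp_comp_of_continuousOn isCompact_stiefel
    (continuousOn_surrogate hτ hU hconv hLip hℓ hlam hL.le
      (lt_div_two_mul_of_lt hτ hL hℓ hlam hlam2) hb)
    ((hrun.adapted_iterate k).mono (ℱ.le k)) (hrun.mem_stiefel k) 2

theorem moreau_sub_moreauMin_nonneg (hℓ : 2 ≤ ℓ) (hf : WeaklyConvexLipschitz f τ L)
    (hC : IsBlockPartition C) (hlam : 0 < lam) (hX : X₀ ∈ stiefel n (Fin p)) :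
    0 ≤ moreau f C lam X₀ - moreauMin f C lam := by
  obtain ⟨b, hb⟩ := hC.exists_label
  obtain ⟨U, hU, -, -, hLip⟩ := hf
  exact sub_nonneg.mpr (moreauMin_le hU hLip hℓ hlam hb hX)

/-- The initial gap of the envelope is at most that of the objective. -/
theorem moreau_sub_moreauMin_le (hℓ : 2 ≤ ℓ) (hf : WeaklyConvexLipschitz f τ L)
    (hC : IsBlockPartition C) (hlam : 0 < lam) (hX : X₀ ∈ stiefel n (Fin p)) {B : ℝ}
    (hB : ∀ Y ∈ stiefel n (Fin p), f X₀ - f Y ≤ B) :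
    moreau f C lam X₀ - moreauMin f C lam ≤ B := by
  obtain ⟨b, hb⟩ := hC.exists_label
  obtain ⟨U, hU, -, -, hLip⟩ := hf
  have h1 := moreau_le_self (lam := lam) hU hLip hℓ hb hX
  have h2 := le_moreauMin_of_le (c := f X₀ - B) hU hLip hℓ hlam hb
    (fun Y hY => by linarith [hB Y hY]) hX
  linarith

/-- The expected stationarity of the best iterate, for general stepsizes. -/
theorem minUpTo_surrogate_sq_le [IsProbabilityMeasure μ] (hτ : 0 ≤ τ) (hL : 0 < L) (hℓ : 2 ≤ ℓ)
    (hf : WeaklyConvexLipschitz f τ L) (hC : IsBlockPartition C) (hlam : 0 < lam)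
    (hlam2 : lam < ℓ / (2 * (τ + (2 * ℓ - 1) * L))) (hrun : IsRun μ ℱ f L C γ X₀ X G S)
    {T : ℕ} {Γ N : ℝ} (hΓ : 0 < Γ) (hΓle : Γ ≤ ∑ k ∈ Finset.range (T + 1), γ k)
    (hN : ∑ k ∈ Finset.range (T + 1), (9 / 2 * L ^ 2 * γ k ^ 2 + ℓ * L ^ 3 * γ k ^ 3 +
      ℓ * L ^ 4 * γ k ^ 4 / 4) / (2 * lam) ≤ N) :
    minUpTo T (fun k => ∫ ω, surrogate f C lam (X k ω) ^ 2 ∂μ) ≤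
      (moreau f C lam X₀ - moreauMin f C lam + N) /
        (lam / ℓ * (ℓ / (2 * lam) - (τ + (2 * ℓ - 3) * L)) * Γ) := by
  have hlam3 := lt_div_two_mul_of_lt hτ hL hℓ hlam hlam2
  obtain ⟨b, hb⟩ := hC.exists_label
  obtain ⟨U, hU, -, hconv, hLip⟩ := hf
  have h2 : (2 : ℝ) ≤ ℓ := by exact_mod_cast hℓ
  have hmor : ∀ j, Integrable (fun ω => moreau f C lam (X j ω)) μ := fun j =>
    memLp_one_iff_integrable.mp (memLp_comp_of_continuousOn isCompact_stiefel
      (continuousOn_moreau hτ hU hconv hLip hℓ hlam hL.le hlam3 hb)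
      ((hrun.adapted_iterate j).mono (ℱ.le j)) (hrun.mem_stiefel j) 1)
  refine minUpTo_le_of_descent (F := fun k => ∫ ω, moreau f C lam (X k ω) ∂μ)
    (Fmin := moreauMin f C lam)
    (expected_descent hτ hU hconv hLip hℓ hlam hL hlam3 hb hrun)
    (fun k => integral_nonneg fun ω => sq_nonneg _) (fun k => (hrun.stepsize_pos k).le) ?_ hΓ
    hΓle ?_ ?_
  · have : τ + (2 * ℓ - 3) * L < ℓ / (2 * lam) := by linarith
    exact mul_pos (by positivity) (sub_pos.mpr this)
  · have h := integral_mono (integrable_const (moreauMin f C lam)) (hmor (T + 1))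
      fun ω => moreauMin_le hU hLip hℓ hlam hb (hrun.mem_stiefel (T + 1) ω)
    simpa using h
  · have : ∫ ω, moreau f C lam (X 0 ω) ∂μ = moreau f C lam X₀ := by
      simp [hrun.init_eq]
    simp only [this]
    linarith

theorem minUpTo_le_const_stepsize [IsProbabilityMeasure μ] (hτ : 0 ≤ τ) (hL : 0 < L) (hℓ : 2 ≤ ℓ)
    (hf : WeaklyConvexLipschitz f τ L) (hC : IsBlockPartition C) (hlam : 0 < lam)
    (hlam2 : lam < ℓ / (2 * (τ + (2 * ℓ - 1) * L))) (hrun : IsRun μ ℱ f L C γ X₀ X G S)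
    {T : ℕ} {Δ : ℝ} (hΔ : 0 < Δ) (hγ : ∀ k ≤ T, γ k = Δ / √(ℓ * (T + 1))) :
    minUpTo T (fun k => ∫ ω, surrogate f C lam (X k ω) ^ 2 ∂μ) ≤
      (moreau f C lam X₀ - moreauMin f C lam
          + 9 * L ^ 2 * Δ ^ 2 / (2 * lam * ℓ)
          + 2 * L ^ 3 * Δ ^ 3 / (lam * √(ℓ * (T + 1)))
          + L ^ 4 * Δ ^ 4 / (2 * lam * ℓ * (T + 1)))
        / (lam / ℓ * (ℓ / (2 * lam) - (τ + (2 * ℓ - 3) * L)) * (Δ / √ℓ * √(T + 1))) := by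
  have h2 : (2 : ℝ) ≤ ℓ := by exact_mod_cast hℓ
  have hr : 0 < √((ℓ : ℝ) * (T + 1)) := Real.sqrt_pos.mpr (by positivity)
  have hr2 : √((ℓ : ℝ) * (T + 1)) ^ 2 = ℓ * (T + 1) := Real.sq_sqrt (by positivity)
  have hℓs : 0 < √(ℓ : ℝ) := Real.sqrt_pos.mpr (by linarith)
  have hTs : 0 < √((T : ℝ) + 1) := Real.sqrt_pos.mpr (by positivity)
  have hsum : ∀ g : ℝ → ℝ, ∑ k ∈ Finset.range (T + 1), g (γ k) =
      (T + 1) * g (Δ / √(ℓ * (T + 1))) := by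
    intro g
    rw [Finset.sum_congr rfl fun k hk => congrArg g (hγ k (Finset.mem_range_succ_iff.mp hk)),
      Finset.sum_const, Finset.card_range, nsmul_eq_mul]
    push_cast
    ring
  rw [add_assoc (moreau f C lam X₀ - moreauMin f C lam),
    add_assoc (moreau f C lam X₀ - moreauMin f C lam)]
  refine minUpTo_surrogate_sq_le hτ hL hℓ hf hC hlam hlam2 hrun (by positivity) ?_ ?_
  · have h := hsum id
    simp only [id] at h
    rw [h, Real.sqrt_mul (by positivity)]
    have : √((T : ℝ) + 1) ^ 2 = T + 1 := Real.sq_sqrt (by positivity)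
    refine le_of_eq ?_
    field_simp
    rw [this]
  · rw [hsum fun x => (9 / 2 * L ^ 2 * x ^ 2 + ℓ * L ^ 3 * x ^ 3 + ℓ * L ^ 4 * x ^ 4 / 4) /
      (2 * lam)]
    have e1 : (9 : ℝ) * L ^ 2 * Δ ^ 2 / (2 * lam * ℓ) =
        (T + 1) * (9 * L ^ 2 * Δ ^ 2 / (2 * lam)) / (ℓ * (T + 1)) := by
      field_simp
    have e2 : L ^ 4 * Δ ^ 4 / (2 * lam * ℓ * (T + 1)) =
        L ^ 4 * Δ ^ 4 / (2 * lam * (ℓ * (T + 1))) := by rw [mul_assoc (2 * lam)]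
    have e3 : (T : ℝ) + 1 = √((ℓ : ℝ) * (T + 1)) ^ 2 / ℓ := by
      rw [hr2]; field_simp
    generalize √((ℓ : ℝ) * (T + 1)) = r at *
    rw [e1, e2, ← hr2, e3]
    have e4 : r ^ 2 / ℓ * ((9 / 2 * L ^ 2 * (Δ / r) ^ 2 + ℓ * L ^ 3 * (Δ / r) ^ 3 +
        ℓ * L ^ 4 * (Δ / r) ^ 4 / 4) / (2 * lam)) =
        1 / 2 * (r ^ 2 / ℓ * (9 * L ^ 2 * Δ ^ 2 / (2 * lam)) / r ^ 2) +
        1 / 4 * (2 * L ^ 3 * Δ ^ 3 / (lam * r)) + 1 / 4 * (L ^ 4 * Δ ^ 4 / (2 * lam * r ^ 2)) := by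
      field_simp
      ring
    rw [e4]
    have p1 : 0 ≤ r ^ 2 / ℓ * (9 * L ^ 2 * Δ ^ 2 / (2 * lam)) / r ^ 2 := by positivity
    have p2 : 0 ≤ 2 * L ^ 3 * Δ ^ 3 / (lam * r) := by positivity
    have p3 : 0 ≤ L ^ 4 * Δ ^ 4 / (2 * lam * r ^ 2) := by positivity
    linarith

theorem minUpTo_le_diminishing_stepsize [IsProbabilityMeasure μ] (hτ : 0 ≤ τ) (hL : 0 < L)
    (hℓ : 2 ≤ ℓ) (hf : WeaklyConvexLipschitz f τ L) (hC : IsBlockPartition C) (hlam : 0 < lam)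
    (hlam2 : lam < ℓ / (2 * (τ + (2 * ℓ - 1) * L))) (hrun : IsRun μ ℱ f L C γ X₀ X G S)
    {T : ℕ} (hT : 1 ≤ T) {Δmin : ℝ} {δ : ℕ → ℝ} (hΔ : 0 < Δmin)
    (hγ : ∀ k ≤ T, Δmin ≤ δ k ∧ δ k ≤ 1 / L ∧ γ k = δ k / √(ℓ * (k + 1))) :
    minUpTo T (fun k => ∫ ω, surrogate f C lam (X k ω) ^ 2 ∂μ) ≤
      (moreau f C lam X₀ - moreauMin f C lam
          + (9 * (1 + Real.log T) + 6 * √ℓ + 2) / (2 * lam * ℓ))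
        / (lam / ℓ * (ℓ / (2 * lam) - (τ + (2 * ℓ - 3) * L)) * (Δmin / √ℓ * √(T + 1))) := by
  have h2 : (2 : ℝ) ≤ ℓ := by exact_mod_cast hℓ
  have hℓs : 0 < √(ℓ : ℝ) := Real.sqrt_pos.mpr (by linarith)
  have hℓs2 : √(ℓ : ℝ) ^ 2 = ℓ := Real.sq_sqrt (by linarith)
  have hTs : 0 < √((T : ℝ) + 1) := Real.sqrt_pos.mpr (by positivity)
  refine minUpTo_surrogate_sq_le hτ hL hℓ hf hC hlam hlam2 hrun (by positivity) ?_ ?_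
  · have h1 : ∀ k ∈ Finset.range (T + 1), Δmin / √ℓ / √(T + 1) ≤ γ k := by
      intro k hk
      have hkT := Finset.mem_range_succ_iff.mp hk
      obtain ⟨h3, -, h5⟩ := hγ k hkT
      have hks : 0 < √((k : ℝ) + 1) := Real.sqrt_pos.mpr (by positivity)
      have hδ : 0 < δ k := hΔ.trans_le h3
      rw [h5, Real.sqrt_mul (by positivity), ← div_div]
      have h6 : √((k : ℝ) + 1) ≤ √(T + 1) := by
        refine Real.sqrt_le_sqrt ?_
        have : (k : ℝ) ≤ T := by exact_mod_cast hkT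
        linarith
      gcongr
    have h3 := Finset.sum_le_sum h1
    rw [Finset.sum_const, Finset.card_range, nsmul_eq_mul] at h3
    refine le_trans (le_of_eq ?_) h3
    have : √((T : ℝ) + 1) ^ 2 = T + 1 := Real.sq_sqrt (by positivity)
    push_cast
    field_simp
    rw [this]
  · have h1 : ∀ k ∈ Finset.range (T + 1), (9 / 2 * L ^ 2 * γ k ^ 2 + ℓ * L ^ 3 * γ k ^ 3 +
        ℓ * L ^ 4 * γ k ^ 4 / 4) / (2 * lam) ≤
        (9 / 2 * (1 / ((k : ℝ) + 1)) + √ℓ * (1 / √((k : ℝ) + 1) ^ 3) +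
          1 / 4 * (1 / ((k : ℝ) + 1) ^ 2)) / (2 * lam * ℓ) := by
      intro k hk
      obtain ⟨h3, h4, h5⟩ := hγ k (Finset.mem_range_succ_iff.mp hk)
      have hks : 0 < √((k : ℝ) + 1) := Real.sqrt_pos.mpr (by positivity)
      have hk2 : √((k : ℝ) + 1) ^ 2 = k + 1 := Real.sq_sqrt (by positivity)
      have h6 : L * γ k ≤ 1 / (√ℓ * √(k + 1)) := by
        rw [h5, Real.sqrt_mul (by positivity), ← mul_div_assoc]
        refine div_le_div_of_nonneg_right ?_ (by positivity)
        rw [le_div_iff₀ hL] at h4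
        linarith
      have h7 : 0 ≤ L * γ k := mul_nonneg hL.le (hrun.stepsize_pos k).le
      have q2 := pow_le_pow_left₀ h7 h6 2
      have q3 := pow_le_pow_left₀ h7 h6 3
      have q4 := pow_le_pow_left₀ h7 h6 4
      have e : (9 / 2 * (1 / ((k : ℝ) + 1)) + √ℓ * (1 / √((k : ℝ) + 1) ^ 3) +
          1 / 4 * (1 / ((k : ℝ) + 1) ^ 2)) / (2 * lam * ℓ) =
          (9 / 2 * (1 / (√ℓ * √(k + 1))) ^ 2 + ℓ * (1 / (√ℓ * √(k + 1))) ^ 3 +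
            ℓ * (1 / (√ℓ * √(k + 1))) ^ 4 / 4) / (2 * lam) := by
        generalize √((k : ℝ) + 1) = x at *
        rw [← hk2]
        have : (ℓ : ℝ) = √ℓ ^ 2 := hℓs2.symm
        generalize √(ℓ : ℝ) = z at *
        rw [this]
        field_simp
      rw [e]
      refine div_le_div_of_nonneg_right ?_ (by positivity)
      have q3' := mul_le_mul_of_nonneg_left q3 (by linarith : (0 : ℝ) ≤ ℓ)
      have q4' := mul_le_mul_of_nonneg_left q4 (by linarith : (0 : ℝ) ≤ ℓ)
      have m2 := mul_pow L (γ k) 2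
      have m3 := mul_pow L (γ k) 3
      have m4 := mul_pow L (γ k) 4
      rw [m2] at q2
      rw [m3, ← mul_assoc] at q3'
      rw [m4, ← mul_assoc] at q4'
      linarith
    refine (Finset.sum_le_sum h1).trans ?_
    rw [← Finset.sum_div, Finset.sum_add_distrib, Finset.sum_add_distrib, ← Finset.mul_sum,
      ← Finset.mul_sum, ← Finset.mul_sum]
    refine div_le_div_of_nonneg_right ?_ (by positivity)
    have s1 := sum_inv_le (T + 1)
    have s2 := sum_inv_sq_le T
    have s3 := sum_inv_mul_sqrt_le T
    have hT1 : (1 : ℝ) ≤ T := by exact_mod_cast hT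
    -- the sum has one more term than `1 + log T` accounts for; the factor two covers it
    have hlog : Real.log ((T + 1 : ℕ) : ℝ) ≤ Real.log 2 + Real.log T := by
      rw [← Real.log_mul (by norm_num) (by linarith)]
      refine Real.log_le_log (by positivity) ?_
      push_cast
      linarith
    have hlog2 : Real.log 2 ≤ 1 := by linarith [Real.log_two_lt_d9]
    have hlogT := Real.log_nonneg hT1
    have s2' : 0 ≤ 1 / ((T : ℝ) + 1) := by positivity
    have s3' : 0 ≤ 2 / √((T : ℝ) + 1) := by positivity
    have s4 := mul_le_mul_of_nonneg_left s3 hℓs.le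
    have s5 : √(ℓ : ℝ) * (3 - 2 / √(T + 1)) ≤ √ℓ * 3 :=
      mul_le_mul_of_nonneg_left (by linarith) hℓs.le
    linarith

theorem minUpTo_integral_le_sqrt [IsProbabilityMeasure μ] {Θ : ℕ → Ω → ℝ}
    (hΘ : ∀ k, MemLp (Θ k) 2 μ) (T : ℕ) :
    minUpTo T (fun k => ∫ ω, Θ k ω ∂μ) ≤ √(minUpTo T fun k => ∫ ω, Θ k ω ^ 2 ∂μ) := by
  obtain ⟨k, hk, he⟩ := exists_minUpTo_eq T fun k => ∫ ω, Θ k ω ^ 2 ∂μ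
  rw [he]
  exact (minUpTo_le _ hk).trans (integral_le_sqrt (hΘ k))

end Bounds

/-! ### Iteration complexity -/

section Complexity

variable {n p ℓ : ℕ} {f : Matrix (Fin n) (Fin p) ℝ → ℝ} {τ L lam : ℝ}
  {C : Fin ℓ → Finset (Fin p)}
  {Ω : Type*} {mΩ : MeasurableSpace Ω} {μ : Measure Ω} {ℱ : Filtration ℕ mΩ} {γ : ℕ → ℝ}
  {X₀ : Matrix (Fin n) (Fin p) ℝ} {X G : ℕ → Ω → Matrix (Fin n) (Fin p) ℝ}
  {S : ℕ → Ω → Finset (Fin ℓ)}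

/-- For `λ = ℓ / (4 (τ + (2ℓ - 1) L))` the envelope parameter is admissible. -/
theorem special_param_bounds (hτ : 0 ≤ τ) (hL : 0 < L) (hℓ : 2 ≤ ℓ)
    (hlam : lam = ℓ / (4 * (τ + (2 * ℓ - 1) * L))) :
    0 < lam ∧ lam < ℓ / (2 * (τ + (2 * ℓ - 1) * L)) ∧
      ℓ / (4 * lam) = τ + (2 * ℓ - 1) * L ∧ ℓ / (2 * lam) = 2 * (τ + (2 * ℓ - 1) * L) := by
  have h2 : (2 : ℝ) ≤ ℓ := by exact_mod_cast hℓ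
  have hA : 0 < τ + (2 * (ℓ : ℝ) - 1) * L := by
    have : 0 < (2 * (ℓ : ℝ) - 1) * L := mul_pos (by linarith) hL
    linarith
  generalize τ + (2 * (ℓ : ℝ) - 1) * L = A at *
  have hlam0 : 0 < lam := by rw [hlam]; positivity
  refine ⟨hlam0, ?_, ?_, ?_⟩
  · rw [hlam]
    exact div_lt_div_of_pos_left (by linarith) (by linarith) (by linarith)
  · rw [hlam]; field_simp
  · rw [hlam]; field_simp; norm_num

theorem minUpTo_le_special_param [IsProbabilityMeasure μ] (hτ : 0 ≤ τ) (hL : 0 < L) (hℓ : 2 ≤ ℓ)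
    (hf : WeaklyConvexLipschitz f τ L) (hC : IsBlockPartition C)
    (hrun : IsRun μ ℱ f L C γ X₀ X G S) (hlam : lam = ℓ / (4 * (τ + (2 * ℓ - 1) * L))) {T : ℕ}
    (hT : ℓ - 1 ≤ T) {Δ : ℝ} (hΔ : 0 < Δ) (hΔL : Δ ≤ 1 / L)
    (hγ : ∀ k ≤ T, γ k = Δ / √(ℓ * (T + 1))) :
    minUpTo T (fun k => ∫ ω, surrogate f C lam (X k ω) ∂μ) ≤
      √((moreau f C lam X₀ - moreauMin f C lam
          + 9 / (2 * lam * ℓ) + 2 / (lam * ℓ) + 1 / (2 * lam * ℓ ^ 2))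
        / (lam / ℓ * (ℓ / (2 * lam) - ℓ / (4 * lam)) * (Δ / √ℓ * √(T + 1)))) := by
  obtain ⟨hlam0, hlam1, hlam4, hlam2⟩ := special_param_bounds hτ hL hℓ hlam
  have h2 : (2 : ℝ) ≤ ℓ := by exact_mod_cast hℓ
  have hTℓ : (ℓ : ℝ) ≤ T + 1 := by
    have : ℓ ≤ T + 1 := by omega
    exact_mod_cast this
  refine (minUpTo_integral_le_sqrt
    (memLp_surrogate hτ hL hℓ hf hC hlam0 hlam1 hrun) T).trans (Real.sqrt_le_sqrt ?_)
  refine (minUpTo_le_const_stepsize hτ hL hℓ hf hC hlam0 hlam1 hrun hΔ hγ).trans ?_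
  have hgap := moreau_sub_moreauMin_nonneg hℓ hf hC hlam0 hrun.init_mem
  have hℓs : 0 < √(ℓ : ℝ) := Real.sqrt_pos.mpr (by linarith)
  have hTs : 0 < √((T : ℝ) + 1) := Real.sqrt_pos.mpr (by positivity)
  have hLΔ : L * Δ ≤ 1 := by rwa [le_div_iff₀' hL] at hΔL
  have hLΔ0 : 0 ≤ L * Δ := by positivity
  have hr : (ℓ : ℝ) ≤ √(ℓ * (T + 1)) := by
    refine Real.le_sqrt_of_sq_le ?_
    rw [pow_two]
    exact mul_le_mul_of_nonneg_left hTℓ (by positivity)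
  have hden : 0 < lam / ℓ * (ℓ / (2 * lam) - ℓ / (4 * lam)) := by
    rw [hlam2, hlam4]
    have : 0 < (2 * (ℓ : ℝ) - 1) * L := mul_pos (by linarith) hL
    refine mul_pos (by positivity) (by linarith)
  refine div_le_div₀ (by positivity) ?_ (mul_pos hden (by positivity)) ?_
  · have t1 : 9 * L ^ 2 * Δ ^ 2 / (2 * lam * ℓ) ≤ 9 / (2 * lam * ℓ) := by
      refine div_le_div_of_nonneg_right ?_ (by positivity)
      have := pow_le_one₀ (n := 2) hLΔ0 hLΔ
      rw [mul_pow] at this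
      linarith
    have t2 : 2 * L ^ 3 * Δ ^ 3 / (lam * √(ℓ * (T + 1))) ≤ 2 / (lam * ℓ) := by
      refine div_le_div₀ (by norm_num) ?_ (by positivity)
        (mul_le_mul_of_nonneg_left hr hlam0.le)
      have := pow_le_one₀ (n := 3) hLΔ0 hLΔ
      rw [mul_pow] at this
      linarith
    have t3 : L ^ 4 * Δ ^ 4 / (2 * lam * ℓ * (T + 1)) ≤ 1 / (2 * lam * ℓ ^ 2) := by
      refine div_le_div₀ (by norm_num) ?_ (by positivity) ?_
      · have := pow_le_one₀ (n := 4) hLΔ0 hLΔ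
        rwa [mul_pow] at this
      · rw [pow_two, ← mul_assoc]
        exact mul_le_mul_of_nonneg_left hTℓ (by positivity)
    linarith
  · refine mul_le_mul_of_nonneg_right ?_ (by positivity)
    refine mul_le_mul_of_nonneg_left ?_ (by positivity)
    rw [hlam4]
    linarith

/-- The complexity constant: with `N = |B| + 28 (τ + 2L)` bounding the numerator of the
constant-stepsize bound uniformly in `ℓ` and `T`, `K = (4N/Δ)²` suffices. -/
theorem minUpTo_le_of_iterations [IsProbabilityMeasure μ] (hτ : 0 ≤ τ) (hL : 0 < L) (hℓ : 2 ≤ ℓ)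
    (hf : WeaklyConvexLipschitz f τ L) (hC : IsBlockPartition C)
    (hrun : IsRun μ ℱ f L C γ X₀ X G S) {B Δ ε : ℝ} (hΔ : 0 < Δ) (hΔL : Δ ≤ 1 / L)
    (hB : ∀ Y ∈ stiefel n (Fin p), f X₀ - f Y ≤ B) (hε : 0 < ε) {T : ℕ}
    (hT : (4 * (|B| + 28 * (τ + 2 * L)) / Δ) ^ 2 * (ℓ * ε⁻¹ ^ 4) ≤ T)
    (hγ : ∀ k ≤ T, γ k = Δ / √(ℓ * (T + 1))) :
    minUpTo T (fun k => ∫ ω,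
      surrogate f C (ℓ / (4 * (τ + (2 * ℓ - 1) * L))) (X k ω) ∂μ) ≤ ε := by
  obtain ⟨lam, hlam⟩ : ∃ lam : ℝ, lam = ℓ / (4 * (τ + (2 * ℓ - 1) * L)) := ⟨_, rfl⟩
  obtain ⟨hlam0, hlam1, hlam4, hlam2⟩ := special_param_bounds hτ hL hℓ hlam
  rw [← hlam]
  have h2 : (2 : ℝ) ≤ ℓ := by exact_mod_cast hℓ
  refine (minUpTo_integral_le_sqrt
    (memLp_surrogate hτ hL hℓ hf hC hlam0 hlam1 hrun) T).trans ?_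
  rw [Real.sqrt_le_left hε.le]
  refine (minUpTo_le_const_stepsize hτ hL hℓ hf hC hlam0 hlam1 hrun hΔ hγ).trans ?_
  have hgap := (moreau_sub_moreauMin_le hℓ hf hC hlam0 hrun.init_mem hB).trans (le_abs_self B)
  have hℓs : 0 < √(ℓ : ℝ) := Real.sqrt_pos.mpr (by linarith)
  have hLΔ : L * Δ ≤ 1 := by rwa [le_div_iff₀' hL] at hΔL
  have hLΔ0 : 0 ≤ L * Δ := by positivity
  have hT1 : (1 : ℝ) ≤ T + 1 := by linarith [(Nat.cast_nonneg T : (0 : ℝ) ≤ T)]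
  have hr : (1 : ℝ) ≤ √(ℓ * (T + 1)) := by
    rw [Real.one_le_sqrt]
    nlinarith
  set N := |B| + 28 * (τ + 2 * L) with hN
  have hN0 : 0 < N := by
    have := abs_nonneg B
    linarith
  have hlaminv : 1 / lam ≤ 4 * (τ + 2 * L) := by
    rw [div_le_iff₀ hlam0]
    have h := hlam4
    rw [div_eq_iff (by positivity)] at h
    have h1 : τ + (2 * (ℓ : ℝ) - 1) * L ≤ ℓ * (τ + 2 * L) := by nlinarith
    have h3 := mul_le_mul_of_nonneg_right h1 (by positivity : (0 : ℝ) ≤ 4 * lam)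
    refine le_of_mul_le_mul_left ?_ (by linarith : (0 : ℝ) < ℓ)
    linarith
  -- the numerator: its error terms add up to at most `7 / λ ≤ 28 (τ + 2L)`
  have t1 : 9 * L ^ 2 * Δ ^ 2 / (2 * lam * ℓ) ≤ 9 / 2 * (1 / lam) := by
    have : 9 / 2 * (1 / lam) = 9 / (2 * lam) := by ring
    rw [this]
    refine div_le_div₀ (by norm_num) ?_ (by positivity) ?_
    · have := pow_le_one₀ (n := 2) hLΔ0 hLΔ
      rw [mul_pow] at this
      linarith
    · exact le_mul_of_one_le_right (by positivity) (by linarith)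
  have t2 : 2 * L ^ 3 * Δ ^ 3 / (lam * √(ℓ * (T + 1))) ≤ 2 * (1 / lam) := by
    rw [mul_one_div]
    refine div_le_div₀ (by norm_num) ?_ hlam0 (le_mul_of_one_le_right hlam0.le hr)
    have := pow_le_one₀ (n := 3) hLΔ0 hLΔ
    rw [mul_pow] at this
    linarith
  have t3 : L ^ 4 * Δ ^ 4 / (2 * lam * ℓ * (T + 1)) ≤ 1 / 2 * (1 / lam) := by
    have : 1 / 2 * (1 / lam) = 1 / (2 * lam) := by ring
    rw [this]
    refine div_le_div₀ (by norm_num) ?_ (by positivity) ?_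
    · have := pow_le_one₀ (n := 4) hLΔ0 hLΔ
      rwa [mul_pow] at this
    · rw [mul_assoc (2 * lam)]
      refine le_mul_of_one_le_right (by positivity) ?_
      nlinarith
  -- the denominator
  have hcoef : 1 / 4 ≤ lam / ℓ * (ℓ / (2 * lam) - (τ + (2 * ℓ - 3) * L)) := by
    have h3 : lam / ℓ * (ℓ / (4 * lam)) ≤
        lam / ℓ * (ℓ / (2 * lam) - (τ + (2 * ℓ - 3) * L)) := by
      refine mul_le_mul_of_nonneg_left ?_ (by positivity)
      rw [hlam4, hlam2]
      linarith
    refine le_trans (le_of_eq ?_) h3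
    field_simp
  have hsqrt : √ℓ * (4 * N / Δ) * ε⁻¹ ^ 2 ≤ √(T + 1) := by
    refine Real.le_sqrt_of_sq_le ?_
    have : (√(ℓ : ℝ) * (4 * N / Δ) * ε⁻¹ ^ 2) ^ 2 = (4 * N / Δ) ^ 2 * (ℓ * ε⁻¹ ^ 4) := by
      rw [mul_pow, mul_pow, Real.sq_sqrt (by positivity)]
      ring
    linarith
  have hden : 4 * N * ε⁻¹ ^ 2 ≤ Δ / √ℓ * √(T + 1) := by
    have h3 := mul_le_mul_of_nonneg_left hsqrt (by positivity : 0 ≤ Δ / √ℓ)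
    refine le_trans (le_of_eq ?_) h3
    field_simp
  have hprod := mul_le_mul hcoef hden (by positivity)
    (le_trans (by norm_num) hcoef)
  rw [div_le_iff₀ (lt_of_lt_of_le (by positivity) hprod)]
  have hfin := mul_le_mul_of_nonneg_left hprod (sq_nonneg ε)
  have e : ε ^ 2 * (1 / 4 * (4 * N * ε⁻¹ ^ 2)) = N := by
    field_simp
  linarith

end Complexity

end RSSM

end

theorem theorem4p10 (τ L : ℝ) (hτ : 0 ≤ τ) (hL : 0 < L) :
    -- explicit bounds
    (∀ (n p ℓ : ℕ) (_ : 2 ≤ ℓ)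
      (f : Matrix (Fin n) (Fin p) ℝ → ℝ) (_ : RSSM.WeaklyConvexLipschitz f τ L)
      (C : Fin ℓ → Finset (Fin p)) (_ : RSSM.IsBlockPartition C)
      (Ω : Type u) (mΩ : MeasurableSpace Ω) (μ : Measure Ω) (_ : IsProbabilityMeasure μ)
      (ℱ : Filtration ℕ mΩ) (γ : ℕ → ℝ) (X₀ : Matrix (Fin n) (Fin p) ℝ)
      (X G : ℕ → Ω → Matrix (Fin n) (Fin p) ℝ) (S : ℕ → Ω → Finset (Fin ℓ))
      (_ : RSSM.IsRun μ ℱ f L C γ X₀ X G S)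
      (lam : ℝ) (_ : 0 < lam) (_ : lam < ℓ / (2 * (τ + (2 * ℓ - 1) * L)))
      (T : ℕ) (_ : 1 ≤ T),
      -- the adaptive proximal map is single-valued and the expectations below exist
      (∀ Y ∈ RSSM.stiefel n (Fin p), ∃! Z, Z ∈ RSSM.proxSet f C lam Y) ∧
      (∀ k, MemLp (fun ω => RSSM.surrogate f C lam (X k ω)) 2 μ) ∧
      -- constant stepsizes
      (∀ Δ : ℝ, 0 < Δ → Δ ≤ 1 / L →
        (∀ k ≤ T, γ k = Δ / √(ℓ * (T + 1))) →
        RSSM.minUpTo T (fun k => ∫ ω, RSSM.surrogate f C lam (X k ω) ^ 2 ∂μ) ≤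
          (RSSM.moreau f C lam X₀ - RSSM.moreauMin f C lam
              + 9 * L ^ 2 * Δ ^ 2 / (2 * lam * ℓ)
              + 2 * L ^ 3 * Δ ^ 3 / (lam * √(ℓ * (T + 1)))
              + L ^ 4 * Δ ^ 4 / (2 * lam * ℓ * (T + 1)))
            / (lam / ℓ * (ℓ / (2 * lam) - (τ + (2 * ℓ - 3) * L)) * (Δ / √ℓ * √(T + 1)))) ∧
      -- diminishing stepsizes
      (∀ (Δmin : ℝ) (δ : ℕ → ℝ), 0 < Δmin →
        (∀ k ≤ T, Δmin ≤ δ k ∧ δ k ≤ 1 / L ∧ γ k = δ k / √(ℓ * (k + 1))) →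
        RSSM.minUpTo T (fun k => ∫ ω, RSSM.surrogate f C lam (X k ω) ^ 2 ∂μ) ≤
          (RSSM.moreau f C lam X₀ - RSSM.moreauMin f C lam
              + (9 * (1 + Real.log T) + 6 * √ℓ + 2) / (2 * lam * ℓ))
            / (lam / ℓ * (ℓ / (2 * lam) - (τ + (2 * ℓ - 3) * L)) * (Δmin / √ℓ * √(T + 1)))) ∧
      -- constant stepsizes, the special parameter `lam` and at least `ℓ` iterations
      (lam = ℓ / (4 * (τ + (2 * ℓ - 1) * L)) → ℓ - 1 ≤ T → ∀ Δ : ℝ, 0 < Δ → Δ ≤ 1 / L →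
        (∀ k ≤ T, γ k = Δ / √(ℓ * (T + 1))) →
        RSSM.minUpTo T (fun k => ∫ ω, RSSM.surrogate f C lam (X k ω) ∂μ) ≤
          √((RSSM.moreau f C lam X₀ - RSSM.moreauMin f C lam
              + 9 / (2 * lam * ℓ) + 2 / (lam * ℓ) + 1 / (2 * lam * ℓ ^ 2))
            / (lam / ℓ * (ℓ / (2 * lam) - ℓ / (4 * lam)) * (Δ / √ℓ * √(T + 1)))))) ∧
    -- iteration complexity: the constant `K` depends only on `τ`, `L`, `Δ` and a bound `B` for the
    -- initial optimality gap
    (∀ (Δ B : ℝ), 0 < Δ → Δ ≤ 1 / L → ∃ K : ℝ, 0 < K ∧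
      ∀ (n p ℓ : ℕ) (_ : 2 ≤ ℓ)
        (f : Matrix (Fin n) (Fin p) ℝ → ℝ) (_ : RSSM.WeaklyConvexLipschitz f τ L)
        (C : Fin ℓ → Finset (Fin p)) (_ : RSSM.IsBlockPartition C)
        (Ω : Type u) (mΩ : MeasurableSpace Ω) (μ : Measure Ω) (_ : IsProbabilityMeasure μ)
        (ℱ : Filtration ℕ mΩ) (γ : ℕ → ℝ) (X₀ : Matrix (Fin n) (Fin p) ℝ)
        (X G : ℕ → Ω → Matrix (Fin n) (Fin p) ℝ) (S : ℕ → Ω → Finset (Fin ℓ))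
        (_ : RSSM.IsRun μ ℱ f L C γ X₀ X G S)
        (_ : ∀ Y ∈ RSSM.stiefel n (Fin p), f X₀ - f Y ≤ B)
        (ε : ℝ) (_ : 0 < ε) (T : ℕ) (_ : 1 ≤ T) (_ : K * (ℓ * ε⁻¹ ^ 4) ≤ T)
        (_ : ∀ k ≤ T, γ k = Δ / √(ℓ * (T + 1))),
        RSSM.minUpTo T (fun k => ∫ ω,
          RSSM.surrogate f C (ℓ / (4 * (τ + (2 * ℓ - 1) * L))) (X k ω) ∂μ) ≤ ε) := by
  refine ⟨?_, ?_⟩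
  · intro n p ℓ hℓ f hf C hC Ω mΩ μ hμ ℱ γ X₀ X G S hrun lam hlam hlam2 T hT
    refine ⟨fun Y hY => RSSM.existsUnique_mem_proxSet hτ hL hℓ hf hC hlam hlam2 hY,
      fun k => RSSM.memLp_surrogate hτ hL hℓ hf hC hlam hlam2 hrun k, ?_, ?_, ?_⟩
    · intro Δ hΔ _ hγ
      exact RSSM.minUpTo_le_const_stepsize hτ hL hℓ hf hC hlam hlam2 hrun hΔ hγ
    · intro Δmin δ hΔ hγ
      exact RSSM.minUpTo_le_diminishing_stepsize hτ hL hℓ hf hC hlam hlam2 hrun hT hΔ hγ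
    · intro hlam3 hT2 Δ hΔ hΔL hγ
      exact RSSM.minUpTo_le_special_param hτ hL hℓ hf hC hrun hlam3 hT2 hΔ hΔL hγ
  · intro Δ B hΔ hΔL
    refine ⟨(4 * (|B| + 28 * (τ + 2 * L)) / Δ) ^ 2, by positivity, ?_⟩
    intro n p ℓ hℓ f hf C hC Ω mΩ μ hμ ℱ γ X₀ X G S hrun hB ε hε T _ hT hγ
    exact RSSM.minUpTo_le_of_iterations hτ hL hℓ hf hC hrun hΔ hΔL hB hε hT hγ
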